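/- Let $M$ be a compact connected $3$-manifold (possibly with boundary) with a finite (simplicial) triangulation $\mathcal T=\{V,E,F,T\}$ into tetrahedra ($E,F$ being the edges and faces of the tetrahedra in $T$), $N=|V|$. A sphere packing metric is a vector $r\in\mathbb R_{>0}^{V}$ such that for every tetrahedron $\{i,j,k,l\}\in T$ the edge lengths $l_{ij}=r_i+r_j$ are those of a nondegenerate Euclidean tetrahedron; $\mathfrak M_{\mathcal T}$ denotes the set of these metrics. The combinatorial scalar curvature is $K_i=4\pi-\sum_{\{i,j,k,l\}\in T}\alpha_{ijkl}$, the sum being over all tetrahedra containing $i$, where $\alpha_{ijkl}$ is the solid angle at the vertex $i$ of the Euclidean tetrahedron $\{i,j,k,l\}$. For $\alpha\in\mathbb R$, the $\alpha$-curvature is $R_{\alpha,i}=K_i/r_i^{\alpha}$, and $r\in\mathfrak M_{\mathcal T}$ is a constant $\alpha$-curvature metric if $R_{\alpha,i}$ does not depend on $i$. Let $s_\alpha=\sum_iK_ir_i\big/\sum_i r_i^{\alpha+1}$, let $\Delta_\alpha$ be the linear operator on functions $f:V\to\mathbb R$ given by $(\Delta_\alpha f)_i=r_i^{-\alpha}\sum_{j\sim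 i}\bigl(-\tfrac{\partial K_i}{\partial r_j}r_j\bigr)(f_j-f_i)$, and let $\lambda_1(-\Delta_\alpha)$ be the smallest positive eigenvalue of $-\Delta_\alpha$. The $\alpha$-flow is the system $\frac{dr_i}{dt}=s_\alpha r_i^{\alpha}-K_i$ on $\mathfrak M_{\mathcal T}$. Let $\mathbb S^{N-1}$ be the Euclidean unit sphere of $\mathbb R^{V}$. Let $\alpha\in\mathbb R$ and let $r^*\in\mathbb S^{N-1}$ be a constant $\alpha$-curvature metric; write $s_\alpha^*$ and $\Delta_\alpha^*$ for $s_\alpha$ and $\Delta_\alpha$ at $r^*$. (a) If $\alpha s_\alpha^*\le 0$, then $\lambda_1(-\Delta_\alpha^*)>\alpha s_\alpha^*$. (b) If $\lambda_1(-\Delta_\alpha^*)>\alpha s_\alpha^*$ (in particular, if $\alpha s_\alpha^*\le 0$), then there is $\delta>0$ such that for every $r(0)\in\mathbb S^{N-1}$ with $\|r(0)-r^*\|<\delta$ the (unique) solution $r(t)$ of the $\alpha$-flow with initial value $r(0)$ exists in $\mathfrak M_{\mathcal T}$ for all $t\ge 0$ and converges to $r^*$ as $t\to\infty$. -/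

import Mathlib

open MeasureTheory Filter Topology

noncomputable section

namespace SpherePacking

/-- The geometric realization of a finite abstract simplicial complex, in barycentric
coordinates: convex weights on the vertices whose support is a face. -/
def realization {V : Type*} [Fintype V] (K : AbstractSimplicialComplex V) : Set (V → ℝ) :=
  {x | (∀ v, 0 ≤ x v) ∧ ∑ v, x v = 1 ∧ ∃ s ∈ K.faces, ∀ v, v ∈ s ↔ x v ≠ 0}

/-- A triangulation of the 3-dimensional space `M` with (finite) vertex set `V`: a purely
3-dimensional simplicial complex (every simplex is a face of a tetrahedron), together with a
homeomorphism from its geometric realization onto `M`. -/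
structure Triangulation (V M : Type*) [Fintype V] [TopologicalSpace M] where
  complex : AbstractSimplicialComplex V
  pure : ∀ s ∈ complex.faces, ∃ τ ∈ complex.faces, s ⊆ τ ∧ τ.card = 4
  homeo : realization complex ≃ₜ M

/-- Given a body `S` in Euclidean 3-space, the solid angle of `S` at the point `x`: the area of
the set of unit vectors that point from `x` to points of `S`. -/
def solidAngleAt (S : Set (EuclideanSpace ℝ (Fin 3))) (x : EuclideanSpace ℝ (Fin 3)) : ℝ :=
  (volume : Measure (EuclideanSpace ℝ (Fin 3))).toSphere.real
    {u : Metric.sphere (0 : EuclideanSpace ℝ (Fin 3)) 1 |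
      ∃ t : ℝ, 0 < t ∧ x + t • (u : EuclideanSpace ℝ (Fin 3)) ∈ S}

/-- The points `p v`, `v ∈ τ`, are the vertices of a nondegenerate Euclidean simplex whose
edges have the lengths `r i + r j`. -/
def IsEuclideanRealization {V : Type*} (r : V → ℝ) (τ : Finset V)
    (p : V → EuclideanSpace ℝ (Fin 3)) : Prop :=
  AffineIndependent ℝ (fun v : τ => p v) ∧
    ∀ i ∈ τ, ∀ j ∈ τ, i ≠ j → dist (p i) (p j) = r i + r j

open Classical in
/-- The solid angle at the vertex `i` of the Euclidean tetrahedron `τ` with edge lengths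
`r i + r j`. Such a tetrahedron is unique up to congruence; the value is `0` by convention if
there is none. -/
def solidAngle {V : Type*} (r : V → ℝ) (τ : Finset V) (i : V) : ℝ :=
  if h : ∃ p, IsEuclideanRealization r τ p then
    solidAngleAt (convexHull ℝ (h.choose '' (τ : Set V))) (h.choose i)
  else 0

namespace Triangulation

variable {V M : Type*} [Fintype V] [TopologicalSpace M]

open Classical in
/-- The set of tetrahedra. -/
def tets (T : Triangulation V M) : Finset (Finset V) :=
  Finset.univ.filter fun τ => τ ∈ T.complex.faces ∧ τ.card = 4

open Classical in
/-- The vertices `j` adjacent to `i`. -/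
def neighbors (T : Triangulation V M) (i : V) : Finset V :=
  Finset.univ.filter fun j => j ≠ i ∧ {i, j} ∈ T.complex.faces

/-- The space of sphere packing metrics: positive radii for which the lengths `r i + r j`
determine a Euclidean tetrahedron for every tetrahedron of the triangulation. -/
def metrics (T : Triangulation V M) : Set (EuclideanSpace ℝ V) :=
  {r | (∀ i, 0 < r i) ∧ ∀ τ ∈ T.tets, ∃ p, IsEuclideanRealization r τ p}

open Classical in
/-- The Cooper–Rivin combinatorial scalar curvature `K_i`. -/
def scalarCurv (T : Triangulation V M) (r : EuclideanSpace ℝ V) (i : V) : ℝ :=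
  4 * Real.pi - ∑ τ ∈ T.tets with i ∈ τ, solidAngle r τ i

/-- The `α`-curvature `R_{α,i} = K_i / r_i ^ α`. -/
def alphaCurv (T : Triangulation V M) (α : ℝ) (r : EuclideanSpace ℝ V) (i : V) : ℝ :=
  T.scalarCurv r i / r i ^ α

/-- `r` is a sphere packing metric with constant `α`-curvature. -/
def IsConstAlphaMetric (T : Triangulation V M) (α : ℝ) (r : EuclideanSpace ℝ V) : Prop :=
  r ∈ T.metrics ∧ ∃ c : ℝ, ∀ i, T.alphaCurv α r i = c

/-- `s_α = (∑ K_i r_i) / ∑ r_i ^ (α + 1)`. -/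
def sAlpha (T : Triangulation V M) (α : ℝ) (r : EuclideanSpace ℝ V) : ℝ :=
  (∑ i, T.scalarCurv r i * r i) / ∑ i, r i ^ (α + 1)

open Classical in
/-- The partial derivative `∂K_i / ∂r_j` at `r`. -/
def partialCurv (T : Triangulation V M) (r : EuclideanSpace ℝ V) (i j : V) : ℝ :=
  lineDeriv ℝ (fun ρ : EuclideanSpace ℝ V => T.scalarCurv ρ i) r (EuclideanSpace.single j 1)

/-- The `α`-Laplacian
`(Δ_α f)_i = r_i ^ (-α) * ∑_{j ∼ i} (-(∂K_i / ∂r_j) r_j) (f_j - f_i)` at the metric `r`. -/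
def alphaLaplacian (T : Triangulation V M) (α : ℝ) (r : EuclideanSpace ℝ V) :
    (V → ℝ) →ₗ[ℝ] (V → ℝ) where
  toFun f i := 1 / r i ^ α * ∑ j ∈ T.neighbors i, (-(T.partialCurv r i j) * r j) * (f j - f i)
  map_add' f g := by
    funext i
    simp only [Pi.add_apply]
    rw [← mul_add, ← Finset.sum_add_distrib]
    congr 1
    exact Finset.sum_congr rfl fun j _ => by ring
  map_smul' c f := by
    funext i
    simp only [Pi.smul_apply, smul_eq_mul, RingHom.id_apply]
    rw [mul_left_comm]
    congr 1
    rw [Finset.mul_sum]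
    exact Finset.sum_congr rfl fun j _ => by ring

/-- The first (smallest) positive eigenvalue `λ₁` of `-Δ_α` at the metric `r`. -/
def lambdaOne (T : Triangulation V M) (α : ℝ) (r : EuclideanSpace ℝ V) : ℝ :=
  sInf {μ : ℝ | 0 < μ ∧ Module.End.HasEigenvalue (-(T.alphaLaplacian α r)) μ}

/-- `ρ` is a solution, on the time interval `J` and with values in the space of sphere packing
metrics, of the `α`-flow `dr_i/dt = s_α r_i ^ α - K_i`. -/
def IsAlphaFlowOn (T : Triangulation V M) (α : ℝ) (J : Set ℝ)
    (ρ : ℝ → EuclideanSpace ℝ V) : Prop :=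
  ∀ t ∈ J, ρ t ∈ T.metrics ∧
    ∀ i, HasDerivWithinAt (fun τ => ρ τ i)
      (T.sAlpha α (ρ t) * ρ t i ^ α - T.scalarCurv (ρ t) i) J t

end Triangulation

end SpherePacking

end

open MeasureTheory Filter Topology

noncomputable section

-- Work with the reciprocal radii x = 1/r. Four mutually tangent spheres span a nondegenerate
-- tetrahedron exactly when Descartes' form Q(x) = (∑x)² - 2∑x² is positive, because the Gram
-- determinant of the edges at a vertex is a positive multiple of Q. Girard's formula turns a solid
-- angle into a sum of dihedral angles, and a complex product identity (`sum_arg_sub_pi_eq`) turns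
-- that sum into π - 2 arctan(h/√Q) with h rational in x; this is `solidAngle_eq`. The space of
-- metrics is therefore open and the curvature is strictly differentiable on it.
--
-- Put f_i = h_i / r_i for a variation h of r. Differentiating the arctangent formula gives r_i
-- dK_i(h) = ∑_j W_ij (f_i - f_j) with symmetric weights W. Individual weights can be negative, but
-- on each tetrahedron the form ∑ W_ij (f_i - f_j)² is positive on nonconstant f
-- (`edge_weight_form_pos`). Connectedness of M makes this global (`sum_totalWeight_pos`).
--
-- Consequently -Δ_α is a graph Laplacian, self-adjoint for the masses w_i = r_i^(α+1), whose kernel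
-- is the constants. So λ₁ is positive, which is (a), and it is the minimum of the Rayleigh quotient
-- on functions of w-mean zero (`lambdaOne_spec`).
--
-- For (b), let F be the field of the flow. The choice of s_α makes F orthogonal to r, so the flow
-- stays on spheres about the origin. At r* the differential satisfies ⟨h, F'h⟩ = α s_α* Var_w(f) -
-- ½ ∑ W_ij (f_i - f_j)² ≤ -(λ₁ - α s_α*) Var_w(f), where Var_w(f) = ∑ w_i (f_i - a)² with a the
-- w-mean of f. This variance controls the part of h orthogonal to r*. Hence ‖r - r*‖² is a Lyapunov
-- function on the unit sphere with exponential decay (`eventually_inner_sub_le`,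
-- `exists_stable_flow`).

namespace SpherePacking

-- Wedges and trihedral cones in the unit ball: Girard's formula

/-- Splitting Euclidean 3-space into the last coordinate and the first two is measure preserving. -/
theorem measurePreserving_splitLast :
    MeasurePreserving (fun x : EuclideanSpace ℝ (Fin 3) => ((x 2, (x 0, x 1)) : ℝ × ℝ × ℝ)) := by
  have h1 := PiLp.volume_preserving_ofLp (ι := Fin 3)
  have h2 := volume_preserving_piFinSuccAbove (fun _ : Fin 3 => ℝ) 2
  have h3 := (MeasurePreserving.id (volume : Measure ℝ)).prod (volume_preserving_finTwoArrow ℝ)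
  exact h3.comp (h2.comp h1)

/-- The volume of the part of the unit ball over a planar cone is proportional to the size of the
set of polar angles of the cone. -/
theorem volume_ball_inter_cylinder {A : Set (ℝ × ℝ)} (hA : MeasurableSet A) {Θ : Set ℝ}
    (hΘ : MeasurableSet Θ) (hΘπ : Θ ⊆ Set.Ioo (-Real.pi) Real.pi)
    (h : ∀ ρ > 0, ∀ θ ∈ Set.Ioo (-Real.pi) Real.pi,
      ((ρ * Real.cos θ, ρ * Real.sin θ) : ℝ × ℝ) ∈ A ↔ θ ∈ Θ) :
    volume {x : EuclideanSpace ℝ (Fin 3) | ‖x‖ < 1 ∧ (x 0, x 1) ∈ A} =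
      (∫⁻ ρ in Set.Ioi (0 : ℝ), ENNReal.ofReal ρ * volume {z : ℝ | ρ ^ 2 + z ^ 2 < 1}) *
        volume Θ := by
  set S : Set (ℝ × ℝ × ℝ) := {y | y.2.1 ^ 2 + y.2.2 ^ 2 + y.1 ^ 2 < 1 ∧ y.2 ∈ A} with hS
  have hSm : MeasurableSet S := by
    refine MeasurableSet.inter ?_ (measurable_snd hA)
    exact measurableSet_lt (f := fun y : ℝ × ℝ × ℝ => y.2.1 ^ 2 + y.2.2 ^ 2 + y.1 ^ 2)
      (by fun_prop) measurable_const
  have hpre : {x : EuclideanSpace ℝ (Fin 3) | ‖x‖ < 1 ∧ (x 0, x 1) ∈ A} =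
      (fun x : EuclideanSpace ℝ (Fin 3) => ((x 2, (x 0, x 1)) : ℝ × ℝ × ℝ)) ⁻¹' S := by
    ext x
    simp only [hS, Set.mem_ofPred_eq, Set.mem_preimage]
    refine and_congr_left fun _ => ?_
    rw [← sq_lt_one_iff₀ (norm_nonneg x), EuclideanSpace.norm_sq_eq]
    simp [Fin.sum_univ_three]
  rw [hpre, measurePreserving_splitLast.measure_preimage hSm.nullMeasurableSet,
    Measure.volume_eq_prod, Measure.prod_apply_symm hSm, ← lintegral_comp_polarCoord_symm]
  have hg : Measurable fun ρ : ℝ => volume {z : ℝ | ρ ^ 2 + z ^ 2 < 1} := by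
    have : MeasurableSet {y : ℝ × ℝ | y.1 ^ 2 + y.2 ^ 2 < 1} :=
      measurableSet_lt (by fun_prop) measurable_const
    exact measurable_measure_prodMk_left this
  have key : ∀ p ∈ polarCoord.target,
      ENNReal.ofReal p.1 • volume ((fun x : ℝ => (x, polarCoord.symm p)) ⁻¹' S) =
      (ENNReal.ofReal p.1 * volume {z : ℝ | p.1 ^ 2 + z ^ 2 < 1}) *
        Θ.indicator (fun _ => (1 : ENNReal)) p.2 := by
    rintro ⟨ρ, θ⟩ hp
    rw [polarCoord_target, Set.mem_prod] at hp
    have hmem := h ρ hp.1 θ hp.2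
    by_cases hθ : θ ∈ Θ
    · rw [Set.indicator_of_mem hθ, mul_one, smul_eq_mul]
      congr 2
      ext z
      have : (ρ * Real.cos θ) ^ 2 + (ρ * Real.sin θ) ^ 2 = ρ ^ 2 := by
        linear_combination ρ ^ 2 * Real.sin_sq_add_cos_sq θ
      simp [hS, hmem, hθ, this]
    · rw [Set.indicator_of_notMem hθ, mul_zero]
      have : (fun x : ℝ => (x, polarCoord.symm (ρ, θ))) ⁻¹' S = ∅ := by
        ext z
        simp [hS, hmem, hθ]
      simp only [this, measure_empty, smul_zero]
  rw [setLIntegral_congr_fun polarCoord.open_target.measurableSet key, polarCoord_target,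
    Measure.volume_eq_prod, ← Measure.prod_restrict,
    lintegral_prod_mul (f := fun ρ : ℝ => ENNReal.ofReal ρ * volume {z : ℝ | ρ ^ 2 + z ^ 2 < 1})
      (g := Θ.indicator fun _ => (1 : ENNReal))]
  · congr 1
    rw [lintegral_indicator_const hΘ, one_mul, Measure.restrict_apply hΘ, Set.inter_eq_left.2 hΘπ]
  · exact (ENNReal.measurable_ofReal.mul hg).aemeasurable
  · exact (measurable_const.indicator hΘ).aemeasurable

/-- The case of the full range of polar angles. It lets the radial integral be eliminated, so that
it never has to be evaluated. -/
theorem volume_ball_three_eq :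
    volume (Metric.ball (0 : EuclideanSpace ℝ (Fin 3)) 1) =
      (∫⁻ ρ in Set.Ioi (0 : ℝ), ENNReal.ofReal ρ * volume {z : ℝ | ρ ^ 2 + z ^ 2 < 1}) *
        ENNReal.ofReal (2 * Real.pi) := by
  have := volume_ball_inter_cylinder (A := Set.univ) MeasurableSet.univ
    (measurableSet_Ioo (a := -Real.pi) (b := Real.pi)) subset_rfl
    (fun ρ _ θ hθ => by simpa using hθ)
  rw [Real.volume_Ioo] at this
  convert this using 3
  · simp [Metric.ball, dist_eq_norm]
  · ring

/-- A coordinate wedge of dihedral angle `θ₀` fills the proportion `θ₀ / 2π` of the unit ball. -/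
theorem volume_ball_inter_coord_wedge {θ₀ : ℝ} (h0 : 0 < θ₀) (hπ : θ₀ < Real.pi) :
    volume.real {x : EuclideanSpace ℝ (Fin 3) | ‖x‖ < 1 ∧ 0 ≤ x 1 ∧
      0 ≤ x 0 * Real.sin θ₀ - x 1 * Real.cos θ₀} =
      volume.real (Metric.ball (0 : EuclideanSpace ℝ (Fin 3)) 1) * (θ₀ / (2 * Real.pi)) := by
  have key := volume_ball_inter_cylinder
    (A := {p : ℝ × ℝ | 0 ≤ p.2 ∧ 0 ≤ p.1 * Real.sin θ₀ - p.2 * Real.cos θ₀})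
    (MeasurableSet.inter (measurableSet_le measurable_const measurable_snd)
      (measurableSet_le (g := fun p : ℝ × ℝ => p.1 * Real.sin θ₀ - p.2 * Real.cos θ₀)
        measurable_const (by fun_prop)))
    (measurableSet_Icc (a := 0) (b := θ₀))
    (fun t ht => ⟨by linarith [ht.1, Real.pi_pos], by linarith [ht.2]⟩) (by
      intro ρ hρ θ hθ
      have e : ρ * Real.cos θ * Real.sin θ₀ - ρ * Real.sin θ * Real.cos θ₀ =
        ρ * Real.sin (θ₀ - θ) := by rw [Real.sin_sub]; ring
      simp only [Set.mem_ofPred_eq, e, mul_nonneg_iff_of_pos_left hρ, Set.mem_Icc]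
      constructor
      · rintro ⟨h1, h2⟩
        have h3 : 0 ≤ θ := by
          by_contra hneg
          push Not at hneg
          exact absurd h1 (not_le.2 (Real.sin_neg_of_neg_of_neg_pi_lt hneg hθ.1))
        refine ⟨h3, ?_⟩
        by_contra hneg
        push Not at hneg
        exact absurd h2 (not_le.2 (Real.sin_neg_of_neg_of_neg_pi_lt (by linarith)
          (by linarith [hθ.2])))
      · rintro ⟨h1, h2⟩
        exact ⟨Real.sin_nonneg_of_nonneg_of_le_pi h1 hθ.2.le,
          Real.sin_nonneg_of_nonneg_of_le_pi (by linarith) (by linarith)⟩)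
  rw [Real.volume_Icc, sub_zero] at key
  simp only [Set.mem_ofPred_eq] at key
  rw [Measure.real, key, Measure.real, volume_ball_three_eq, ENNReal.toReal_mul,
    ENNReal.toReal_mul, ENNReal.toReal_ofReal h0.le,
    ENNReal.toReal_ofReal (by positivity)]
  field_simp

/-- The wedge between two planes with normals `n₁, n₂` fills the proportion
`(π - ∠(n₁, n₂)) / 2π` of the unit ball. -/
theorem volume_ball_inter_wedge {n₁ n₂ : EuclideanSpace ℝ (Fin 3)} (hn₁ : n₁ ≠ 0) (hn₂ : n₂ ≠ 0)
    (h0 : 0 < InnerProductGeometry.angle n₁ n₂)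
    (hπ : InnerProductGeometry.angle n₁ n₂ < Real.pi) :
    volume.real {x : EuclideanSpace ℝ (Fin 3) | ‖x‖ < 1 ∧ 0 ≤ inner ℝ n₁ x ∧ 0 ≤ inner ℝ n₂ x} =
      volume.real (Metric.ball (0 : EuclideanSpace ℝ (Fin 3)) 1) *
        ((Real.pi - InnerProductGeometry.angle n₁ n₂) / (2 * Real.pi)) := by
  have hcos := InnerProductGeometry.cos_angle_mul_norm_mul_norm n₁ n₂
  set β := InnerProductGeometry.angle n₁ n₂ with hβ
  have p1 : 0 < ‖n₁‖ := norm_pos_iff.2 hn₁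
  have p2 : 0 < ‖n₂‖ := norm_pos_iff.2 hn₂
  have hs : 0 < Real.sin β := Real.sin_pos_of_pos_of_lt_pi h0 hπ
  have hsc := Real.sin_sq_add_cos_sq β
  -- Gram-Schmidt on n₁, n₂, in the order that makes n₁ the second axis. In these coordinates the
  -- two half-spaces are those of the coordinate wedge of angle π - β.
  set e₂ : EuclideanSpace ℝ (Fin 3) := ‖n₁‖⁻¹ • n₁ with he₂
  set e₁ : EuclideanSpace ℝ (Fin 3) := (Real.sin β)⁻¹ • (‖n₂‖⁻¹ • n₂ - Real.cos β • e₂) with he₁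
  have h22 : inner ℝ e₂ e₂ = (1 : ℝ) := by
    rw [he₂, real_inner_smul_left, real_inner_smul_right, real_inner_self_eq_norm_sq]
    field_simp
  have hnn : inner ℝ n₂ n₂ = ‖n₂‖ ^ 2 := real_inner_self_eq_norm_sq n₂
  have h2n : inner ℝ e₂ n₂ = Real.cos β * ‖n₂‖ := by
    rw [he₂, real_inner_smul_left, ← hcos]
    field_simp
  have h12 : inner ℝ e₁ e₂ = (0 : ℝ) := by
    rw [he₁, real_inner_smul_left, inner_sub_left, real_inner_smul_left, real_inner_smul_left,
      h22, real_inner_comm, h2n]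
    field_simp
    ring
  have h11 : inner ℝ e₁ e₁ = (1 : ℝ) := by
    have : inner ℝ e₁ e₁ = (Real.sin β)⁻¹ * (‖n₂‖⁻¹ * inner ℝ e₁ n₂) := by
      conv_lhs => rw [he₁, real_inner_comm, real_inner_smul_right, inner_sub_right,
        real_inner_smul_right, real_inner_smul_right, h12, mul_zero, sub_zero]
    rw [this, he₁, real_inner_smul_left, inner_sub_left, real_inner_smul_left,
      real_inner_smul_left, h2n, hnn]
    field_simp
    linear_combination -hsc
  have hf : Orthonormal ℝ (({0, 1} : Set (Fin 3)).domRestrict ![e₁, e₂, 0]) := by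
    rw [orthonormal_iff_ite]
    rintro ⟨i, hi⟩ ⟨j, hj⟩
    simp only [Set.mem_insert_iff, Set.mem_singleton_iff] at hi hj
    rcases hi with rfl | rfl <;> rcases hj with rfl | rfl
    · exact h11.trans (by simp)
    · exact h12.trans (by simp)
    · exact ((real_inner_comm _ _).trans h12).trans (by simp)
    · exact h22.trans (by simp)
  obtain ⟨b, hb⟩ := hf.exists_orthonormalBasis_extension_of_card_eq (by simp)
  have hb0 : b 0 = e₁ := hb 0 (by simp)
  have hb1 : b 1 = e₂ := hb 1 (by simp)
  have hn₁' : n₁ = ‖n₁‖ • e₂ := by rw [he₂, smul_smul, mul_inv_cancel₀ p1.ne', one_smul]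
  have hn₂' : n₂ = ‖n₂‖ • (Real.sin β • e₁ + Real.cos β • e₂) := by
    rw [he₁, smul_smul, mul_inv_cancel₀ hs.ne', one_smul, sub_add_cancel, smul_smul,
      mul_inv_cancel₀ p2.ne', one_smul]
  have hpre : {x : EuclideanSpace ℝ (Fin 3) | ‖x‖ < 1 ∧ 0 ≤ inner ℝ n₁ x ∧ 0 ≤ inner ℝ n₂ x} =
      b.repr ⁻¹' {x : EuclideanSpace ℝ (Fin 3) | ‖x‖ < 1 ∧ 0 ≤ x 1 ∧
        0 ≤ x 0 * Real.sin (Real.pi - β) - x 1 * Real.cos (Real.pi - β)} := by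
    ext x
    have a1 : inner ℝ n₁ x = ‖n₁‖ * b.repr x 1 := by
      rw [hn₁', real_inner_smul_left, b.repr_apply_apply, hb1, ← hn₁']
    have a2 : inner ℝ n₂ x = ‖n₂‖ * (b.repr x 0 * Real.sin β + b.repr x 1 * Real.cos β) := by
      rw [b.repr_apply_apply, b.repr_apply_apply, hb1, hb0]
      refine (congrArg (fun y => inner ℝ y x) hn₂').trans ?_
      simp only [real_inner_smul_left, inner_add_left]
      ring
    simp only [Set.mem_ofPred_eq, Set.mem_preimage, LinearIsometryEquiv.norm_map, a1, a2,
      mul_nonneg_iff_of_pos_left p1, mul_nonneg_iff_of_pos_left p2, Real.sin_pi_sub,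
      Real.cos_pi_sub, mul_neg, sub_neg_eq_add]
  rw [← volume_ball_inter_coord_wedge (by linarith) (by linarith), hpre]
  exact congrArg ENNReal.toReal (b.measurePreserving_measurableEquiv.measure_preimage_equiv _)

theorem volume_inner_eq_zero {n : EuclideanSpace ℝ (Fin 3)} (hn : n ≠ 0) :
    volume {x : EuclideanSpace ℝ (Fin 3) | inner ℝ n x = 0} = 0 := by
  have : {x : EuclideanSpace ℝ (Fin 3) | inner ℝ n x = 0} =
      (LinearMap.ker (innerSL ℝ n : EuclideanSpace ℝ (Fin 3) →ₗ[ℝ] ℝ) :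
        Set (EuclideanSpace ℝ (Fin 3))) := by
    ext x; simp
  rw [this]
  refine Measure.addHaar_submodule _ _ fun h => hn ?_
  have hx : n ∈ LinearMap.ker (innerSL ℝ n : EuclideanSpace ℝ (Fin 3) →ₗ[ℝ] ℝ) := h ▸ trivial
  simpa using hx

/-- Sets that are opposite to each other up to a finite union of hyperplanes have the same measure
in the unit ball. -/
theorem measureReal_ball_opposite {n₁ n₂ n₃ : EuclideanSpace ℝ (Fin 3)} (h₁ : n₁ ≠ 0)
    (h₂ : n₂ ≠ 0) (h₃ : n₃ ≠ 0) {S T : Set (EuclideanSpace ℝ (Fin 3))} (hS : MeasurableSet S)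
    (hT : MeasurableSet T)
    (h : ∀ x, inner ℝ n₁ x ≠ 0 → inner ℝ n₂ x ≠ 0 → inner ℝ n₃ x ≠ 0 → (x ∈ S ↔ -x ∈ T)) :
    (volume.restrict (Metric.ball 0 1)).real S = (volume.restrict (Metric.ball 0 1)).real T := by
  rw [Measure.real, Measure.real, Measure.restrict_apply hS, Measure.restrict_apply hT,
    ← Measure.measure_preimage_neg volume (T ∩ Metric.ball 0 1)]
  congr 1
  refine measure_congr ?_
  have e1 := measure_eq_zero_iff_ae_notMem.1 (volume_inner_eq_zero h₁)
  have e2 := measure_eq_zero_iff_ae_notMem.1 (volume_inner_eq_zero h₂)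
  have e3 := measure_eq_zero_iff_ae_notMem.1 (volume_inner_eq_zero h₃)
  filter_upwards [e1, e2, e3] with x a1 a2 a3
  refine propext ?_
  change x ∈ S ∧ x ∈ Metric.ball 0 1 ↔ -x ∈ T ∧ -x ∈ Metric.ball 0 1
  rw [h x a1 a2 a3]
  simp

/-- Girard's formula for the volume of the part of the unit ball in a trihedral cone, in terms of
the angles between the normals of its faces. -/
theorem volume_ball_inter_trihedral {n₁ n₂ n₃ : EuclideanSpace ℝ (Fin 3)} (h₁ : n₁ ≠ 0)
    (h₂ : n₂ ≠ 0) (h₃ : n₃ ≠ 0)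
    (h12 : InnerProductGeometry.angle n₁ n₂ ∈ Set.Ioo 0 Real.pi)
    (h13 : InnerProductGeometry.angle n₁ n₃ ∈ Set.Ioo 0 Real.pi)
    (h23 : InnerProductGeometry.angle n₂ n₃ ∈ Set.Ioo 0 Real.pi) :
    volume.real {x : EuclideanSpace ℝ (Fin 3) |
      ‖x‖ < 1 ∧ 0 ≤ inner ℝ n₁ x ∧ 0 ≤ inner ℝ n₂ x ∧ 0 ≤ inner ℝ n₃ x} =
      volume.real (Metric.ball (0 : EuclideanSpace ℝ (Fin 3)) 1) *
        ((2 * Real.pi - InnerProductGeometry.angle n₁ n₂ - InnerProductGeometry.angle n₁ n₃ -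
          InnerProductGeometry.angle n₂ n₃) / (4 * Real.pi)) := by
  set A : EuclideanSpace ℝ (Fin 3) → Set (EuclideanSpace ℝ (Fin 3)) :=
    fun n => {x | 0 ≤ inner ℝ n x} with hA
  have hAm : ∀ n, MeasurableSet (A n) := fun n =>
    (isClosed_le continuous_const (continuous_const.inner continuous_id)).measurableSet
  set μ : Measure (EuclideanSpace ℝ (Fin 3)) := volume.restrict (Metric.ball 0 1) with hμ
  set V := volume.real (Metric.ball (0 : EuclideanSpace ℝ (Fin 3)) 1) with hV
  have : IsFiniteMeasure μ := ⟨by rw [hμ, Measure.restrict_apply_univ]; exact measure_ball_lt_top⟩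
  have w12 := volume_ball_inter_wedge h₁ h₂ h12.1 h12.2
  have w13 := volume_ball_inter_wedge h₁ h₃ h13.1 h13.2
  have w23 := volume_ball_inter_wedge h₂ h₃ h23.1 h23.2
  have conv2 : ∀ n m, volume.real {x : EuclideanSpace ℝ (Fin 3) |
      ‖x‖ < 1 ∧ 0 ≤ inner ℝ n x ∧ 0 ≤ inner ℝ m x} = μ.real (A n ∩ A m) := by
    intro n m
    rw [hμ, Measure.real, Measure.real, Measure.restrict_apply ((hAm n).inter (hAm m))]
    congr 2
    ext x
    simp [hA, and_comm]
  have conv3 : volume.real {x : EuclideanSpace ℝ (Fin 3) |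
      ‖x‖ < 1 ∧ 0 ≤ inner ℝ n₁ x ∧ 0 ≤ inner ℝ n₂ x ∧ 0 ≤ inner ℝ n₃ x} =
      μ.real ((A n₁ ∩ A n₂) ∩ A n₃) := by
    rw [hμ, Measure.real, Measure.real,
      Measure.restrict_apply (((hAm _).inter (hAm _)).inter (hAm _))]
    congr 2
    ext x
    simp only [hA, Set.mem_ofPred_eq, Set.mem_inter_iff, mem_ball_zero_iff]
    tauto
  rw [conv2] at w12 w13 w23
  rw [conv3]
  have hc : ∀ n, MeasurableSet (A n)ᶜ := fun n => (hAm n).compl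
  -- Up to the three bounding planes, complementing a half-space is applying the antipodal map,
  -- which preserves the measure on the ball.
  have hhalf : μ.real (A n₃)ᶜ = μ.real (A n₃) :=
    measureReal_ball_opposite h₁ h₂ h₃ (hc _) (hAm _) fun x _ _ a3 => by
      simp only [hA, Set.mem_compl_iff, Set.mem_ofPred_eq, not_le, inner_neg_right,
        Left.nonneg_neg_iff]
      exact ⟨le_of_lt, fun h => lt_of_le_of_ne h a3⟩
  have hw : μ.real ((A n₁)ᶜ ∩ (A n₂)ᶜ) = μ.real (A n₁ ∩ A n₂) :=
    measureReal_ball_opposite h₁ h₂ h₃ ((hc _).inter (hc _)) ((hAm _).inter (hAm _))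
      fun x a1 a2 _ => by
        simp only [hA, Set.mem_compl_iff, Set.mem_inter_iff, Set.mem_ofPred_eq, not_le,
          inner_neg_right, Left.nonneg_neg_iff]
        exact ⟨fun h => ⟨h.1.le, h.2.le⟩, fun h => ⟨lt_of_le_of_ne h.1 a1, lt_of_le_of_ne h.2 a2⟩⟩
  have ht : μ.real (((A n₁)ᶜ ∩ (A n₂)ᶜ) ∩ (A n₃)ᶜ) = μ.real ((A n₁ ∩ A n₂) ∩ A n₃) :=
    measureReal_ball_opposite h₁ h₂ h₃ (((hc _).inter (hc _)).inter (hc _))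
      (((hAm _).inter (hAm _)).inter (hAm _)) fun x a1 a2 a3 => by
        simp only [hA, Set.mem_compl_iff, Set.mem_inter_iff, Set.mem_ofPred_eq, not_le,
          inner_neg_right, Left.nonneg_neg_iff]
        exact ⟨fun h => ⟨⟨h.1.1.le, h.1.2.le⟩, h.2.le⟩, fun h =>
          ⟨⟨lt_of_le_of_ne h.1.1 a1, lt_of_le_of_ne h.1.2 a2⟩, lt_of_le_of_ne h.2 a3⟩⟩
  have huniv : μ.real (A n₃) + μ.real (A n₃)ᶜ = V := by
    rw [measureReal_add_measureReal_compl (hAm _), hμ, measureReal_restrict_apply MeasurableSet.univ,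
      Set.univ_inter]
  have split : ∀ (s : Set (EuclideanSpace ℝ (Fin 3))) n,
      μ.real (s ∩ A n) + μ.real (s ∩ (A n)ᶜ) = μ.real s := fun s n => by
    rw [← Set.sdiff_eq, measureReal_inter_add_sdiff (hAm n)]
  -- Inclusion-exclusion: cutting the intersection of two complements by the third plane and using
  -- the antipodal equalities leaves the triple intersection as the only unknown, counted twice.
  have s1 := split ((A n₁)ᶜ ∩ (A n₂)ᶜ) n₃
  have s2 := split ((A n₁)ᶜ ∩ A n₃) n₂
  have s3 := split (A n₃) n₁
  have s4 := split (A n₂ ∩ A n₃) n₁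
  rw [show (A n₁)ᶜ ∩ A n₃ ∩ A n₂ = A n₂ ∩ A n₃ ∩ (A n₁)ᶜ by
      ext; simp only [Set.mem_inter_iff]; tauto,
    show (A n₁)ᶜ ∩ A n₃ ∩ (A n₂)ᶜ = (A n₁)ᶜ ∩ (A n₂)ᶜ ∩ A n₃ by
      ext; simp only [Set.mem_inter_iff]; tauto,
    Set.inter_comm (A n₁)ᶜ (A n₃)] at s2
  rw [Set.inter_comm (A n₃) (A n₁)] at s3
  rw [show A n₂ ∩ A n₃ ∩ A n₁ = A n₁ ∩ A n₂ ∩ A n₃ by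
      ext; simp only [Set.mem_inter_iff]; tauto] at s4
  have hpi := Real.pi_pos
  have h2a : 2 * μ.real (A n₁ ∩ A n₂ ∩ A n₃) = μ.real (A n₁ ∩ A n₂) + μ.real (A n₁ ∩ A n₃) +
      μ.real (A n₂ ∩ A n₃) - V / 2 := by linarith
  rw [w12, w13, w23] at h2a
  have : μ.real (A n₁ ∩ A n₂ ∩ A n₃) = (2 * μ.real (A n₁ ∩ A n₂ ∩ A n₃)) / 2 := by ring
  rw [this, h2a]
  field_simp
  ring

-- From dihedral angles to an arctangent formula for the solid angle

/-- The exterior angle between two vectors as the argument of a complex number. -/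
theorem pi_sub_angle_eq_arg {F : Type*} [NormedAddCommGroup F] [InnerProductSpace ℝ F] {n m : F}
    {s : ℝ} (hs : 0 < s) (h : s ^ 2 = ‖n‖ ^ 2 * ‖m‖ ^ 2 - inner ℝ n m ^ 2) :
    Real.pi - InnerProductGeometry.angle n m = Complex.arg ⟨-inner ℝ n m, s⟩ := by
  have hne : (⟨-inner ℝ n m, s⟩ : ℂ) ≠ 0 := fun h0 => hs.ne' (congrArg Complex.im h0)
  have hnorm : ‖(⟨-inner ℝ n m, s⟩ : ℂ)‖ = ‖n‖ * ‖m‖ := by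
    rw [← sq_eq_sq₀ (norm_nonneg _) (by positivity), Complex.sq_norm, Complex.normSq_mk]
    linear_combination h
  rw [Complex.arg_of_im_nonneg_of_ne_zero hs.le hne, hnorm, neg_div, Real.arccos_neg]
  rfl

theorem arg_mem_Ioo_of_im_pos {z : ℂ} (hz : 0 < z.im) : Complex.arg z ∈ Set.Ioo 0 Real.pi := by
  refine ⟨lt_of_le_of_ne (Complex.arg_nonneg_iff.2 hz.le) fun h => ?_,
    Complex.arg_lt_pi_iff.2 (Or.inr hz.ne')⟩
  exact hz.ne' (Complex.arg_eq_zero_iff.1 h.symm).2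

/-- The complement π/2 - arg has tangent D/E and lies in the range of the arctangent. -/
theorem two_mul_arg_eq {D E : ℝ} (hE : 0 < E) :
    2 * Complex.arg ⟨D, E⟩ = Real.pi - 2 * Real.arctan (D / E) := by
  obtain ⟨h0, hπ⟩ := arg_mem_Ioo_of_im_pos (z := ⟨D, E⟩) hE
  have hne : (⟨D, E⟩ : ℂ) ≠ 0 := fun h0 => hE.ne' (congrArg Complex.im h0)
  have hn : 0 < ‖(⟨D, E⟩ : ℂ)‖ := norm_pos_iff.2 hne
  have : Real.tan (Real.pi / 2 - Complex.arg ⟨D, E⟩) = D / E := by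
    rw [Real.tan_pi_div_two_sub, Real.tan_eq_sin_div_cos, Complex.sin_arg, Complex.cos_arg hne,
      inv_div]
    field_simp
  rw [← this, Real.arctan_tan (by linarith) (by linarith)]
  ring

/-- The formula of van Oosterom and Strackee: passing from dihedral angles to the solid angle. -/
theorem sum_arg_sub_pi_eq {A B C x y z E : ℝ} (hE : 0 < E) (hA : 0 < A) (hB : 0 < B) (hC : 0 < C)
    (hdet : E ^ 2 = A ^ 2 * B ^ 2 * C ^ 2 + 2 * x * y * z - A ^ 2 * y ^ 2 - B ^ 2 * z ^ 2 -
      C ^ 2 * x ^ 2)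
    (hx : x < A * B) (hy : y < B * C) (hz : z < C * A)
    (hnonneg : 0 ≤ Complex.arg ⟨-(y * z - x * C ^ 2), C * E⟩ +
      Complex.arg ⟨-(x * y - z * B ^ 2), B * E⟩ +
      Complex.arg ⟨-(x * z - y * A ^ 2), A * E⟩ - Real.pi) :
    Complex.arg ⟨-(y * z - x * C ^ 2), C * E⟩ + Complex.arg ⟨-(x * y - z * B ^ 2), B * E⟩ +
      Complex.arg ⟨-(x * z - y * A ^ 2), A * E⟩ - Real.pi =
      Real.pi - 2 * Real.arctan ((A * B * C + x * C + y * A + z * B) / E) := by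
  rw [← two_mul_arg_eq hE]
  set z₁ : ℂ := ⟨-(y * z - x * C ^ 2), C * E⟩ with hz₁
  set z₂ : ℂ := ⟨-(x * y - z * B ^ 2), B * E⟩ with hz₂
  set z₃ : ℂ := ⟨-(x * z - y * A ^ 2), A * E⟩ with hz₃
  set w : ℂ := ⟨A * B * C + x * C + y * A + z * B, E⟩ with hw
  have i₁ := arg_mem_Ioo_of_im_pos (z := z₁) (mul_pos hC hE)
  have i₂ := arg_mem_Ioo_of_im_pos (z := z₂) (mul_pos hB hE)
  have i₃ := arg_mem_Ioo_of_im_pos (z := z₃) (mul_pos hA hE)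
  have iw := arg_mem_Ioo_of_im_pos (z := w) hE
  have n₁ : 0 < ‖z₁‖ := norm_pos_iff.2 fun h => (mul_pos hC hE).ne' (congrArg Complex.im h)
  have n₂ : 0 < ‖z₂‖ := norm_pos_iff.2 fun h => (mul_pos hB hE).ne' (congrArg Complex.im h)
  have n₃ : 0 < ‖z₃‖ := norm_pos_iff.2 fun h => (mul_pos hA hE).ne' (congrArg Complex.im h)
  have nw : 0 < ‖w‖ := norm_pos_iff.2 fun h => hE.ne' (congrArg Complex.im h)
  set κ : ℝ := (A * B - x) * (B * C - y) * (C * A - z) with hκ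
  have hκ0 : 0 < κ := mul_pos (mul_pos (by linarith) (by linarith)) (by linarith)
  -- The crucial identity: z₁z₂z₃ is a negative multiple of w², so the three arguments sum to π + 2
  -- arg w modulo 2π. Its real and imaginary parts are polynomial identities modulo `hdet`.
  have hprod : 2 * (z₁ * z₂ * z₃) = -((κ : ℂ) * w ^ 2) := by
    rw [pow_two]
    apply Complex.ext
    · simp only [hz₁, hz₂, hz₃, hw, Complex.mul_re, Complex.mul_im, Complex.neg_re,
        Complex.ofReal_re, Complex.ofReal_im, Complex.re_ofNat, Complex.im_ofNat]
      rw [hκ]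
      linear_combination (2 * ((y * z - x * C ^ 2) * A * B + (x * y - z * B ^ 2) * A * C +
        (x * z - y * A ^ 2) * B * C) - (A * B - x) * (B * C - y) * (C * A - z)) * hdet
    · simp only [hz₁, hz₂, hz₃, hw, Complex.mul_re, Complex.mul_im, Complex.neg_im,
        Complex.ofReal_re, Complex.ofReal_im, Complex.re_ofNat, Complex.im_ofNat]
      rw [hκ]
      linear_combination (-2 * A * B * C * E) * hdet
  have hnorm : 2 * (‖z₁‖ * ‖z₂‖ * ‖z₃‖) = κ * ‖w‖ ^ 2 := by
    have := congrArg norm hprod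
    simpa [abs_of_pos hκ0] using this
  have hexp : Complex.exp ((z₁.arg + z₂.arg + z₃.arg - Real.pi : ℝ) * Complex.I) =
      Complex.exp ((2 * w.arg : ℝ) * Complex.I) := by
    have e₁ := Complex.norm_mul_exp_arg_mul_I z₁
    have e₂ := Complex.norm_mul_exp_arg_mul_I z₂
    have e₃ := Complex.norm_mul_exp_arg_mul_I z₃
    have ew := Complex.norm_mul_exp_arg_mul_I w
    have l1 : Complex.exp ((z₁.arg + z₂.arg + z₃.arg - Real.pi : ℝ) * Complex.I) =
        -(Complex.exp (z₁.arg * Complex.I) * Complex.exp (z₂.arg * Complex.I) *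
          Complex.exp (z₃.arg * Complex.I)) := by
      rw [← Complex.exp_add, ← Complex.exp_add, ← mul_neg_one, ← Complex.exp_neg_pi_mul_I,
        ← Complex.exp_add]
      congr 1
      push_cast
      ring
    have l2 : Complex.exp ((2 * w.arg : ℝ) * Complex.I) = Complex.exp (w.arg * Complex.I) ^ 2 := by
      rw [pow_two, ← Complex.exp_add]
      congr 1
      push_cast
      ring
    rw [l1, l2]
    have hne : ((κ * ‖w‖ ^ 2 : ℝ) : ℂ) ≠ 0 := by
      exact_mod_cast (mul_pos hκ0 (pow_pos nw 2)).ne'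
    apply mul_left_cancel₀ hne
    conv_lhs => rw [← hnorm]
    push_cast
    calc _ = -(2 * ((‖z₁‖ * Complex.exp (z₁.arg * Complex.I)) *
          (‖z₂‖ * Complex.exp (z₂.arg * Complex.I)) *
          (‖z₃‖ * Complex.exp (z₃.arg * Complex.I)))) := by ring
      _ = (κ : ℂ) * (‖w‖ * Complex.exp (w.arg * Complex.I)) ^ 2 := by
        rw [e₁, e₂, e₃, ew, hprod, neg_neg]
      _ = _ := by ring
  obtain ⟨n, hn⟩ := Complex.exp_eq_exp_iff_exists_int.1 hexp
  have hn' : z₁.arg + z₂.arg + z₃.arg - Real.pi = 2 * w.arg + n * (2 * Real.pi) := by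
    have := congrArg Complex.im hn
    simpa using this
  have hpi := Real.pi_pos
  -- The multiple of 2π is zero: the angle excess lies in [0, 2π) (its nonnegativity is `hnonneg`)
  -- and 2 arg w lies in (0, 2π).
  have hlt : (n : ℝ) < 1 := by
    by_contra h
    push Not at h
    nlinarith [i₁.2, i₂.2, i₃.2, iw.1]
  have hgt : (-1 : ℝ) < n := by
    by_contra h
    push Not at h
    nlinarith [iw.2]
  have hn0 : n = 0 := by
    have h1 : n < 1 := by exact_mod_cast hlt
    have h2 : -1 < n := by exact_mod_cast hgt
    omega
  rw [hn', hn0]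
  simp

/-- The solid angle of a trihedral cone cut out by three half-spaces is three times the volume of
its part in the unit ball. -/
theorem toSphere_real_cone (n₁ n₂ n₃ : EuclideanSpace ℝ (Fin 3)) :
    (volume : Measure (EuclideanSpace ℝ (Fin 3))).toSphere.real
      {u : Metric.sphere (0 : EuclideanSpace ℝ (Fin 3)) 1 |
        0 ≤ inner ℝ n₁ (u : EuclideanSpace ℝ (Fin 3)) ∧
        0 ≤ inner ℝ n₂ (u : EuclideanSpace ℝ (Fin 3)) ∧
        0 ≤ inner ℝ n₃ (u : EuclideanSpace ℝ (Fin 3))} =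
      3 * volume.real {x : EuclideanSpace ℝ (Fin 3) |
        ‖x‖ < 1 ∧ 0 ≤ inner ℝ n₁ x ∧ 0 ≤ inner ℝ n₂ x ∧ 0 ≤ inner ℝ n₃ x} := by
  have hcl : ∀ n : EuclideanSpace ℝ (Fin 3),
      IsClosed {u : Metric.sphere (0 : EuclideanSpace ℝ (Fin 3)) 1 |
        0 ≤ inner ℝ n (u : EuclideanSpace ℝ (Fin 3))} := fun n =>
    isClosed_le continuous_const (continuous_const.inner continuous_subtype_val)
  have hm : MeasurableSet {u : Metric.sphere (0 : EuclideanSpace ℝ (Fin 3)) 1 |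
        0 ≤ inner ℝ n₁ (u : EuclideanSpace ℝ (Fin 3)) ∧
        0 ≤ inner ℝ n₂ (u : EuclideanSpace ℝ (Fin 3)) ∧
        0 ≤ inner ℝ n₃ (u : EuclideanSpace ℝ (Fin 3))} :=
    ((hcl n₁).inter ((hcl n₂).inter (hcl n₃))).measurableSet
  rw [Measure.real, Measure.toSphere_apply' _ hm, ENNReal.toReal_mul, Measure.real]
  congr 1
  · simp
  · congr 1
    have hae : ∀ᵐ x : EuclideanSpace ℝ (Fin 3), x ≠ 0 := by
      rw [ae_iff]
      simp
    refine measure_congr ?_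
    filter_upwards [hae] with x hx
    refine propext ?_
    have hn : 0 < ‖x‖ := norm_pos_iff.2 hx
    constructor
    · rintro ⟨t, ht, _, ⟨u, ⟨h1, h2, h3⟩, rfl⟩, rfl⟩
      have hu : ‖(u : EuclideanSpace ℝ (Fin 3))‖ = 1 := norm_eq_of_mem_sphere u
      refine ⟨?_, ?_⟩
      · change ‖t • (u : EuclideanSpace ℝ (Fin 3))‖ < 1
        rw [norm_smul, hu, mul_one, Real.norm_of_nonneg ht.1.le]
        exact ht.2
      · simp only [real_inner_smul_right]
        exact ⟨mul_nonneg ht.1.le h1, mul_nonneg ht.1.le h2, mul_nonneg ht.1.le h3⟩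
    · rintro ⟨hlt, h1, h2, h3⟩
      refine ⟨‖x‖, ⟨hn, hlt⟩, ‖x‖⁻¹ • x, ⟨⟨‖x‖⁻¹ • x, ?_⟩, ?_, rfl⟩, ?_⟩
      · simp [norm_smul, hn.ne']
      · simp only [Set.mem_ofPred_eq, real_inner_smul_right]
        have := inv_nonneg.2 hn.le
        exact ⟨mul_nonneg this h1, mul_nonneg this h2, mul_nonneg this h3⟩
      · change ‖x‖ • ‖x‖⁻¹ • x = x
        rw [smul_smul, mul_inv_cancel₀ hn.ne', one_smul]

/-- The solid angle of a tetrahedron in terms of the lengths `A, B, C` of the edges at a vertex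
and their mutual inner products. -/
theorem solidAngleAt_tetrahedron {p a b c : EuclideanSpace ℝ (Fin 3)} {A B C x y z E : ℝ}
    (hA : 0 < A) (hB : 0 < B) (hC : 0 < C) (hE : 0 < E)
    (haa : inner ℝ a a = A ^ 2) (hbb : inner ℝ b b = B ^ 2) (hcc : inner ℝ c c = C ^ 2)
    (hab : inner ℝ a b = x) (hbc : inner ℝ b c = y) (hca : inner ℝ c a = z)
    (hdet : E ^ 2 = A ^ 2 * B ^ 2 * C ^ 2 + 2 * x * y * z - A ^ 2 * y ^ 2 - B ^ 2 * z ^ 2 -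
      C ^ 2 * x ^ 2)
    (hx : |x| < A * B) (hy : |y| < B * C) (hz : |z| < C * A) :
    solidAngleAt (convexHull ℝ {p, p + a, p + b, p + c}) p =
      Real.pi - 2 * Real.arctan ((A * B * C + x * C + y * A + z * B) / E) := by
  have hba : inner ℝ b a = x := by rw [real_inner_comm, hab]
  have hcb : inner ℝ c b = y := by rw [real_inner_comm, hbc]
  have hac : inner ℝ a c = z := by rw [real_inner_comm, hca]
  have hE2 : 0 < E ^ 2 := by positivity
  have c33 : 0 < A ^ 2 * B ^ 2 - x ^ 2 := by
    have := sq_lt_sq' (by linarith [(abs_lt.1 hx).1]) (abs_lt.1 hx).2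
    nlinarith
  have c11 : 0 < B ^ 2 * C ^ 2 - y ^ 2 := by
    have := sq_lt_sq' (by linarith [(abs_lt.1 hy).1]) (abs_lt.1 hy).2
    nlinarith
  have c22 : 0 < A ^ 2 * C ^ 2 - z ^ 2 := by
    have := sq_lt_sq' (by linarith [(abs_lt.1 hz).1]) (abs_lt.1 hz).2
    nlinarith
  -- The coefficients are the cofactors of the Gram matrix of a, b, c, so n₁, n₂, n₃ are E² times
  -- the dual basis: the inward normals of the faces at p.
  set n₁ := (B ^ 2 * C ^ 2 - y ^ 2) • a + (y * z - x * C ^ 2) • b + (x * y - z * B ^ 2) • c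
    with hn₁
  set n₂ := (y * z - x * C ^ 2) • a + (A ^ 2 * C ^ 2 - z ^ 2) • b + (x * z - y * A ^ 2) • c
    with hn₂
  set n₃ := (x * y - z * B ^ 2) • a + (x * z - y * A ^ 2) • b + (A ^ 2 * B ^ 2 - x ^ 2) • c
    with hn₃
  have hexp : ∀ (s t u : ℝ) (w : EuclideanSpace ℝ (Fin 3)), inner ℝ (s • a + t • b + u • c) w =
      s * inner ℝ a w + t * inner ℝ b w + u * inner ℝ c w := fun s t u w => by
    rw [inner_add_left, inner_add_left, real_inner_smul_left, real_inner_smul_left,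
      real_inner_smul_left]
  have d11 : inner ℝ n₁ a = E ^ 2 := by rw [hexp, haa, hba, hca, hdet]; ring
  have d12 : inner ℝ n₁ b = (0 : ℝ) := by rw [hexp, hab, hbb, hcb]; ring
  have d13 : inner ℝ n₁ c = (0 : ℝ) := by rw [hexp, hac, hbc, hcc]; ring
  have d21 : inner ℝ n₂ a = (0 : ℝ) := by rw [hexp, haa, hba, hca]; ring
  have d22 : inner ℝ n₂ b = E ^ 2 := by rw [hexp, hab, hbb, hcb, hdet]; ring
  have d23 : inner ℝ n₂ c = (0 : ℝ) := by rw [hexp, hac, hbc, hcc]; ring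
  have d31 : inner ℝ n₃ a = (0 : ℝ) := by rw [hexp, haa, hba, hca]; ring
  have d32 : inner ℝ n₃ b = (0 : ℝ) := by rw [hexp, hab, hbb, hcb]; ring
  have d33 : inner ℝ n₃ c = E ^ 2 := by rw [hexp, hac, hbc, hcc, hdet]; ring
  have hcomb : ∀ (s t u : ℝ) (w : EuclideanSpace ℝ (Fin 3)), inner ℝ w (s • a + t • b + u • c) =
      s * inner ℝ w a + t * inner ℝ w b + u * inner ℝ w c := fun s t u w => by
    rw [inner_add_right, inner_add_right, real_inner_smul_right, real_inner_smul_right,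
      real_inner_smul_right]
  have m11 : ‖n₁‖ ^ 2 = (B ^ 2 * C ^ 2 - y ^ 2) * E ^ 2 := by
    rw [← real_inner_self_eq_norm_sq]
    conv_lhs => enter [3]; rw [hn₁]
    rw [hcomb, d11, d12, d13]; ring
  have m22 : ‖n₂‖ ^ 2 = (A ^ 2 * C ^ 2 - z ^ 2) * E ^ 2 := by
    rw [← real_inner_self_eq_norm_sq]
    conv_lhs => enter [3]; rw [hn₂]
    rw [hcomb, d21, d22, d23]; ring
  have m33 : ‖n₃‖ ^ 2 = (A ^ 2 * B ^ 2 - x ^ 2) * E ^ 2 := by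
    rw [← real_inner_self_eq_norm_sq]
    conv_lhs => enter [3]; rw [hn₃]
    rw [hcomb, d31, d32, d33]; ring
  have m12 : inner ℝ n₁ n₂ = (y * z - x * C ^ 2) * E ^ 2 := by
    rw [hn₂, hcomb, d11, d12, d13]; ring
  have m13 : inner ℝ n₁ n₃ = (x * y - z * B ^ 2) * E ^ 2 := by
    rw [hn₃, hcomb, d11, d12, d13]; ring
  have m23 : inner ℝ n₂ n₃ = (x * z - y * A ^ 2) * E ^ 2 := by
    rw [hn₃, hcomb, d21, d22, d23]; ring
  have z₁ : n₁ ≠ 0 := by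
    rw [← norm_ne_zero_iff, ← pow_ne_zero_iff two_ne_zero, m11]; positivity
  have z₂ : n₂ ≠ 0 := by
    rw [← norm_ne_zero_iff, ← pow_ne_zero_iff two_ne_zero, m22]; positivity
  have z₃ : n₃ ≠ 0 := by
    rw [← norm_ne_zero_iff, ← pow_ne_zero_iff two_ne_zero, m33]; positivity
  have harg : ∀ u v : ℝ, Complex.arg ⟨-(u * E ^ 2), v * E ^ 2⟩ = Complex.arg ⟨-u, v⟩ := by
    intro u v
    rw [← Complex.arg_real_mul ⟨-u, v⟩ hE2]
    congr 1
    apply Complex.ext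
    · rw [Complex.re_ofReal_mul]; ring
    · rw [Complex.im_ofReal_mul]; ring
  have a12 := pi_sub_angle_eq_arg (n := n₁) (m := n₂) (s := C * E * E ^ 2) (by positivity)
    (by rw [m11, m22, m12]; linear_combination C ^ 2 * E ^ 4 * hdet)
  have a13 := pi_sub_angle_eq_arg (n := n₁) (m := n₃) (s := B * E * E ^ 2) (by positivity)
    (by rw [m11, m33, m13]; linear_combination B ^ 2 * E ^ 4 * hdet)
  have a23 := pi_sub_angle_eq_arg (n := n₂) (m := n₃) (s := A * E * E ^ 2) (by positivity)
    (by rw [m22, m33, m23]; linear_combination A ^ 2 * E ^ 4 * hdet)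
  rw [m12, harg] at a12
  rw [m13, harg] at a13
  rw [m23, harg] at a23
  have r12 : InnerProductGeometry.angle n₁ n₂ ∈ Set.Ioo 0 Real.pi := by
    have := arg_mem_Ioo_of_im_pos (z := ⟨-(y * z - x * C ^ 2), C * E⟩) (by positivity)
    rw [← a12] at this
    exact ⟨by linarith [this.2], by linarith [this.1]⟩
  have r13 : InnerProductGeometry.angle n₁ n₃ ∈ Set.Ioo 0 Real.pi := by
    have := arg_mem_Ioo_of_im_pos (z := ⟨-(x * y - z * B ^ 2), B * E⟩) (by positivity)
    rw [← a13] at this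
    exact ⟨by linarith [this.2], by linarith [this.1]⟩
  have r23 : InnerProductGeometry.angle n₂ n₃ ∈ Set.Ioo 0 Real.pi := by
    have := arg_mem_Ioo_of_im_pos (z := ⟨-(x * z - y * A ^ 2), A * E⟩) (by positivity)
    rw [← a23] at this
    exact ⟨by linarith [this.2], by linarith [this.1]⟩
  have hset : {u : Metric.sphere (0 : EuclideanSpace ℝ (Fin 3)) 1 |
      ∃ t : ℝ, 0 < t ∧ p + t • (u : EuclideanSpace ℝ (Fin 3)) ∈
        convexHull ℝ {p, p + a, p + b, p + c}} =
      {u : Metric.sphere (0 : EuclideanSpace ℝ (Fin 3)) 1 |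
        0 ≤ inner ℝ n₁ (u : EuclideanSpace ℝ (Fin 3)) ∧
        0 ≤ inner ℝ n₂ (u : EuclideanSpace ℝ (Fin 3)) ∧
        0 ≤ inner ℝ n₃ (u : EuclideanSpace ℝ (Fin 3))} := by
    ext u
    constructor
    · rintro ⟨t, ht, hmem⟩
      have hsub : ∀ n : EuclideanSpace ℝ (Fin 3), 0 ≤ inner ℝ n a → 0 ≤ inner ℝ n b →
          0 ≤ inner ℝ n c → 0 ≤ inner ℝ n (u : EuclideanSpace ℝ (Fin 3)) := by
        intro n ha hb hc
        have hconv : Convex ℝ {w : EuclideanSpace ℝ (Fin 3) | inner ℝ n p ≤ inner ℝ n w} :=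
          convex_halfSpace_ge (innerSL ℝ n).toLinearMap.isLinear _
        have hle : inner ℝ n p ≤ inner ℝ n (p + t • (u : EuclideanSpace ℝ (Fin 3))) := by
          refine convexHull_min ?_ hconv hmem
          rintro w (rfl | rfl | rfl | rfl) <;> simp [inner_add_right, ha, hb, hc]
        rw [inner_add_right, real_inner_smul_right] at hle
        exact nonneg_of_mul_nonneg_right (by linarith) ht
      exact ⟨hsub n₁ (by rw [d11]; positivity) d12.ge d13.ge,
        hsub n₂ d21.ge (by rw [d22]; positivity) d23.ge,
        hsub n₃ d31.ge d32.ge (by rw [d33]; positivity)⟩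
    · rintro ⟨h1, h2, h3⟩
      have hli : LinearIndependent ℝ ![a, b, c] := by
        rw [Fintype.linearIndependent_iff]
        intro g hg
        rw [Fin.sum_univ_three] at hg
        have hz : ∀ n : EuclideanSpace ℝ (Fin 3),
            g 0 * inner ℝ n a + g 1 * inner ℝ n b + g 2 * inner ℝ n c = 0 := fun n => by
          rw [← hcomb]
          exact (congrArg (inner ℝ n) hg).trans (inner_zero_right n)
        have g0 := hz n₁
        have g1 := hz n₂
        have g2 := hz n₃
        rw [d11, d12, d13] at g0
        rw [d21, d22, d23] at g1
        rw [d31, d32, d33] at g2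
        have hEn := hE2.ne'
        intro i
        fin_cases i
        · simpa [hE.ne'] using g0
        · simpa [hE.ne'] using g1
        · simpa [hE.ne'] using g2
      have hu : (u : EuclideanSpace ℝ (Fin 3)) ∈ Submodule.span ℝ (Set.range ![a, b, c]) := by
        rw [hli.span_eq_top_of_card_eq_finrank (by simp)]
        trivial
      obtain ⟨g, hg⟩ := (Submodule.mem_span_range_iff_exists_fun ℝ).1 hu
      rw [Fin.sum_univ_three] at hg
      change g 0 • a + g 1 • b + g 2 • c = u at hg
      rw [← hg, hcomb, d11, d12, d13] at h1
      rw [← hg, hcomb, d21, d22, d23] at h2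
      rw [← hg, hcomb, d31, d32, d33] at h3
      have g0 : 0 ≤ g 0 := nonneg_of_mul_nonneg_left (by linarith) hE2
      have g1 : 0 ≤ g 1 := nonneg_of_mul_nonneg_left (by linarith) hE2
      have g2 : 0 ≤ g 2 := nonneg_of_mul_nonneg_left (by linarith) hE2
      have hS : 0 < g 0 + g 1 + g 2 := by
        refine lt_of_le_of_ne (by positivity) fun h0 => ?_
        have e0 : g 0 = 0 := by linarith
        have e1 : g 1 = 0 := by linarith
        have e2 : g 2 = 0 := by linarith
        rw [e0, e1, e2] at hg
        have hn := norm_eq_of_mem_sphere u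
        rw [← hg] at hn
        simp at hn
      -- This scaling puts the ray on the face opposite to p, where the cone coefficients become
      -- convex weights.
      refine ⟨(g 0 + g 1 + g 2)⁻¹, inv_pos.2 hS, ?_⟩
      have hmem := (convex_convexHull ℝ ({p, p + a, p + b, p + c} :
        Set (EuclideanSpace ℝ (Fin 3)))).sum_mem (t := Finset.univ)
        (w := fun i => (g 0 + g 1 + g 2)⁻¹ * g i) (z := ![p + a, p + b, p + c])
        (fun i _ => by
          refine mul_nonneg (inv_nonneg.2 hS.le) ?_
          fin_cases i <;> assumption)
        (by rw [← Finset.mul_sum, Fin.sum_univ_three, inv_mul_cancel₀ hS.ne'])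
        (fun i _ => subset_convexHull ℝ _ (by fin_cases i <;> simp))
      convert hmem using 1
      rw [Fin.sum_univ_three, ← hg]
      change _ = ((g 0 + g 1 + g 2)⁻¹ * g 0) • (p + a) + ((g 0 + g 1 + g 2)⁻¹ * g 1) • (p + b) +
        ((g 0 + g 1 + g 2)⁻¹ * g 2) • (p + c)
      have hp : p = ((g 0 + g 1 + g 2)⁻¹ * g 0 + (g 0 + g 1 + g 2)⁻¹ * g 1 +
          (g 0 + g 1 + g 2)⁻¹ * g 2) • p := by
        rw [← mul_add, ← mul_add, inv_mul_cancel₀ hS.ne', one_smul]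
      nth_rw 1 [hp]
      module
  rw [solidAngleAt, hset, toSphere_real_cone]
  have hvol := volume_ball_inter_trihedral z₁ z₂ z₃ r12 r13 r23
  have hV : volume.real (Metric.ball (0 : EuclideanSpace ℝ (Fin 3)) 1) = 4 * Real.pi / 3 := by
    rw [Measure.real, EuclideanSpace.volume_ball_fin_three, ENNReal.ofReal_one, one_pow, one_mul,
      ENNReal.toReal_ofReal (by positivity), mul_comm]
  have hpi := Real.pi_pos
  have htot : 3 * volume.real {x : EuclideanSpace ℝ (Fin 3) |
      ‖x‖ < 1 ∧ 0 ≤ inner ℝ n₁ x ∧ 0 ≤ inner ℝ n₂ x ∧ 0 ≤ inner ℝ n₃ x} =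
      Complex.arg ⟨-(y * z - x * C ^ 2), C * E⟩ + Complex.arg ⟨-(x * y - z * B ^ 2), B * E⟩ +
      Complex.arg ⟨-(x * z - y * A ^ 2), A * E⟩ - Real.pi := by
    rw [hvol, hV, ← a12, ← a13, ← a23]
    field_simp
    ring
  have hnonneg : 0 ≤ 3 * volume.real {x : EuclideanSpace ℝ (Fin 3) |
      ‖x‖ < 1 ∧ 0 ≤ inner ℝ n₁ x ∧ 0 ≤ inner ℝ n₂ x ∧ 0 ≤ inner ℝ n₃ x} := by positivity
  rw [htot] at hnonneg ⊢
  exact sum_arg_sub_pi_eq hE hA hB hC hdet (abs_lt.1 hx).2 (abs_lt.1 hy).2 (abs_lt.1 hz).2 hnonneg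

-- Realizing tangent spheres and expressing solid angles by radii

/-- Descartes' quadratic form in the reciprocal radii `x`; it is positive exactly when four
mutually tangent spheres exist. -/
def descartesForm {V : Type*} (x : V → ℝ) (τ : Finset V) : ℝ :=
  (∑ v ∈ τ, x v) ^ 2 - 2 * ∑ v ∈ τ, x v ^ 2

/-- The numerator of the cotangent of half the solid angle at `i` in terms of the reciprocal radii
`x`. -/
def halfCot {V : Type*} (x : V → ℝ) (τ : Finset V) (i : V) : ℝ :=
  2 * (∏ v ∈ τ, x v) / x i ^ 3 + ((∑ v ∈ τ, x v) ^ 2 - ∑ v ∈ τ, x v ^ 2) / x i - ∑ v ∈ τ, x v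

/-- Reduces statements about a tetrahedron with a marked vertex to polynomial identities in four
variables, the marked one first. The swap moves i to position 0 in an arbitrary enumeration. -/
theorem exists_fin_four_enum {V : Type*} [DecidableEq V] {τ : Finset V} (hτ : τ.card = 4) {i : V}
    (hi : i ∈ τ) : ∃ f : Fin 4 → V, Function.Injective f ∧ f 0 = i ∧ τ = Finset.univ.image f := by
  set e := τ.equivFinOfCardEq hτ
  have hinj : Function.Injective
      (fun m : Fin 4 => ((e.symm (Equiv.swap 0 (e ⟨i, hi⟩) m) : τ) : V)) :=
    Subtype.val_injective.comp (e.symm.injective.comp (Equiv.swap _ _).injective)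
  refine ⟨_, hinj, by simp, ?_⟩
  symm
  refine Finset.eq_of_subset_of_card_le ?_ ?_
  · intro v hv
    obtain ⟨m, -, rfl⟩ := Finset.mem_image.1 hv
    exact Subtype.property _
  · rw [Finset.card_image_of_injective _ hinj, hτ]
    simp

theorem affineIndependent_fin_four_iff {F : Type*} [AddCommGroup F] [Module ℝ F]
    (q : Fin 4 → F) :
    AffineIndependent ℝ q ↔ LinearIndependent ℝ ![q 1 - q 0, q 2 - q 0, q 3 - q 0] := by
  rw [affineIndependent_iff_linearIndependent_vsub ℝ q 0,
    ← linearIndependent_equiv (finSuccAboveEquiv (0 : Fin 4))]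
  have : (fun i : { x // x ≠ (0 : Fin 4) } => q i -ᵥ q 0) ∘ finSuccAboveEquiv (0 : Fin 4) =
      ![q 1 - q 0, q 2 - q 0, q 3 - q 0] := by
    funext m
    fin_cases m <;> rfl
  rw [this]

theorem affineIndependent_image_iff {V F : Type*} [DecidableEq V] [AddCommGroup F] [Module ℝ F]
    {f : Fin 4 → V} (hf : Function.Injective f) (p : V → F) :
    AffineIndependent ℝ (fun v : (Finset.univ.image f : Finset V) => p v) ↔
      AffineIndependent ℝ (p ∘ f) := by
  let g : Fin 4 → (Finset.univ.image f : Finset V) := fun m => ⟨f m, by simp⟩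
  have hg : Function.Bijective g := by
    refine ⟨fun m n h => hf (congrArg Subtype.val h), ?_⟩
    rintro ⟨v, hv⟩
    obtain ⟨m, -, rfl⟩ := Finset.mem_image.1 hv
    exact ⟨m, rfl⟩
  rw [← affineIndependent_equiv (Equiv.ofBijective g hg)]
  rfl

theorem isEuclideanRealization_image_iff {V : Type*} [DecidableEq V] {f : Fin 4 → V}
    (hf : Function.Injective f) (r : V → ℝ) (p : V → EuclideanSpace ℝ (Fin 3)) :
    IsEuclideanRealization r (Finset.univ.image f) p ↔
      LinearIndependent ℝ ![p (f 1) - p (f 0), p (f 2) - p (f 0), p (f 3) - p (f 0)] ∧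
        ∀ m n, m ≠ n → dist (p (f m)) (p (f n)) = r (f m) + r (f n) := by
  rw [IsEuclideanRealization, affineIndependent_image_iff hf, affineIndependent_fin_four_iff]
  refine and_congr Iff.rfl ⟨fun h m n hmn => h _ (by simp) _ (by simp) (hf.ne hmn), ?_⟩
  intro h i hi j hj hij
  obtain ⟨m, -, rfl⟩ := Finset.mem_image.1 hi
  obtain ⟨n, -, rfl⟩ := Finset.mem_image.1 hj
  exact h m n fun e => hij (congrArg f e)

/-- Vectors in Euclidean 3-space with a prescribed positive definite Gram matrix. -/
theorem exists_vectors_of_gram {A B C x y z E : ℝ} (hA : 0 < A)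
    (hx : |x| < A * B)
    (hdet : E ^ 2 = A ^ 2 * B ^ 2 * C ^ 2 + 2 * x * y * z - A ^ 2 * y ^ 2 - B ^ 2 * z ^ 2 -
      C ^ 2 * x ^ 2) :
    ∃ a b c : EuclideanSpace ℝ (Fin 3), inner ℝ a a = A ^ 2 ∧ inner ℝ b b = B ^ 2 ∧
      inner ℝ c c = C ^ 2 ∧ inner ℝ a b = x ∧ inner ℝ b c = y ∧ inner ℝ c a = z := by
  have c33 : 0 < A ^ 2 * B ^ 2 - x ^ 2 := by
    have := sq_lt_sq' (by linarith [(abs_lt.1 hx).1]) (abs_lt.1 hx).2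
    nlinarith
  set s := Real.sqrt (A ^ 2 * B ^ 2 - x ^ 2) with hs
  have hs0 : 0 < s := Real.sqrt_pos.2 c33
  have hs2 : s ^ 2 = A ^ 2 * B ^ 2 - x ^ 2 := Real.sq_sqrt c33.le
  -- The rows of the Cholesky factor of the Gram matrix; s² is its leading 2×2 minor and E² its
  -- determinant.
  refine ⟨!₂[A, 0, 0], !₂[x / A, s / A, 0],
    !₂[z / A, (A ^ 2 * y - x * z) / (A * s), E / s], ?_, ?_, ?_, ?_, ?_, ?_⟩ <;>
    simp only [PiLp.inner_apply, Fin.sum_univ_three, RCLike.inner_apply, conj_trivial] <;> simp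
  · ring
  · field_simp
    linear_combination hs2
  · field_simp
    linear_combination A ^ 2 * hdet + (z ^ 2 - A ^ 2 * C ^ 2) * hs2
  · field_simp
  · field_simp
    ring
  · field_simp

/-- Descartes' form and the Gram determinant of the tetrahedron spanned by four mutually tangent
spheres. -/
theorem gram_det_eq {a b c d Q : ℝ} (ha : 0 < a) (hb : 0 < b) (hc : 0 < c) (hd : 0 < d)
    (hQ : Q = (a⁻¹ + b⁻¹ + c⁻¹ + d⁻¹) ^ 2 - 2 * (a⁻¹ ^ 2 + b⁻¹ ^ 2 + c⁻¹ ^ 2 + d⁻¹ ^ 2)) :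
    (a + b) ^ 2 * (a + c) ^ 2 * (a + d) ^ 2 +
      2 * (a ^ 2 + a * b + a * c - b * c) * (a ^ 2 + a * c + a * d - c * d) *
        (a ^ 2 + a * d + a * b - d * b) -
      (a + b) ^ 2 * (a ^ 2 + a * c + a * d - c * d) ^ 2 -
      (a + c) ^ 2 * (a ^ 2 + a * d + a * b - d * b) ^ 2 -
      (a + d) ^ 2 * (a ^ 2 + a * b + a * c - b * c) ^ 2 = (2 * a * b * c * d) ^ 2 * Q := by
  rw [hQ]
  field_simp
  ring

/-- Strict Cauchy-Schwarz for two edges at a vertex: the two gaps are 2bc and 2a(a + b + c). -/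
theorem abs_gram_entry_lt {a b c : ℝ} (ha : 0 < a) (hb : 0 < b) (hc : 0 < c) :
    |a ^ 2 + a * b + a * c - b * c| < (a + b) * (a + c) := by
  have h1 := mul_pos ha hb
  have h2 := mul_pos ha hc
  have h3 := mul_pos hb hc
  rw [abs_lt]
  constructor <;> nlinarith

theorem inner_eq_of_dist {F : Type*} [NormedAddCommGroup F] [InnerProductSpace ℝ F] {p q s : F}
    {a b c : ℝ} (h1 : dist q p = b + a) (h2 : dist s p = c + a) (h3 : dist q s = b + c) :
    inner ℝ (q - p) (s - p) = a ^ 2 + a * b + a * c - b * c := by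
  have := real_inner_eq_norm_mul_self_add_norm_mul_self_sub_norm_sub_mul_self_div_two
    (q - p) (s - p)
  rw [this, sub_sub_sub_cancel_right, ← dist_eq_norm, ← dist_eq_norm, ← dist_eq_norm, h1, h2, h3]
  ring

section Realization

variable {V : Type*}

theorem descartesForm_image [DecidableEq V] {f : Fin 4 → V} (hf : Function.Injective f)
    (x : V → ℝ) : descartesForm x (Finset.univ.image f) =
      (x (f 0) + x (f 1) + x (f 2) + x (f 3)) ^ 2 -
        2 * (x (f 0) ^ 2 + x (f 1) ^ 2 + x (f 2) ^ 2 + x (f 3) ^ 2) := by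
  rw [descartesForm, Finset.sum_image hf.injOn, Finset.sum_image hf.injOn, Fin.sum_univ_four,
    Fin.sum_univ_four]

theorem halfCot_image [DecidableEq V] {f : Fin 4 → V} (hf : Function.Injective f)
    (x : V → ℝ) (i : V) : halfCot x (Finset.univ.image f) i =
      2 * (x (f 0) * x (f 1) * x (f 2) * x (f 3)) / x i ^ 3 +
        ((x (f 0) + x (f 1) + x (f 2) + x (f 3)) ^ 2 -
          (x (f 0) ^ 2 + x (f 1) ^ 2 + x (f 2) ^ 2 + x (f 3) ^ 2)) / x i -
        (x (f 0) + x (f 1) + x (f 2) + x (f 3)) := by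
  rw [halfCot, Finset.sum_image hf.injOn, Finset.sum_image hf.injOn, Finset.prod_image hf.injOn,
    Fin.sum_univ_four, Fin.sum_univ_four, Fin.prod_univ_four]

/-- The Gram matrix of independent edge vectors is positive definite, and by `gram_det_eq` its
determinant is a positive multiple of Descartes' form. -/
theorem IsEuclideanRealization.descartesForm_pos [DecidableEq V] {r : V → ℝ} {τ : Finset V}
    {p : V → EuclideanSpace ℝ (Fin 3)} (hp : IsEuclideanRealization r τ p) (hτ : τ.card = 4)
    (hr : ∀ v ∈ τ, 0 < r v) : 0 < descartesForm (fun v => (r v)⁻¹) τ := by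
  obtain ⟨i, hi⟩ := Finset.card_pos.1 (by omega : 0 < τ.card)
  obtain ⟨f, hf, -, rfl⟩ := exists_fin_four_enum hτ hi
  rw [isEuclideanRealization_image_iff hf] at hp
  obtain ⟨hli, hd⟩ := hp
  have hpos : ∀ m, 0 < r (f m) := fun m => hr _ (by simp)
  have hdet := (Matrix.posDef_gram_of_linearIndependent hli).det_pos
  rw [Matrix.det_fin_three] at hdet
  simp only [Matrix.gram_apply, Matrix.cons_val_zero, Matrix.cons_val_one, Matrix.cons_val] at hdet
  rw [inner_eq_of_dist (hd 1 0 (by decide)) (hd 2 0 (by decide)) (hd 1 2 (by decide)),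
    inner_eq_of_dist (hd 2 0 (by decide)) (hd 1 0 (by decide)) (hd 2 1 (by decide)),
    inner_eq_of_dist (hd 1 0 (by decide)) (hd 3 0 (by decide)) (hd 1 3 (by decide)),
    inner_eq_of_dist (hd 3 0 (by decide)) (hd 1 0 (by decide)) (hd 3 1 (by decide)),
    inner_eq_of_dist (hd 2 0 (by decide)) (hd 3 0 (by decide)) (hd 2 3 (by decide)),
    inner_eq_of_dist (hd 3 0 (by decide)) (hd 2 0 (by decide)) (hd 3 2 (by decide)),
    real_inner_self_eq_norm_sq, real_inner_self_eq_norm_sq, real_inner_self_eq_norm_sq,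
    ← dist_eq_norm, ← dist_eq_norm, ← dist_eq_norm, hd 1 0 (by decide), hd 2 0 (by decide),
    hd 3 0 (by decide)] at hdet
  have hQ := gram_det_eq (hpos 0) (hpos 1) (hpos 2) (hpos 3) (descartesForm_image hf fun v => (r v)⁻¹)
  have h0 := hpos 0
  have h1 := hpos 1
  have h2 := hpos 2
  have h3 := hpos 3
  refine pos_of_mul_pos_right (a := (2 * r (f 0) * r (f 1) * r (f 2) * r (f 3)) ^ 2) ?_
    (by positivity)
  rw [← hQ]
  convert hdet using 1
  ring

/-- When Descartes' form is positive, the prescribed Gram matrix has a Cholesky factor. One vertex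
is placed at the origin and the others at the three vectors so obtained; the nonzero Gram
determinant gives independence. -/
theorem exists_isEuclideanRealization [DecidableEq V] {r : V → ℝ} {τ : Finset V}
    (hτ : τ.card = 4) (hr : ∀ v ∈ τ, 0 < r v) (hQ : 0 < descartesForm (fun v => (r v)⁻¹) τ) :
    ∃ p, IsEuclideanRealization r τ p := by
  obtain ⟨i, hi⟩ := Finset.card_pos.1 (by omega : 0 < τ.card)
  obtain ⟨f, hf, -, rfl⟩ := exists_fin_four_enum hτ hi
  have h0 : 0 < r (f 0) := hr _ (by simp)
  have h1 : 0 < r (f 1) := hr _ (by simp)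
  have h2 : 0 < r (f 2) := hr _ (by simp)
  have h3 : 0 < r (f 3) := hr _ (by simp)
  have hdet := gram_det_eq h0 h1 h2 h3 (descartesForm_image hf fun v => (r v)⁻¹)
  set Q := descartesForm (fun v => (r v)⁻¹) (Finset.univ.image f)
  set E := 2 * r (f 0) * r (f 1) * r (f 2) * r (f 3) * Real.sqrt Q with hE
  have hE0 : 0 < E := by have := Real.sqrt_pos.2 hQ; positivity
  have hE2 : E ^ 2 = (2 * r (f 0) * r (f 1) * r (f 2) * r (f 3)) ^ 2 * Q := by
    rw [hE, mul_pow, Real.sq_sqrt hQ.le]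
  obtain ⟨a, b, c, haa, hbb, hcc, hab, hbc, hca⟩ := exists_vectors_of_gram (A := r (f 0) + r (f 1))
    (by positivity) (abs_gram_entry_lt h0 h1 h2) (hE2.trans hdet.symm)
  have hba : inner ℝ b a = _ := (real_inner_comm _ _).trans hab
  have hcb : inner ℝ c b = _ := (real_inner_comm _ _).trans hbc
  have hac : inner ℝ a c = _ := (real_inner_comm _ _).trans hca
  refine ⟨Function.extend f ![0, a, b, c] 0, ?_⟩
  rw [isEuclideanRealization_image_iff hf]
  simp only [hf.extend_apply]
  constructor
  · have : ![(![0, a, b, c] : Fin 4 → EuclideanSpace ℝ (Fin 3)) 1 - (![0, a, b, c] : Fin 4 → _) 0,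
        (![0, a, b, c] : Fin 4 → EuclideanSpace ℝ (Fin 3)) 2 - (![0, a, b, c] : Fin 4 → _) 0,
        (![0, a, b, c] : Fin 4 → EuclideanSpace ℝ (Fin 3)) 3 - (![0, a, b, c] : Fin 4 → _) 0] =
        ![a, b, c] := by simp
    rw [this]
    apply Matrix.linearIndependent_of_det_gram_ne_zero
    rw [Matrix.det_fin_three]
    simp only [Matrix.gram_apply, Matrix.cons_val_zero, Matrix.cons_val_one, Matrix.cons_val]
    rw [haa, hbb, hcc, hab, hbc, hca, hba, hcb, hac]
    have hpos : 0 < E ^ 2 := by positivity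
    rw [hE2, ← hdet] at hpos
    refine (lt_of_lt_of_eq hpos ?_).ne'
    ring
  · have hd : ∀ (u v : EuclideanSpace ℝ (Fin 3)) (l : ℝ), 0 ≤ l →
        inner ℝ u u - 2 * inner ℝ u v + inner ℝ v v = l ^ 2 → dist u v = l := by
      intro u v l hl h
      rw [dist_eq_norm, ← sq_eq_sq₀ (norm_nonneg _) hl, @norm_sub_sq_real, ← h,
        real_inner_self_eq_norm_sq, real_inner_self_eq_norm_sq]
    intro m n hmn
    fin_cases m <;> fin_cases n <;> first | exact absurd rfl hmn | skip
    all_goals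
      refine hd _ _ _ (by simp; positivity) ?_
      simp [-inner_self_eq_norm_sq_to_K, haa, hbb, hcc, hab, hbc, hca,
        hba, hcb, hac]
      try ring

/-- The chosen realization enters only through its distances, hence through the radii, so the choice
in the definition is harmless. After the common factor 2abcd cancels, the argument of the arctangent
depends only on the reciprocal radii. -/
theorem solidAngle_eq [DecidableEq V] {r : V → ℝ} {τ : Finset V}
    (hτ : τ.card = 4) (hr : ∀ v ∈ τ, 0 < r v) (hQ : 0 < descartesForm (fun v => (r v)⁻¹) τ) {i : V}
    (hi : i ∈ τ) :
    solidAngle r τ i = Real.pi - 2 * Real.arctan (halfCot (fun v => (r v)⁻¹) τ i /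
      Real.sqrt (descartesForm (fun v => (r v)⁻¹) τ)) := by
  have hex := exists_isEuclideanRealization hτ hr hQ
  rw [solidAngle, dif_pos hex]
  have hp := hex.choose_spec
  set p := hex.choose
  obtain ⟨f, hf, rfl, rfl⟩ := exists_fin_four_enum hτ hi
  rw [isEuclideanRealization_image_iff hf] at hp
  obtain ⟨-, hd⟩ := hp
  have h0 : 0 < r (f 0) := hr _ (by simp)
  have h1 : 0 < r (f 1) := hr _ (by simp)
  have h2 : 0 < r (f 2) := hr _ (by simp)
  have h3 : 0 < r (f 3) := hr _ (by simp)
  have hdet := gram_det_eq h0 h1 h2 h3 (descartesForm_image hf fun v => (r v)⁻¹)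
  have hcot := halfCot_image hf (fun v => (r v)⁻¹) (f 0)
  set Q := descartesForm (fun v => (r v)⁻¹) (Finset.univ.image f)
  set E := 2 * r (f 0) * r (f 1) * r (f 2) * r (f 3) * Real.sqrt Q with hE
  have hsq := Real.sqrt_pos.2 hQ
  have hE0 : 0 < E := by positivity
  have hE2 : E ^ 2 = (2 * r (f 0) * r (f 1) * r (f 2) * r (f 3)) ^ 2 * Q := by
    rw [hE, mul_pow, Real.sq_sqrt hQ.le]
  have himg : p '' ((Finset.univ.image f : Finset V) : Set V) =
      {p (f 0), p (f 0) + (p (f 1) - p (f 0)), p (f 0) + (p (f 2) - p (f 0)),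
        p (f 0) + (p (f 3) - p (f 0))} := by
    simp only [add_sub_cancel]
    ext v
    simp [Fin.exists_fin_succ, eq_comm]
  have hself : ∀ m, m ≠ 0 → inner ℝ (p (f m) - p (f 0)) (p (f m) - p (f 0)) =
      (r (f 0) + r (f m)) ^ 2 := fun m hm => by
    rw [real_inner_self_eq_norm_sq, ← dist_eq_norm, hd m 0 hm, add_comm]
  rw [himg, solidAngleAt_tetrahedron (A := r (f 0) + r (f 1)) (B := r (f 0) + r (f 2))
    (C := r (f 0) + r (f 3)) (by positivity) (by positivity) (by positivity) hE0
    (hself 1 (by decide)) (hself 2 (by decide)) (hself 3 (by decide))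
    (inner_eq_of_dist (hd 1 0 (by decide)) (hd 2 0 (by decide)) (hd 1 2 (by decide)))
    (inner_eq_of_dist (hd 2 0 (by decide)) (hd 3 0 (by decide)) (hd 2 3 (by decide)))
    (inner_eq_of_dist (hd 3 0 (by decide)) (hd 1 0 (by decide)) (hd 3 1 (by decide)))
    (hE2.trans hdet.symm) (abs_gram_entry_lt h0 h1 h2) (abs_gram_entry_lt h0 h2 h3)
    (abs_gram_entry_lt h0 h3 h1)]
  congr 3
  rw [hcot, hE]
  field_simp
  ring

end Realization

-- Differentiating the solid angle

section HalfCotDeriv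

variable {E : Type*} [NormedAddCommGroup E] [NormedSpace ℝ E]

theorem hasStrictFDerivAt_pi_sub_two_arctan {h Q : E → ℝ} {h' Q' : E →L[ℝ] ℝ} {r : E}
    (hh : HasStrictFDerivAt h h' r) (hQ : HasStrictFDerivAt Q Q' r) (hpos : 0 < Q r) :
    HasStrictFDerivAt (fun ρ => Real.pi - 2 * Real.arctan (h ρ / Real.sqrt (Q ρ)))
      (-(1 / (Real.sqrt (Q r) * (Q r + h r ^ 2))) • ((2 * Q r) • h' - h r • Q')) r := by
  have hs : 0 < Real.sqrt (Q r) := Real.sqrt_pos.2 hpos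
  have hs2 : Real.sqrt (Q r) ^ 2 = Q r := Real.sq_sqrt hpos.le
  have h1 := (hasStrictDerivAt_inv hs.ne').comp_hasStrictFDerivAt r (hQ.sqrt hpos.ne')
  have h2 := ((hh.mul h1).arctan.const_mul 2).const_sub Real.pi
  refine (h2.congr_fderiv ?_).congr_of_eventuallyEq ?_
  · ext v
    simp only [neg_smul, one_div, neg_apply, smul_apply, add_apply, sub_apply, smul_eq_mul,
      Pi.mul_apply, Function.comp_apply]
    set s := Real.sqrt (Q r)
    clear_value s
    rw [← hs2]
    have : 0 < s ^ 2 + h r ^ 2 := by positivity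
    field_simp
    ring
  · exact Eventually.of_forall fun ρ => by simp [div_eq_mul_inv]

/-- The differential of a solid angle as a function of the reciprocal radii `a, b, c, d`. -/
theorem hasStrictFDerivAt_solidAngle_formula {a b c d : E → ℝ} {a' b' c' d' : E →L[ℝ] ℝ} {r : E}
    (ha : HasStrictFDerivAt a a' r) (hb : HasStrictFDerivAt b b' r)
    (hc : HasStrictFDerivAt c c' r) (hd : HasStrictFDerivAt d d' r)
    (ha0 : 0 < a r) (hb0 : 0 < b r) (hc0 : 0 < c r) (hd0 : 0 < d r)
    (hQ0 : 0 < (a r + b r + c r + d r) ^ 2 - 2 * (a r ^ 2 + b r ^ 2 + c r ^ 2 + d r ^ 2)) :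
    HasStrictFDerivAt (fun ρ => Real.pi - 2 * Real.arctan
      ((2 * (a ρ * b ρ * c ρ * d ρ) / a ρ ^ 3 + ((a ρ + b ρ + c ρ + d ρ) ^ 2 -
        (a ρ ^ 2 + b ρ ^ 2 + c ρ ^ 2 + d ρ ^ 2)) / a ρ - (a ρ + b ρ + c ρ + d ρ)) /
      Real.sqrt ((a ρ + b ρ + c ρ + d ρ) ^ 2 - 2 * (a ρ ^ 2 + b ρ ^ 2 + c ρ ^ 2 + d ρ ^ 2))))
      (-(a r ^ 2 / Real.sqrt ((a r + b r + c r + d r) ^ 2 -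
        2 * (a r ^ 2 + b r ^ 2 + c r ^ 2 + d r ^ 2))) •
        (((a r * (b r + c r + d r) + b r * (a r + c r + d r) - (c r - d r) ^ 2) /
            ((a r * b r + a r * d r + b r * d r) * (a r * b r + a r * c r + b r * c r))) •
            (b' - (b r / a r) • a') +
          ((a r * (b r + c r + d r) + c r * (a r + b r + d r) - (b r - d r) ^ 2) /
            ((a r * c r + a r * d r + c r * d r) * (a r * b r + a r * c r + b r * c r))) •
            (c' - (c r / a r) • a') +
          ((a r * (b r + c r + d r) + d r * (a r + b r + c r) - (b r - c r) ^ 2) /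
            ((a r * c r + a r * d r + c r * d r) * (a r * b r + a r * d r + b r * d r))) •
            (d' - (d r / a r) • a'))) r := by
  have hi := (hasStrictDerivAt_inv ha0.ne').comp_hasStrictFDerivAt r ha
  have hs := ((ha.add hb).add hc).add hd
  have hq := (((ha.pow 2).add (hb.pow 2)).add (hc.pow 2)).add (hd.pow 2)
  have hQ : HasStrictFDerivAt (fun ρ => (a ρ + b ρ + c ρ + d ρ) ^ 2 -
      2 * (a ρ ^ 2 + b ρ ^ 2 + c ρ ^ 2 + d ρ ^ 2))
      ((2 * (b r + c r + d r - a r)) • a' + (2 * (a r + c r + d r - b r)) • b' +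
        (2 * (a r + b r + d r - c r)) • c' + (2 * (a r + b r + c r - d r)) • d') r := by
    refine ((hs.pow 2).sub (hq.const_mul 2)).congr_fderiv ?_
    ext v
    simp
    ring
  have hh : HasStrictFDerivAt (fun ρ => 2 * (a ρ * b ρ * c ρ * d ρ) / a ρ ^ 3 +
      ((a ρ + b ρ + c ρ + d ρ) ^ 2 - (a ρ ^ 2 + b ρ ^ 2 + c ρ ^ 2 + d ρ ^ 2)) / a ρ -
      (a ρ + b ρ + c ρ + d ρ))
      ((-(4 * (b r * c r * d r) / a r ^ 3 +
          2 * (b r * c r + b r * d r + c r * d r) / a r ^ 2 + 1)) • a' +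
        (2 * (c r * d r) / a r ^ 2 + 2 * (c r + d r) / a r + 1) • b' +
        (2 * (b r * d r) / a r ^ 2 + 2 * (b r + d r) / a r + 1) • c' +
        (2 * (b r * c r) / a r ^ 2 + 2 * (b r + c r) / a r + 1) • d') r := by
    refine ((((((((ha.mul hb).mul hc).mul hd).const_mul 2).mul (hi.pow 3)).add
      (((hs.pow 2).sub hq).mul hi)).sub hs).congr_fderiv ?_).congr_of_eventuallyEq ?_
    · ext v
      simp
      field_simp
      ring
    · exact Eventually.of_forall fun ρ => by simp [div_eq_mul_inv]
  refine (hasStrictFDerivAt_pi_sub_two_arctan hh hQ hQ0).congr_fderiv ?_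
  ext v
  simp only [one_div, smul_apply, add_apply, sub_apply, smul_eq_mul]
  generalize a' v = da
  generalize b' v = db
  generalize c' v = dc
  generalize d' v = dd
  clear hh hQ hq hs hi ha hb hc hd
  generalize a r = a at *
  generalize b r = b at *
  generalize c r = c at *
  generalize d r = d at *
  set Q := (a + b + c + d) ^ 2 - 2 * (a ^ 2 + b ^ 2 + c ^ 2 + d ^ 2) with hQ
  set h := 2 * (a * b * c * d) / a ^ 3 + ((a + b + c + d) ^ 2 - (a ^ 2 + b ^ 2 + c ^ 2 + d ^ 2)) / a -
    (a + b + c + d) with hh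
  have hsq : 0 < Real.sqrt Q := Real.sqrt_pos.2 hQ0
  set s := Real.sqrt Q
  clear_value s
  -- The denominator in the derivative of the arctangent factors into the second symmetric functions
  -- of the three faces at the vertex a.
  have hden : Q + h ^ 2 = 4 * ((a * c + a * d + c * d) * (a * b + a * d + b * d) *
      (a * b + a * c + b * c)) / a ^ 4 := by
    rw [hQ, hh]
    field_simp
    ring
  -- Scaling invariance of angles shows in the numerator: it involves only the combinations db -
  -- (b/a) da and their analogues, which vanish in the direction (a, b, c, d).
  have hnum : 2 * Q * (-(4 * (b * c * d) / a ^ 3 + 2 * (b * c + b * d + c * d) / a ^ 2 + 1) * da +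
      (2 * (c * d) / a ^ 2 + 2 * (c + d) / a + 1) * db +
      (2 * (b * d) / a ^ 2 + 2 * (b + d) / a + 1) * dc +
      (2 * (b * c) / a ^ 2 + 2 * (b + c) / a + 1) * dd) -
      h * (2 * (b + c + d - a) * da + 2 * (a + c + d - b) * db + 2 * (a + b + d - c) * dc +
        2 * (a + b + c - d) * dd) =
      4 / a ^ 2 * ((a * c + a * d + c * d) *
        (a * (b + c + d) + b * (a + c + d) - (c - d) ^ 2) * (db - b / a * da) +
      (a * b + a * d + b * d) *
        (a * (b + c + d) + c * (a + b + d) - (b - d) ^ 2) * (dc - c / a * da) +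
      (a * b + a * c + b * c) *
        (a * (b + c + d) + d * (a + b + c) - (b - c) ^ 2) * (dd - d / a * da)) := by
    rw [hQ, hh]
    field_simp
    ring
  rw [hnum, hden]
  clear_value h Q
  generalize a * (b + c + d) + b * (a + c + d) - (c - d) ^ 2 = B₁
  generalize a * (b + c + d) + c * (a + b + d) - (b - d) ^ 2 = B₂
  generalize a * (b + c + d) + d * (a + b + c) - (b - c) ^ 2 = B₃
  have h1 : 0 < a * c + a * d + c * d := by positivity
  have h2 : 0 < a * b + a * d + b * d := by positivity
  have h3 : 0 < a * b + a * c + b * c := by positivity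
  generalize a * c + a * d + c * d = S₁ at *
  generalize a * b + a * d + b * d = S₂ at *
  generalize a * b + a * c + b * c = S₃ at *
  field_simp

end HalfCotDeriv

-- Positivity of the form of a single tetrahedron

/-- A symmetric ternary quadratic form with positive leading minors is positive definite. -/
theorem ternary_form_pos {p q s α β γ u v w : ℝ} (hp : 0 < p) (hM : 0 < p * q - α ^ 2)
    (hdet : 0 < p * q * s + 2 * α * β * γ - p * γ ^ 2 - q * β ^ 2 - s * α ^ 2)
    (h : ¬(u = 0 ∧ v = 0 ∧ w = 0)) :
    0 < p * u ^ 2 + q * v ^ 2 + s * w ^ 2 + 2 * α * (u * v) + 2 * β * (u * w) +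
      2 * γ * (v * w) := by
  -- Successive completion of squares, cleared of denominators.
  have key : p * (p * q - α ^ 2) * (p * u ^ 2 + q * v ^ 2 + s * w ^ 2 + 2 * α * (u * v) +
      2 * β * (u * w) + 2 * γ * (v * w)) =
      (p * q - α ^ 2) * (p * u + α * v + β * w) ^ 2 +
        ((p * q - α ^ 2) * v + (p * γ - α * β) * w) ^ 2 +
        p * (p * q * s + 2 * α * β * γ - p * γ ^ 2 - q * β ^ 2 - s * α ^ 2) * w ^ 2 := by ring
  have hpM := mul_pos hp hM
  refine pos_of_mul_pos_right (a := p * (p * q - α ^ 2)) ?_ hpM.le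
  rw [key]
  by_cases hw : w = 0
  · by_cases hv : v = 0
    · have hu : u ≠ 0 := fun hu => h ⟨hu, hv, hw⟩
      subst hw hv
      have : 0 < (p * q - α ^ 2) * (p * u) ^ 2 := by positivity
      simpa using this
    · subst hw
      have : 0 < ((p * q - α ^ 2) * v) ^ 2 := by positivity
      have h2 : 0 ≤ (p * q - α ^ 2) * (p * u + α * v) ^ 2 := by positivity
      simp only [mul_zero, add_zero, ne_eq, OfNat.ofNat_ne_zero, not_false_eq_true, zero_pow]
      linarith
  · have h1 : 0 < p * (p * q * s + 2 * α * β * γ - p * γ ^ 2 - q * β ^ 2 - s * α ^ 2) * w ^ 2 := by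
      positivity
    have h2 : 0 ≤ (p * q - α ^ 2) * (p * u + α * v + β * w) ^ 2 := by positivity
    have h3 := sq_nonneg ((p * q - α ^ 2) * v + (p * γ - α * β) * w)
    linarith

/-- The edge factors may be negative (for a = b = d = 1 and c = 6 one has Q = 3 but B₁₂ = -9), so no
termwise argument works. Taking differences with f₄ gives a ternary form, and each of its leading
minors is, up to positive factors, a polynomial in a, b, c, d and Q that is visibly positive once Q
> 0. -/
theorem edge_weight_form_pos {a b c d f₁ f₂ f₃ f₄ : ℝ} (ha : 0 < a) (hb : 0 < b) (hc : 0 < c)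
    (hd : 0 < d) (hQ : 0 < (a + b + c + d) ^ 2 - 2 * (a ^ 2 + b ^ 2 + c ^ 2 + d ^ 2))
    {z₁ z₂ z₃ z₄ B₁₂ B₁₃ B₁₄ B₂₃ B₂₄ B₃₄ : ℝ}
    (hz₁ : z₁ = a * (b * c + b * d + c * d)) (hz₂ : z₂ = b * (a * c + a * d + c * d))
    (hz₃ : z₃ = c * (a * b + a * d + b * d)) (hz₄ : z₄ = d * (a * b + a * c + b * c))
    (h₁₂ : B₁₂ = a * (b + c + d) + b * (a + c + d) - (c - d) ^ 2)
    (h₁₃ : B₁₃ = a * (b + c + d) + c * (a + b + d) - (b - d) ^ 2)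
    (h₁₄ : B₁₄ = a * (b + c + d) + d * (a + b + c) - (b - c) ^ 2)
    (h₂₃ : B₂₃ = b * (a + c + d) + c * (a + b + d) - (a - d) ^ 2)
    (h₂₄ : B₂₄ = b * (a + c + d) + d * (a + b + c) - (a - c) ^ 2)
    (h₃₄ : B₃₄ = c * (a + b + d) + d * (a + b + c) - (a - b) ^ 2)
    (hf : ¬(f₁ = f₄ ∧ f₂ = f₄ ∧ f₃ = f₄)) :
    0 < z₁ * z₂ * B₁₂ * (f₁ - f₂) ^ 2 + z₁ * z₃ * B₁₃ * (f₁ - f₃) ^ 2 +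
      z₁ * z₄ * B₁₄ * (f₁ - f₄) ^ 2 + z₂ * z₃ * B₂₃ * (f₂ - f₃) ^ 2 +
      z₂ * z₄ * B₂₄ * (f₂ - f₄) ^ 2 + z₃ * z₄ * B₃₄ * (f₃ - f₄) ^ 2 := by
  have z1 : 0 < z₁ := by rw [hz₁]; positivity
  have z2 : 0 < z₂ := by rw [hz₂]; positivity
  have z3 : 0 < z₃ := by rw [hz₃]; positivity
  have z4 : 0 < z₄ := by rw [hz₄]; positivity
  set Q := (a + b + c + d) ^ 2 - 2 * (a ^ 2 + b ^ 2 + c ^ 2 + d ^ 2) with hQdef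
  have hD : z₂ * B₁₂ + z₃ * B₁₃ + z₄ * B₁₄ =
      Q * (2 * (b * c * d) + (b * c + b * d + c * d) * a) + (b * c + b * d + c * d) * a ^ 3 +
        a ^ 2 * ((b * c + b * d + c * d) * (b + c + d) - b * c * d) +
        a * (b * c * d) * (b + c + d) := by
    rw [hz₂, hz₃, hz₄, h₁₂, h₁₃, h₁₄, hQdef]
    ring
  have hDpos : 0 < z₂ * B₁₂ + z₃ * B₁₃ + z₄ * B₁₄ := by
    have e : (b * c + b * d + c * d) * (b + c + d) - b * c * d =
      b ^ 2 * c + b ^ 2 * d + b * c ^ 2 + b * d ^ 2 + c ^ 2 * d + c * d ^ 2 + 2 * (b * c * d) := by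
      ring
    rw [hD, e]
    positivity
  have hM : (z₂ * B₁₂ + z₃ * B₁₃ + z₄ * B₁₄) * (z₁ * B₁₂ + z₃ * B₂₃ + z₄ * B₂₄) -
      z₁ * z₂ * B₁₂ ^ 2 = Q * ((a * b + a * d + b * d) * (a * b + a * c + b * c)) *
        (2 * (c * d) * Q + 3 * (a * b) * (c + d) ^ 2 + 2 * (a + b) * (c * d) * (c + d) +
          2 * (c * d) * (a - b) ^ 2) := by
    rw [hz₁, hz₂, hz₃, hz₄, h₁₂, h₁₃, h₁₄, h₂₃, h₂₄, hQdef]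
    ring
  have hMpos : 0 < (z₂ * B₁₂ + z₃ * B₁₃ + z₄ * B₁₄) * (z₁ * B₁₂ + z₃ * B₂₃ + z₄ * B₂₄) -
      z₁ * z₂ * B₁₂ ^ 2 := by
    rw [hM]
    positivity
  have hdet : (z₂ * B₁₂ + z₃ * B₁₃ + z₄ * B₁₄) * (z₁ * B₁₂ + z₃ * B₂₃ + z₄ * B₂₄) *
      (z₁ * B₁₃ + z₂ * B₂₃ + z₄ * B₃₄) - 2 * (z₁ * z₂ * z₃) * (B₁₂ * B₁₃ * B₂₃) -
      (z₂ * B₁₂ + z₃ * B₁₃ + z₄ * B₁₄) * (z₂ * z₃ * B₂₃ ^ 2) -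
      (z₁ * B₁₂ + z₃ * B₂₃ + z₄ * B₂₄) * (z₁ * z₃ * B₁₃ ^ 2) -
      (z₁ * B₁₃ + z₂ * B₂₃ + z₄ * B₃₄) * (z₁ * z₂ * B₁₂ ^ 2) =
      6 * Q ^ 2 * z₄ * ((b * c + b * d + c * d) * (a * c + a * d + c * d) *
        (a * b + a * d + b * d) * (a * b + a * c + b * c)) := by
    rw [hz₁, hz₂, hz₃, hz₄, h₁₂, h₁₃, h₁₄, h₂₃, h₂₄, h₃₄, hQdef]
    ring
  have key := ternary_form_pos (p := z₁ * (z₂ * B₁₂ + z₃ * B₁₃ + z₄ * B₁₄))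
    (q := z₂ * (z₁ * B₁₂ + z₃ * B₂₃ + z₄ * B₂₄)) (s := z₃ * (z₁ * B₁₃ + z₂ * B₂₃ + z₄ * B₃₄))
    (α := -(z₁ * z₂ * B₁₂)) (β := -(z₁ * z₃ * B₁₃)) (γ := -(z₂ * z₃ * B₂₃))
    (u := f₁ - f₄) (v := f₂ - f₄) (w := f₃ - f₄) (mul_pos z1 hDpos)
    (by
      refine lt_of_lt_of_eq (mul_pos (mul_pos z1 z2) hMpos) ?_
      ring)
    (by
      have h : 0 < z₁ * z₂ * z₃ * (6 * Q ^ 2 * z₄ * ((b * c + b * d + c * d) *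
        (a * c + a * d + c * d) * (a * b + a * d + b * d) * (a * b + a * c + b * c))) := by
        positivity
      rw [← hdet] at h
      refine lt_of_lt_of_eq h ?_
      ring)
    (by simpa only [sub_eq_zero] using hf)
  refine lt_of_lt_of_eq key ?_
  ring

section EdgeWeight

variable {V : Type*}

/-- The second elementary symmetric function of the reciprocal radii of the face of `τ` opposite
to `v`. -/
def faceForm (x : V → ℝ) (τ : Finset V) (v : V) : ℝ :=
  ((∑ u ∈ τ, x u - x v) ^ 2 - (∑ u ∈ τ, x u ^ 2 - x v ^ 2)) / 2

/-- The edge factor of the derivative of the solid angles of `τ`. -/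
def edgeForm (x : V → ℝ) (τ : Finset V) (i j : V) : ℝ :=
  x i * (∑ u ∈ τ, x u - x i) + x j * (∑ u ∈ τ, x u - x j) -
    (2 * (∑ u ∈ τ, x u ^ 2 - x i ^ 2 - x j ^ 2) - (∑ u ∈ τ, x u - x i - x j) ^ 2)

/-- The symmetric weights `r_i r_j ∂α_i / ∂r_j` of the edges of `τ` in terms of the reciprocal
radii. -/
def edgeWeight (x : V → ℝ) (τ : Finset V) (i j : V) : ℝ :=
  x i * faceForm x τ i * (x j * faceForm x τ j) * edgeForm x τ i j /
    (Real.sqrt (descartesForm x τ) * ∏ v ∈ τ, faceForm x τ v)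

theorem edgeWeight_comm (x : V → ℝ) (τ : Finset V) (i j : V) :
    edgeWeight x τ i j = edgeWeight x τ j i := by
  unfold edgeWeight edgeForm
  ring

/-- The quadratic form of the edge weights of a tetrahedron is positive on nonconstant
functions. -/
theorem sum_edgeWeight_pos [DecidableEq V] {x : V → ℝ} {τ : Finset V} (hτ : τ.card = 4)
    (hx : ∀ v ∈ τ, 0 < x v) (hQ : 0 < descartesForm x τ) {g : V → ℝ}
    (hg : ∃ i ∈ τ, ∃ j ∈ τ, g i ≠ g j) :
    0 < ∑ i ∈ τ, ∑ j ∈ τ, edgeWeight x τ i j * (g i - g j) ^ 2 := by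
  obtain ⟨k, hk⟩ := Finset.card_pos.1 (by omega : 0 < τ.card)
  obtain ⟨f, hf, -, rfl⟩ := exists_fin_four_enum hτ hk
  have hne : ¬(g (f 0) = g (f 3) ∧ g (f 1) = g (f 3) ∧ g (f 2) = g (f 3)) := by
    rintro ⟨h0, h1, h2⟩
    obtain ⟨i, hi, j, hj, hij⟩ := hg
    have hall : ∀ v ∈ Finset.univ.image f, g v = g (f 3) := by
      intro v hv
      obtain ⟨m, -, rfl⟩ := Finset.mem_image.1 hv
      fin_cases m
      exacts [h0, h1, h2, rfl]
    exact hij ((hall i hi).trans (hall j hj).symm)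
  have p0 : 0 < x (f 0) := hx _ (by simp)
  have p1 : 0 < x (f 1) := hx _ (by simp)
  have p2 : 0 < x (f 2) := hx _ (by simp)
  have p3 : 0 < x (f 3) := hx _ (by simp)
  have hQ' := hQ
  rw [descartesForm_image hf] at hQ'
  have key := edge_weight_form_pos p0 p1 p2 p3 hQ' rfl rfl rfl rfl rfl rfl rfl rfl rfl rfl hne
  have hs := Real.sqrt_pos.2 hQ
  simp only [edgeWeight, Finset.sum_image hf.injOn, Finset.prod_image hf.injOn, Fin.sum_univ_four,
    Fin.prod_univ_four, sub_self, ne_eq, OfNat.ofNat_ne_zero, not_false_eq_true, zero_pow, mul_zero,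
    zero_add, add_zero]
  have e0 : faceForm x (Finset.univ.image f) (f 0) =
      x (f 1) * x (f 2) + x (f 1) * x (f 3) + x (f 2) * x (f 3) := by
    simp only [faceForm, Finset.sum_image hf.injOn, Fin.sum_univ_four]; ring
  have e1 : faceForm x (Finset.univ.image f) (f 1) =
      x (f 0) * x (f 2) + x (f 0) * x (f 3) + x (f 2) * x (f 3) := by
    simp only [faceForm, Finset.sum_image hf.injOn, Fin.sum_univ_four]; ring
  have e2 : faceForm x (Finset.univ.image f) (f 2) =
      x (f 0) * x (f 1) + x (f 0) * x (f 3) + x (f 1) * x (f 3) := by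
    simp only [faceForm, Finset.sum_image hf.injOn, Fin.sum_univ_four]; ring
  have e3 : faceForm x (Finset.univ.image f) (f 3) =
      x (f 0) * x (f 1) + x (f 0) * x (f 2) + x (f 1) * x (f 2) := by
    simp only [faceForm, Finset.sum_image hf.injOn, Fin.sum_univ_four]; ring
  have hden : 0 < Real.sqrt (descartesForm x (Finset.univ.image f)) *
      (faceForm x (Finset.univ.image f) (f 0) * faceForm x (Finset.univ.image f) (f 1) *
        faceForm x (Finset.univ.image f) (f 2) * faceForm x (Finset.univ.image f) (f 3)) := by
    rw [e0, e1, e2, e3]; positivity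
  -- The factor 2 appears because the double sum meets every edge in both orders.
  refine lt_of_lt_of_eq (mul_pos two_pos (div_pos key hden)) ?_
  rw [← e0, ← e1, ← e2, ← e3]
  simp only [edgeForm, Finset.sum_image hf.injOn, Fin.sum_univ_four]
  generalize Real.sqrt (descartesForm x (Finset.univ.image f)) *
      (faceForm x (Finset.univ.image f) (f 0) * faceForm x (Finset.univ.image f) (f 1) *
        faceForm x (Finset.univ.image f) (f 2) * faceForm x (Finset.univ.image f) (f 3)) = W
  ring

/-- The differential of the solid angle of `τ` at `i` as a function of the radii. -/
def solidAngleDeriv (x : V → ℝ) (τ : Finset V) (i : V) : EuclideanSpace ℝ V →L[ℝ] ℝ :=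
  x i • ∑ j ∈ τ, edgeWeight x τ i j •
    (x j • (EuclideanSpace.proj j : EuclideanSpace ℝ V →L[ℝ] ℝ) - x i • EuclideanSpace.proj i)

theorem solidAngleDeriv_apply (x : V → ℝ) (τ : Finset V) (i : V) (v : EuclideanSpace ℝ V) :
    solidAngleDeriv x τ i v = x i * ∑ j ∈ τ, edgeWeight x τ i j * (x j * v j - x i * v i) := by
  simp [solidAngleDeriv]

variable [Fintype V]

theorem hasStrictFDerivAt_inv_proj {r : EuclideanSpace ℝ V} {v : V} (hv : r v ≠ 0) :
    HasStrictFDerivAt (fun ρ : EuclideanSpace ℝ V => (ρ v)⁻¹)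
      (-((r v)⁻¹ ^ 2) • (EuclideanSpace.proj v : EuclideanSpace ℝ V →L[ℝ] ℝ)) r := by
  have h := (EuclideanSpace.proj v : EuclideanSpace ℝ V →L[ℝ] ℝ).hasStrictFDerivAt (x := r)
  have := (hasStrictDerivAt_inv hv).comp_hasStrictFDerivAt r h
  rw [← inv_pow] at this
  exact this

theorem continuousAt_descartesForm {r : EuclideanSpace ℝ V} {τ : Finset V}
    (hr : ∀ v ∈ τ, 0 < r v) :
    ContinuousAt (fun ρ : EuclideanSpace ℝ V => descartesForm (fun v => (ρ v)⁻¹) τ) r := by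
  have h : ∀ v ∈ τ, ContinuousAt (fun ρ : EuclideanSpace ℝ V => (ρ v)⁻¹) r := fun v hv =>
    (hasStrictFDerivAt_inv_proj (hr v hv).ne').continuousAt
  unfold descartesForm
  exact ((tendsto_finsetSum _ h).pow 2).sub
    ((tendsto_finsetSum _ fun v hv => (h v hv).pow 2).const_mul 2)

theorem eventually_tetrahedron_nondegenerate {r : EuclideanSpace ℝ V} {τ : Finset V}
    (hr : ∀ v ∈ τ, 0 < r v) (hQ : 0 < descartesForm (fun v => (r v)⁻¹) τ) :
    ∀ᶠ ρ : EuclideanSpace ℝ V in 𝓝 r, (∀ v ∈ τ, 0 < ρ v) ∧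
      0 < descartesForm (fun v => (ρ v)⁻¹) τ := by
  refine Eventually.and ?_ ((continuousAt_descartesForm hr).eventually (lt_mem_nhds hQ))
  refine (Filter.eventually_all_finset τ).2 fun v hv => ?_
  exact ((EuclideanSpace.proj v : EuclideanSpace ℝ V →L[ℝ] ℝ).continuous.continuousAt).eventually
    (lt_mem_nhds (hr v hv))

/-- Nondegeneracy is an open condition, so the arctangent formula holds near r and can be
differentiated there. Strict differentiability is kept because it later yields a Lipschitz bound for
the flow. -/
theorem hasStrictFDerivAt_solidAngle {r : EuclideanSpace ℝ V} {τ : Finset V} (hτ : τ.card = 4)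
    (hr : ∀ v ∈ τ, 0 < r v) (hQ : 0 < descartesForm (fun v => (r v)⁻¹) τ) {i : V} (hi : i ∈ τ) :
    HasStrictFDerivAt (fun ρ : EuclideanSpace ℝ V => solidAngle ρ τ i)
      (solidAngleDeriv (fun v => (r v)⁻¹) τ i) r := by
  classical
  have hev : (fun ρ : EuclideanSpace ℝ V => Real.pi - 2 * Real.arctan
      (halfCot (fun v => (ρ v)⁻¹) τ i / Real.sqrt (descartesForm (fun v => (ρ v)⁻¹) τ))) =ᶠ[𝓝 r]
      fun ρ : EuclideanSpace ℝ V => solidAngle ρ τ i := by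
    filter_upwards [eventually_tetrahedron_nondegenerate hr hQ] with ρ hρ
    exact (solidAngle_eq hτ hρ.1 hρ.2 hi).symm
  refine HasStrictFDerivAt.congr_of_eventuallyEq ?_ hev
  obtain ⟨f, hf, rfl, rfl⟩ := exists_fin_four_enum hτ hi
  have p : ∀ m, 0 < r (f m) := fun m => hr _ (by simp)
  have hd := fun m => hasStrictFDerivAt_inv_proj (r := r) (p m).ne'
  have hQeq := descartesForm_image hf fun v => (r v)⁻¹
  have hQ' := hQ
  rw [hQeq] at hQ'
  have key := hasStrictFDerivAt_solidAngle_formula (hd 0) (hd 1) (hd 2) (hd 3) (inv_pos.2 (p 0))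
    (inv_pos.2 (p 1)) (inv_pos.2 (p 2)) (inv_pos.2 (p 3)) hQ'
  simp only [descartesForm_image hf, halfCot_image hf]
  refine key.congr_fderiv ?_
  rw [← hQeq]
  have hs := Real.sqrt_pos.2 hQ
  have q : ∀ m, 0 < (r (f m))⁻¹ := fun m => inv_pos.2 (p m)
  ext v
  rw [solidAngleDeriv_apply]
  simp only [edgeWeight, Finset.sum_image hf.injOn, Finset.prod_image hf.injOn, Fin.sum_univ_four,
    Fin.prod_univ_four, sub_self, mul_zero, zero_add, smul_apply, add_apply, sub_apply, smul_eq_mul,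
    PiLp.proj_apply, faceForm, edgeForm]
  generalize Real.sqrt (descartesForm (fun v => (r v)⁻¹) (Finset.univ.image f)) = s at *
  have q0 := q 0
  have q1 := q 1
  have q2 := q 2
  have q3 := q 3
  clear key hd hev hQeq hQ' hQ q p
  generalize (r (f 0))⁻¹ = a at *
  generalize (r (f 1))⁻¹ = b at *
  generalize (r (f 2))⁻¹ = c at *
  generalize (r (f 3))⁻¹ = d at *
  rw [show ((a + b + c + d - a) ^ 2 - (a ^ 2 + b ^ 2 + c ^ 2 + d ^ 2 - a ^ 2)) / 2 =
      b * c + b * d + c * d by ring,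
    show ((a + b + c + d - b) ^ 2 - (a ^ 2 + b ^ 2 + c ^ 2 + d ^ 2 - b ^ 2)) / 2 =
      a * c + a * d + c * d by ring,
    show ((a + b + c + d - c) ^ 2 - (a ^ 2 + b ^ 2 + c ^ 2 + d ^ 2 - c ^ 2)) / 2 =
      a * b + a * d + b * d by ring,
    show ((a + b + c + d - d) ^ 2 - (a ^ 2 + b ^ 2 + c ^ 2 + d ^ 2 - d ^ 2)) / 2 =
      a * b + a * c + b * c by ring,
    show a * (a + b + c + d - a) + b * (a + b + c + d - b) -
      (2 * (a ^ 2 + b ^ 2 + c ^ 2 + d ^ 2 - a ^ 2 - b ^ 2) - (a + b + c + d - a - b) ^ 2) =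
      a * (b + c + d) + b * (a + c + d) - (c - d) ^ 2 by ring,
    show a * (a + b + c + d - a) + c * (a + b + c + d - c) -
      (2 * (a ^ 2 + b ^ 2 + c ^ 2 + d ^ 2 - a ^ 2 - c ^ 2) - (a + b + c + d - a - c) ^ 2) =
      a * (b + c + d) + c * (a + b + d) - (b - d) ^ 2 by ring,
    show a * (a + b + c + d - a) + d * (a + b + c + d - d) -
      (2 * (a ^ 2 + b ^ 2 + c ^ 2 + d ^ 2 - a ^ 2 - d ^ 2) - (a + b + c + d - a - d) ^ 2) =
      a * (b + c + d) + d * (a + b + c) - (b - c) ^ 2 by ring]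
  have h0 : 0 < b * c + b * d + c * d := by positivity
  have h1 : 0 < a * c + a * d + c * d := by positivity
  have h2 : 0 < a * b + a * d + b * d := by positivity
  have h3 : 0 < a * b + a * c + b * c := by positivity
  generalize a * (b + c + d) + b * (a + c + d) - (c - d) ^ 2 = B₁
  generalize a * (b + c + d) + c * (a + b + d) - (b - d) ^ 2 = B₂
  generalize a * (b + c + d) + d * (a + b + c) - (b - c) ^ 2 = B₃
  generalize b * c + b * d + c * d = S₀ at *
  generalize a * c + a * d + c * d = S₁ at *
  generalize a * b + a * d + b * d = S₂ at *
  generalize a * b + a * c + b * c = S₃ at *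
  field_simp
  ring

end EdgeWeight

-- Curvature and Laplacian of the whole triangulation

namespace Triangulation

variable {V M : Type*} [Fintype V] [TopologicalSpace M]

theorem mem_tets {T : Triangulation V M} {τ : Finset V} :
    τ ∈ T.tets ↔ τ ∈ T.complex.faces ∧ τ.card = 4 := by
  classical
  simp [tets]

theorem face_of_subset {T : Triangulation V M} {s t : Finset V} (ht : t ∈ T.complex.faces)
    (hst : s ⊆ t) (hs : s.Nonempty) : s ∈ T.complex.faces :=
  (T.complex.isRelLowerSet_faces ht).2 hst hs

theorem exists_tet_of_face (T : Triangulation V M) {s : Finset V} (hs : s ∈ T.complex.faces) :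
    ∃ τ ∈ T.tets, s ⊆ τ := by
  obtain ⟨τ, hτ, hsub, hc⟩ := T.pure s hs
  exact ⟨τ, mem_tets.2 ⟨hτ, hc⟩, hsub⟩

/-- On a connected triangulated space, a function on the vertices that is constant on every
tetrahedron is constant. -/
theorem eq_of_constant_on_tets [ConnectedSpace M] (T : Triangulation V M) {g : V → ℝ}
    (hg : ∀ τ ∈ T.tets, ∀ i ∈ τ, ∀ j ∈ τ, g i = g j) (i j : V) : g i = g j := by
  classical
  have : ConnectedSpace (realization T.complex) :=
    T.homeo.symm.surjective.connectedSpace T.homeo.symm.continuous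
  have hpre : IsPreconnected (realization T.complex) :=
    isPreconnected_iff_preconnectedSpace.2 inferInstance
  have hsingle : ∀ v : V, Pi.single v (1 : ℝ) ∈ realization T.complex := by
    intro v
    refine ⟨fun u => ?_, ?_, {v}, T.complex.singleton_mem v, fun u => ?_⟩
    · by_cases h : u = v
      · subst h; simp
      · simp [h]
    · simp
    · by_cases h : u = v
      · subst h; simp
      · simp [h]
  -- The piecewise linear extension of g is constant on every simplex, hence takes only finitely
  -- many values on the connected realization.
  have hcont : Continuous fun x : V → ℝ => ∑ v, x v * g v := by fun_prop
  have hmaps : Set.MapsTo (fun x : V → ℝ => ∑ v, x v * g v) (realization T.complex)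
      (Set.range g) := by
    rintro x ⟨-, hsum, s, hs, hsupp⟩
    obtain ⟨τ, hτ, hsub⟩ := T.exists_tet_of_face hs
    obtain ⟨u, hu⟩ := Finset.card_pos.1 (by rw [(mem_tets.1 hτ).2]; norm_num : 0 < τ.card)
    refine ⟨u, ?_⟩
    have : ∀ v, x v * g v = x v * g u := by
      intro v
      by_cases h : x v = 0
      · simp [h]
      · rw [hg τ hτ v (hsub ((hsupp v).2 h)) u hu]
    simp only [this]
    rw [← Finset.sum_mul, hsum, one_mul]
  have := hpre.constant_of_mapsTo (Set.finite_range g).isDiscrete hcont.continuousOn hmaps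
    (hsingle i) (hsingle j)
  simpa [Pi.single_apply, ite_mul] using this

/-- Replaces existence of tetrahedra by strict inequalities, which makes openness evident. -/
theorem mem_metrics_iff {T : Triangulation V M} {r : EuclideanSpace ℝ V} :
    r ∈ T.metrics ↔ (∀ i, 0 < r i) ∧ ∀ τ ∈ T.tets, 0 < descartesForm (fun v => (r v)⁻¹) τ := by
  classical
  refine and_congr_right fun hr => forall₂_congr fun τ hτ => ?_
  exact ⟨fun ⟨p, hp⟩ => hp.descartesForm_pos (mem_tets.1 hτ).2 fun v _ => hr v,
    fun h => exists_isEuclideanRealization (mem_tets.1 hτ).2 (fun v _ => hr v) h⟩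

theorem metrics_mem_nhds {T : Triangulation V M} {r : EuclideanSpace ℝ V} (hr : r ∈ T.metrics) :
    T.metrics ∈ 𝓝 r := by
  rw [mem_metrics_iff] at hr
  have h1 : ∀ᶠ ρ : EuclideanSpace ℝ V in 𝓝 r, ∀ i, 0 < ρ i :=
    Filter.eventually_all.2 fun i =>
      ((EuclideanSpace.proj i : EuclideanSpace ℝ V →L[ℝ] ℝ).continuous.continuousAt).eventually
        (lt_mem_nhds (hr.1 i))
  have h2 : ∀ᶠ ρ : EuclideanSpace ℝ V in 𝓝 r, ∀ τ ∈ T.tets,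
      0 < descartesForm (fun v => (ρ v)⁻¹) τ :=
    (Filter.eventually_all_finset _).2 fun τ hτ =>
      (eventually_tetrahedron_nondegenerate (fun v _ => hr.1 v) (hr.2 τ hτ)).mono fun _ h => h.2
  filter_upwards [h1, h2] with ρ a b
  exact mem_metrics_iff.2 ⟨a, b⟩

open Classical in
/-- The sum of the edge weights of the tetrahedra that contain the edge `ij`. -/
def totalWeight (T : Triangulation V M) (r : EuclideanSpace ℝ V) (i j : V) : ℝ :=
  ∑ τ ∈ T.tets, if i ∈ τ ∧ j ∈ τ then edgeWeight (fun v => (r v)⁻¹) τ i j else 0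

theorem totalWeight_comm (T : Triangulation V M) (r : EuclideanSpace ℝ V) (i j : V) :
    T.totalWeight r i j = T.totalWeight r j i := by
  classical
  refine Finset.sum_congr rfl fun τ _ => ?_
  rw [edgeWeight_comm]
  simp only [and_comm]

/-- Allows the sum over neighbours in the Laplacian to be extended to all vertices. -/
theorem totalWeight_eq_zero {T : Triangulation V M} {r : EuclideanSpace ℝ V} {i j : V}
    (hij : i ≠ j) (h : j ∉ T.neighbors i) : T.totalWeight r i j = 0 := by
  classical
  refine Finset.sum_eq_zero fun τ hτ => if_neg fun ⟨hi, hj⟩ => h ?_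
  have : ({i, j} : Finset V) ∈ T.complex.faces :=
    face_of_subset (mem_tets.1 hτ).1 (by
      intro v hv
      rcases Finset.mem_insert.1 hv with rfl | hv
      · exact hi
      · rwa [Finset.mem_singleton.1 hv]) ⟨i, by simp⟩
  simp only [neighbors, Finset.mem_filter, Finset.mem_univ, true_and]
  refine ⟨hij.symm, ?_⟩
  convert this

/-- The sum splits into the forms of the tetrahedra, each nonnegative. If none were positive, g
would be constant on every tetrahedron, hence constant by connectedness. -/
theorem sum_totalWeight_pos [ConnectedSpace M] {T : Triangulation V M} {r : EuclideanSpace ℝ V}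
    (hr : r ∈ T.metrics) {g : V → ℝ} (hg : ∃ i j, g i ≠ g j) :
    0 < ∑ i, ∑ j, T.totalWeight r i j * (g i - g j) ^ 2 := by
  classical
  rw [mem_metrics_iff] at hr
  have hswap : ∑ i, ∑ j, T.totalWeight r i j * (g i - g j) ^ 2 =
      ∑ τ ∈ T.tets, ∑ i ∈ τ, ∑ j ∈ τ,
        edgeWeight (fun v => (r v)⁻¹) τ i j * (g i - g j) ^ 2 := by
    have : ∀ τ ∈ T.tets, ∑ i ∈ τ, ∑ j ∈ τ,
        edgeWeight (fun v => (r v)⁻¹) τ i j * (g i - g j) ^ 2 =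
        ∑ i, ∑ j, (if i ∈ τ ∧ j ∈ τ then edgeWeight (fun v => (r v)⁻¹) τ i j else 0) *
          (g i - g j) ^ 2 := by
      intro τ _
      rw [← Finset.sum_subset (Finset.subset_univ τ)]
      · refine Finset.sum_congr rfl fun i hi => ?_
        rw [← Finset.sum_subset (Finset.subset_univ τ)]
        · refine Finset.sum_congr rfl fun j hj => ?_
          rw [if_pos ⟨hi, hj⟩]
        · intro j _ hj
          rw [if_neg fun h => hj h.2, zero_mul]
      · intro i _ hi
        refine Finset.sum_eq_zero fun j _ => ?_
        rw [if_neg fun h => hi h.1, zero_mul]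
    symm
    rw [Finset.sum_congr rfl this, Finset.sum_comm]
    refine Finset.sum_congr rfl fun i _ => ?_
    rw [Finset.sum_comm]
    refine Finset.sum_congr rfl fun j _ => ?_
    rw [totalWeight, Finset.sum_mul]
  rw [hswap]
  have hx : ∀ τ ∈ T.tets, ∀ v ∈ τ, 0 < (r v)⁻¹ := fun τ _ v _ => inv_pos.2 (hr.1 v)
  refine Finset.sum_pos' (fun τ hτ => ?_) ?_
  · by_cases h : ∃ i ∈ τ, ∃ j ∈ τ, g i ≠ g j
    · exact (sum_edgeWeight_pos (mem_tets.1 hτ).2 (hx τ hτ) (hr.2 τ hτ) h).le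
    · push Not at h
      refine Finset.sum_nonneg fun i hi => Finset.sum_nonneg fun j hj => ?_
      rw [h i hi j hj]
      simp
  · by_contra! hcon
    obtain ⟨i, j, hij⟩ := hg
    refine hij (T.eq_of_constant_on_tets (fun τ hτ i hi j hj => ?_) i j)
    by_contra hne
    exact absurd (sum_edgeWeight_pos (mem_tets.1 hτ).2 (hx τ hτ) (hr.2 τ hτ)
      ⟨i, hi, j, hj, hne⟩) (not_lt.2 (hcon τ hτ))

/-- The differential of the scalar curvature. -/
def scalarCurvDeriv (T : Triangulation V M) (r : EuclideanSpace ℝ V) (i : V) :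
    EuclideanSpace ℝ V →L[ℝ] ℝ :=
  (r i)⁻¹ • ∑ j, T.totalWeight r i j •
    ((r i)⁻¹ • (EuclideanSpace.proj i : EuclideanSpace ℝ V →L[ℝ] ℝ) -
      (r j)⁻¹ • EuclideanSpace.proj j)

theorem scalarCurvDeriv_apply (T : Triangulation V M) (r : EuclideanSpace ℝ V) (i : V)
    (v : EuclideanSpace ℝ V) : T.scalarCurvDeriv r i v =
      (r i)⁻¹ * ∑ j, T.totalWeight r i j * ((r i)⁻¹ * v i - (r j)⁻¹ * v j) := by
  simp [scalarCurvDeriv]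

theorem hasStrictFDerivAt_scalarCurv {T : Triangulation V M} {r : EuclideanSpace ℝ V}
    (hr : r ∈ T.metrics) (i : V) :
    HasStrictFDerivAt (fun ρ => T.scalarCurv ρ i) (T.scalarCurvDeriv r i) r := by
  classical
  rw [mem_metrics_iff] at hr
  have h : HasStrictFDerivAt
      (fun ρ : EuclideanSpace ℝ V => ∑ τ ∈ T.tets with i ∈ τ, solidAngle ρ τ i)
      (∑ τ ∈ T.tets with i ∈ τ, solidAngleDeriv (fun v => (r v)⁻¹) τ i) r := by
    refine HasStrictFDerivAt.fun_sum fun τ hτ => ?_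
    rw [Finset.mem_filter] at hτ
    exact hasStrictFDerivAt_solidAngle (mem_tets.1 hτ.1).2 (fun v _ => hr.1 v) (hr.2 τ hτ.1) hτ.2
  have h2 := h.const_sub (4 * Real.pi)
  have e : (fun ρ => T.scalarCurv ρ i) = fun ρ : EuclideanSpace ℝ V =>
      4 * Real.pi - ∑ τ ∈ T.tets with i ∈ τ, solidAngle ρ τ i := by
    funext ρ
    unfold scalarCurv
    congr!
  rw [e]
  refine h2.congr_fderiv ?_
  ext v
  rw [scalarCurvDeriv_apply]
  simp only [neg_apply, FunLike.coe_sum, Finset.sum_apply, solidAngleDeriv_apply, totalWeight,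
    Finset.sum_mul]
  rw [Finset.sum_filter, Finset.sum_comm, Finset.mul_sum, ← Finset.sum_neg_distrib]
  refine Finset.sum_congr rfl fun τ _ => ?_
  split_ifs with hi
  · rw [← mul_neg, ← Finset.sum_neg_distrib]
    congr 1
    rw [← Finset.sum_subset (Finset.subset_univ τ)]
    · refine Finset.sum_congr rfl fun j hj => ?_
      rw [if_pos ⟨hi, hj⟩]
      ring
    · intro j _ hj
      rw [if_neg fun h => hj h.2, zero_mul]
  · symm
    rw [neg_zero]
    refine mul_eq_zero_of_right _ (Finset.sum_eq_zero fun j _ => ?_)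
    rw [if_neg fun h => hi h.1, zero_mul]

/-- Only the off-diagonal entries of the Jacobian matter for the Laplacian; in direction j a single
summand of the differential survives. -/
theorem partialCurv_eq {T : Triangulation V M} {r : EuclideanSpace ℝ V}
    (hr : r ∈ T.metrics) {i j : V} (hij : i ≠ j) :
    T.partialCurv r i j = -((r i)⁻¹ * T.totalWeight r i j * (r j)⁻¹) := by
  classical
  have h := (hasStrictFDerivAt_scalarCurv hr i).hasFDerivAt.hasLineDerivAt
    (EuclideanSpace.single j (1 : ℝ))
  have e : T.partialCurv r i j =
      lineDeriv ℝ (fun ρ : EuclideanSpace ℝ V => T.scalarCurv ρ i) r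
        (EuclideanSpace.single j (1 : ℝ)) := by
    unfold partialCurv
    congr!
  rw [e, h.lineDeriv, scalarCurvDeriv_apply, Finset.sum_eq_single j]
  · simp [hij]
    ring
  · intro k _ hk
    simp [hij, hk]
  · simp

/-- The weighted `α`-Laplacian is the graph Laplacian of the total weights. -/
theorem alphaLaplacian_apply {T : Triangulation V M} {r : EuclideanSpace ℝ V}
    (hr : r ∈ T.metrics) (α : ℝ) (g : V → ℝ) (i : V) :
    r i ^ (α + 1) * T.alphaLaplacian α r g i = ∑ j, T.totalWeight r i j * (g j - g i) := by
  have hpos := (mem_metrics_iff.1 hr).1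
  have hi := hpos i
  have e : T.alphaLaplacian α r g i =
      1 / r i ^ α * ∑ j ∈ T.neighbors i, (-(T.partialCurv r i j) * r j) * (g j - g i) := rfl
  have hs : ∑ j ∈ T.neighbors i, (-(T.partialCurv r i j) * r j) * (g j - g i) =
      (r i)⁻¹ * ∑ j, T.totalWeight r i j * (g j - g i) := by
    rw [← Finset.sum_subset (Finset.subset_univ (T.neighbors i)), Finset.mul_sum]
    · refine Finset.sum_congr rfl fun j hj => ?_
      have hij : i ≠ j := by
        simp only [neighbors, Finset.mem_filter] at hj
        exact hj.2.1.symm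
      have hj0 := hpos j
      rw [partialCurv_eq hr hij]
      field_simp
    · intro j _ hj
      by_cases h : i = j
      · subst h; simp
      · rw [totalWeight_eq_zero h hj, zero_mul]
  have hp : 0 < r i ^ α := Real.rpow_pos_of_pos hi α
  rw [e, hs, Real.rpow_add hi, Real.rpow_one]
  field_simp

end Triangulation

-- Spectral gap of a weighted graph Laplacian with signed weights

section WeightedLaplacian

variable {V : Type*} [Fintype V]

/-- Summation by parts: exchange i and j, use the symmetry of W, and add the two expressions. -/
theorem two_mul_sum_weight_mul_sub {W : V → V → ℝ} (hW : ∀ i j, W i j = W j i) (f g : V → ℝ) :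
    2 * ∑ i, f i * ∑ j, W i j * (g i - g j) =
      ∑ i, ∑ j, W i j * ((f i - f j) * (g i - g j)) := by
  have h1 : ∑ i, f i * ∑ j, W i j * (g i - g j) = ∑ i, ∑ j, W i j * (f i * (g i - g j)) := by
    refine Finset.sum_congr rfl fun i _ => ?_
    rw [Finset.mul_sum]
    exact Finset.sum_congr rfl fun j _ => by ring
  have h2 : ∑ i, f i * ∑ j, W i j * (g i - g j) = ∑ i, ∑ j, W i j * (-f j * (g i - g j)) := by
    rw [h1, Finset.sum_comm]
    refine Finset.sum_congr rfl fun i _ => Finset.sum_congr rfl fun j _ => ?_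
    rw [hW]
    ring
  rw [two_mul]
  nth_rw 1 [h1]
  rw [h2, ← Finset.sum_add_distrib]
  refine Finset.sum_congr rfl fun i _ => ?_
  rw [← Finset.sum_add_distrib]
  exact Finset.sum_congr rfl fun j _ => by ring

theorem sum_weight_mul_sub_eq_zero {W : V → V → ℝ} (hW : ∀ i j, W i j = W j i) (g : V → ℝ) :
    ∑ i, ∑ j, W i j * (g i - g j) = 0 := by
  have := two_mul_sum_weight_mul_sub hW (fun _ => 1) g
  simpa using this

variable {w : V → ℝ} {W : V → V → ℝ}

theorem isCompact_weighted_sphere (hw : ∀ i, 0 < w i) :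
    IsCompact {f : V → ℝ | ∑ i, w i * f i ^ 2 = 1 ∧ ∑ i, w i * f i = 0} := by
  have hK : IsCompact (Set.univ.pi fun i => Set.Icc (-Real.sqrt (1 / w i)) (Real.sqrt (1 / w i))) :=
    isCompact_univ_pi fun i => isCompact_Icc
  refine hK.of_isClosed_subset ?_ ?_
  · exact (isClosed_eq (by fun_prop) continuous_const).inter
      (isClosed_eq (by fun_prop) continuous_const)
  · rintro f ⟨h1, -⟩ i -
    refine abs_le.1 (Real.abs_le_sqrt ?_)
    rw [le_div_iff₀ (hw i), mul_comm, ← h1]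
    exact Finset.single_le_sum (f := fun i => w i * f i ^ 2)
      (fun j _ => mul_nonneg (hw j).le (sq_nonneg _)) (Finset.mem_univ i)

theorem weighted_sphere_nonempty [Nontrivial V] (hw : ∀ i, 0 < w i) :
    {f : V → ℝ | ∑ i, w i * f i ^ 2 = 1 ∧ ∑ i, w i * f i = 0}.Nonempty := by
  classical
  obtain ⟨i, j, hij⟩ := exists_pair_ne V
  set g : V → ℝ := fun v => (w v)⁻¹ * ((Pi.single i 1 : V → ℝ) v - (Pi.single j 1 : V → ℝ) v) with hg
  have h0 : ∑ v, w v * g v = 0 := by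
    have : ∀ v, w v * g v = (Pi.single i 1 : V → ℝ) v - (Pi.single j 1 : V → ℝ) v := fun v => by
      rw [hg, ← mul_assoc, mul_inv_cancel₀ (hw v).ne', one_mul]
    simp [this]
  have hpos : 0 < ∑ v, w v * g v ^ 2 := by
    refine Finset.sum_pos' (fun v _ => mul_nonneg (hw v).le (sq_nonneg _)) ⟨i, Finset.mem_univ i, ?_⟩
    have hgi : g i = (w i)⁻¹ := by simp [hg, hij]
    have := hw i
    rw [hgi]
    positivity
  set s := ∑ v, w v * g v ^ 2
  have hs := Real.sqrt_pos.2 hpos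
  refine ⟨fun v => (Real.sqrt s)⁻¹ * g v, ?_, ?_⟩
  · have : ∀ v, w v * ((Real.sqrt s)⁻¹ * g v) ^ 2 = s⁻¹ * (w v * g v ^ 2) := fun v => by
      rw [mul_pow, inv_pow, Real.sq_sqrt hpos.le]
      ring
    simp only [this]
    rw [← Finset.mul_sum]
    exact inv_mul_cancel₀ hpos.ne'
  · have : ∀ v, w v * ((Real.sqrt s)⁻¹ * g v) = (Real.sqrt s)⁻¹ * (w v * g v) := fun v => by ring
    simp only [this]
    rw [← Finset.mul_sum, h0, mul_zero]

/-- The smallest positive eigenvalue of a weighted graph Laplacian whose quadratic form is positive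
on nonconstant functions, with its variational characterization. -/
theorem exists_isLeast_pos_eigenvalue [Nontrivial V] (hw : ∀ i, 0 < w i)
    (hW : ∀ i j, W i j = W j i)
    (hpos : ∀ g : V → ℝ, (∃ i j, g i ≠ g j) → 0 < ∑ i, ∑ j, W i j * (g i - g j) ^ 2)
    {A : (V → ℝ) →ₗ[ℝ] (V → ℝ)} (hA : ∀ g i, w i * A g i = ∑ j, W i j * (g i - g j)) :
    ∃ μ, IsLeast {μ : ℝ | 0 < μ ∧ Module.End.HasEigenvalue A μ} μ ∧
      ∀ f : V → ℝ, ∑ i, w i * f i = 0 →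
        2 * μ * ∑ i, w i * f i ^ 2 ≤ ∑ i, ∑ j, W i j * (f i - f j) ^ 2 := by
  obtain ⟨f₀, ⟨hn, hm⟩, hmin⟩ := (isCompact_weighted_sphere hw).exists_isMinOn
    (weighted_sphere_nonempty hw) (f := fun f : V → ℝ => ∑ i, ∑ j, W i j * (f i - f j) ^ 2)
    (Continuous.continuousOn (by fun_prop))
  set q : (V → ℝ) → ℝ := fun f => ∑ i, ∑ j, W i j * (f i - f j) ^ 2 with hq
  -- The half compensates for q being twice the energy ∑ w f (A f).
  set μ := q f₀ / 2 with hμ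
  have hqB : ∀ f, q f = 2 * ∑ i, w i * (f i * A f i) := fun f => by
    have h := two_mul_sum_weight_mul_sub hW f f
    have e : ∀ i, f i * ∑ j, W i j * (f i - f j) = w i * (f i * A f i) := fun i => by
      rw [← hA]; ring
    simp only [e] at h
    rw [h]
    simp only [hq, pow_two]
  have hB : ∀ f g, ∑ i, w i * (f i * A g i) = ∑ i, w i * (g i * A f i) := fun f g => by
    have h := two_mul_sum_weight_mul_sub hW f g
    have h' := two_mul_sum_weight_mul_sub hW g f
    have e : ∀ f g : V → ℝ, ∀ i, f i * ∑ j, W i j * (g i - g j) = w i * (f i * A g i) :=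
      fun f g i => by rw [← hA]; ring
    simp only [e] at h h'
    have : ∑ i, ∑ j, W i j * ((f i - f j) * (g i - g j)) =
        ∑ i, ∑ j, W i j * ((g i - g j) * (f i - f j)) := by simp only [mul_comm]
    linarith
  have hmean : ∀ f, ∑ i, w i * A f i = 0 := fun f => by
    simp only [hA]
    exact sum_weight_mul_sub_eq_zero hW f
  have hray : ∀ f : V → ℝ, ∑ i, w i * f i = 0 → 2 * μ * ∑ i, w i * f i ^ 2 ≤ q f := by
    intro f hf
    rcases (Finset.sum_nonneg fun i _ => mul_nonneg (hw i).le (sq_nonneg (f i)) :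
      0 ≤ ∑ i, w i * f i ^ 2).eq_or_lt with h0 | h0
    · have hz : ∀ i, f i = 0 := fun i => by
        have := (Finset.sum_eq_zero_iff_of_nonneg fun i _ =>
          mul_nonneg (hw i).le (sq_nonneg (f i))).1 h0.symm i (Finset.mem_univ i)
        simpa [(hw i).ne'] using this
      simp [hq, hz]
    · set s := ∑ i, w i * f i ^ 2 with hs
      have hmem : (fun v => (Real.sqrt s)⁻¹ * f v) ∈
          {f : V → ℝ | ∑ i, w i * f i ^ 2 = 1 ∧ ∑ i, w i * f i = 0} := by
        constructor
        · have : ∀ v, w v * ((Real.sqrt s)⁻¹ * f v) ^ 2 = s⁻¹ * (w v * f v ^ 2) := fun v => by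
            rw [mul_pow, inv_pow, Real.sq_sqrt h0.le]
            ring
          simp only [this]
          rw [← Finset.mul_sum]
          exact inv_mul_cancel₀ h0.ne'
        · have : ∀ v, w v * ((Real.sqrt s)⁻¹ * f v) = (Real.sqrt s)⁻¹ * (w v * f v) :=
            fun v => by ring
          simp only [this]
          rw [← Finset.mul_sum, hf, mul_zero]
      have hle : q f₀ ≤ q fun v => (Real.sqrt s)⁻¹ * f v := hmin hmem
      have hqs : (q fun v => (Real.sqrt s)⁻¹ * f v) = s⁻¹ * q f := by
        simp only [hq, Finset.mul_sum]
        refine Finset.sum_congr rfl fun i _ => Finset.sum_congr rfl fun j _ => ?_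
        rw [← mul_sub, mul_pow, inv_pow, Real.sq_sqrt h0.le]
        ring
      rw [hqs] at hle
      rw [hμ, mul_div_cancel₀ _ two_ne_zero]
      calc q f₀ * s ≤ s⁻¹ * q f * s := mul_le_mul_of_nonneg_right hle h0.le
        _ = q f := by field_simp
  have hne : ∃ i, f₀ i ≠ 0 := by
    by_contra! h
    simp [h] at hn
  have hμ0 : 0 < μ := by
    refine div_pos (hpos f₀ ?_) two_pos
    by_contra! hc
    obtain ⟨i, hi⟩ := hne
    have hconst : ∀ j, w j * f₀ j = f₀ i * w j := fun j => by rw [hc j i, mul_comm]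
    simp only [hconst] at hm
    rw [← Finset.mul_sum] at hm
    rcases mul_eq_zero.1 hm with h | h
    · exact hi h
    · exact (Finset.sum_pos (fun j _ => hw j) ⟨i, Finset.mem_univ i⟩).ne' h
  have heig : A f₀ = μ • f₀ := by
    set h : V → ℝ := A f₀ - μ • f₀ with hh
    have hhm : ∑ i, w i * h i = 0 := by
      have : ∀ i, w i * h i = w i * A f₀ i - μ * (w i * f₀ i) := fun i => by
        simp only [hh, Pi.sub_apply, Pi.smul_apply, smul_eq_mul]; ring
      simp only [this]
      rw [Finset.sum_sub_distrib, ← Finset.mul_sum, hmean, hm]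
      ring
    set H := ∑ i, w i * h i ^ 2 with hH
    have hHeq : H = ∑ i, w i * (h i * A f₀ i) - μ * ∑ i, w i * (h i * f₀ i) := by
      rw [hH, Finset.mul_sum, ← Finset.sum_sub_distrib]
      refine Finset.sum_congr rfl fun i _ => ?_
      have : h i = A f₀ i - μ * f₀ i := by simp [hh]
      calc w i * h i ^ 2 = w i * h i * h i := by ring
        _ = w i * h i * (A f₀ i - μ * f₀ i) := by rw [← this]
        _ = _ := by ring
    -- Perturb the minimizer along its own residual h = A f₀ - μ f₀. The resulting quadratic in t is
    -- nonnegative without constant term, so its linear coefficient 4H vanishes; H is the squared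
    -- norm of the residual.
    have hquad : ∀ t : ℝ, 0 ≤ (q h - 2 * μ * H) * (t * t) + 4 * H * t + 0 := by
      intro t
      have h1 := hray (f₀ + t • h) (by
        have : ∀ i, w i * (f₀ + t • h) i = w i * f₀ i + t * (w i * h i) := fun i => by
          simp only [Pi.add_apply, Pi.smul_apply, smul_eq_mul]; ring
        simp only [this]
        rw [Finset.sum_add_distrib, ← Finset.mul_sum, hm, hhm]
        ring)
      have h2 : q (f₀ + t • h) = q f₀ + t * (4 * ∑ i, w i * (h i * A f₀ i)) + t ^ 2 * q h := by
        rw [hqB, hqB, hqB]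
        have e : ∀ i, w i * ((f₀ + t • h) i * A (f₀ + t • h) i) = w i * (f₀ i * A f₀ i) +
            t * (w i * (h i * A f₀ i)) + t * (w i * (f₀ i * A h i)) +
            t ^ 2 * (w i * (h i * A h i)) := fun i => by
          simp only [map_add, map_smul, Pi.add_apply, Pi.smul_apply, smul_eq_mul]; ring
        simp only [e, Finset.sum_add_distrib, ← Finset.mul_sum]
        rw [hB f₀ h]
        ring
      have h3 : ∑ i, w i * (f₀ + t • h) i ^ 2 = 1 + 2 * t * ∑ i, w i * (h i * f₀ i) + t ^ 2 * H := by
        have e : ∀ i, w i * (f₀ + t • h) i ^ 2 = w i * f₀ i ^ 2 + 2 * t * (w i * (h i * f₀ i)) +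
            t ^ 2 * (w i * h i ^ 2) := fun i => by
          simp only [Pi.add_apply, Pi.smul_apply, smul_eq_mul]; ring
        simp only [e, Finset.sum_add_distrib, ← Finset.mul_sum]
        rw [hn]
      have h4 : q f₀ = 2 * μ := by rw [hμ]; ring
      rw [h2, h3, h4] at h1
      rw [hHeq]
      rw [hHeq] at h1
      linarith
    have hdisc := discrim_le_zero hquad
    have hH0 : H = 0 := by
      have : (4 * H) ^ 2 ≤ 0 := by simpa [discrim] using hdisc
      nlinarith [sq_nonneg H]
    have hz : h = 0 := by
      funext i
      have := (Finset.sum_eq_zero_iff_of_nonneg fun i _ =>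
        mul_nonneg (hw i).le (sq_nonneg (h i))).1 hH0 i (Finset.mem_univ i)
      simpa [(hw i).ne'] using this
    exact sub_eq_zero.1 hz
  refine ⟨μ, ⟨⟨hμ0, ?_⟩, ?_⟩, hray⟩
  · refine Module.End.hasEigenvalue_of_hasEigenvector (x := f₀) ⟨?_, ?_⟩
    · exact Module.End.mem_eigenspace_iff.2 heig
    · rintro rfl
      simp at hne
  · rintro ν ⟨hν, hνe⟩
    obtain ⟨g, hg⟩ := hνe.exists_hasEigenvector
    have hAg := hg.apply_eq_smul
    -- Since A g has w-mean zero, an eigenfunction with nonzero eigenvalue has it too and the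
    -- Rayleigh bound applies.
    have hgm : ∑ i, w i * g i = 0 := by
      have h1 := hmean g
      have e : ∀ i, w i * A g i = ν * (w i * g i) := fun i => by
        rw [hAg, Pi.smul_apply, smul_eq_mul]; ring
      simp only [e] at h1
      rw [← Finset.mul_sum] at h1
      exact (mul_eq_zero.1 h1).resolve_left hν.ne'
    have h1 := hray g hgm
    rw [hqB] at h1
    have e : ∀ i, w i * (g i * A g i) = ν * (w i * g i ^ 2) := fun i => by
      rw [hAg, Pi.smul_apply, smul_eq_mul]; ring
    simp only [e] at h1
    rw [← Finset.mul_sum] at h1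
    have hgpos : 0 < ∑ i, w i * g i ^ 2 := by
      obtain ⟨i, hi⟩ := Function.ne_iff.1 hg.2
      refine Finset.sum_pos' (fun i _ => mul_nonneg (hw i).le (sq_nonneg _))
        ⟨i, Finset.mem_univ i, ?_⟩
      have hi' : g i ≠ 0 := hi
      have := hw i
      positivity
    exact le_of_mul_le_mul_right (by linarith) hgpos

end WeightedLaplacian

-- Existence and uniqueness for autonomous equations

section AutonomousODE

open Set NNReal

variable {E : Type*} [NormedAddCommGroup E] [NormedSpace ℝ E]

theorem _root_.HasDerivWithinAt.right_of_mem_Ico {f : ℝ → E} {f' : E} {a b t : ℝ} {s : Set ℝ}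
    (ht : t ∈ Ico a b) (hs : Ico a b ⊆ s) (h : HasDerivWithinAt f f' s t) :
    HasDerivWithinAt f f' (Ici t) t :=
  h.mono_of_mem_nhdsWithin <| mem_of_superset (Ico_mem_nhdsGE ht.2) <|
    (Ico_subset_Ico_left ht.1).trans hs

/-- A bound on the speed lets Picard-Lindelöf apply on every [0, n], in a ball of radius L n;
uniqueness glues the pieces. -/
theorem exists_global_solution [CompleteSpace E] {G : E → E} {K L : ℝ≥0} (hG : LipschitzWith K G)
    (hL : ∀ x, ‖G x‖ ≤ L) (x₀ : E) :
    ∃ r : ℝ → E, r 0 = x₀ ∧ ∀ t ∈ Ici (0 : ℝ), HasDerivWithinAt r (G (r t)) (Ici 0) t := by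
  have hex : ∀ n : ℕ, ∃ a : ℝ → E, a 0 = x₀ ∧
      ∀ t ∈ Icc (0 : ℝ) n, HasDerivWithinAt a (G (a t)) (Icc 0 n) t := by
    intro n
    have hp : IsPicardLindelof (fun _ => G) (⟨0, le_rfl, n.cast_nonneg⟩ : Icc (0 : ℝ) n) x₀
        (L * n) 0 L K := by
      refine IsPicardLindelof.of_time_independent (fun x _ => hL x) hG.lipschitzOnWith ?_
      simp
    exact hp.exists_eq_forall_mem_Icc_hasDerivWithinAt₀
  choose a ha0 ha using hex
  have hagree : ∀ m n : ℕ, m ≤ n → EqOn (a m) (a n) (Icc 0 m) := by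
    intro m n hmn
    have hsub : Icc (0 : ℝ) m ⊆ Icc 0 n := Icc_subset_Icc_right (by exact_mod_cast hmn)
    refine ODE_solution_unique_of_mem_Icc_right (v := fun _ => G) (s := fun _ => univ) (K := K)
      (fun t _ => hG.lipschitzOnWith) (fun t ht => (ha m t ht).continuousWithinAt)
      (fun t ht => (ha m t (Ico_subset_Icc_self ht)).right_of_mem_Ico ht Ico_subset_Icc_self)
      (fun _ _ => mem_univ _) (fun t ht => ((ha n t (hsub ht)).mono hsub).continuousWithinAt)
      (fun t ht => (ha n t (hsub (Ico_subset_Icc_self ht))).right_of_mem_Ico ht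
        (Ico_subset_Icc_self.trans hsub)) (fun _ _ => mem_univ _) (by rw [ha0, ha0])
  have hr : ∀ n : ℕ, ∀ t ∈ Ico (0 : ℝ) n, a (⌊t⌋₊ + 1) t = a n t := by
    intro n t ht
    refine hagree _ _ ?_ ⟨ht.1, ?_⟩
    · exact Nat.succ_le_of_lt ((Nat.floor_lt ht.1).2 ht.2)
    · exact_mod_cast (Nat.lt_floor_add_one t).le
  -- The index ⌊t⌋ + 1 keeps t strictly below the right end, so the derivative within the piece is
  -- the derivative within [0, ∞).
  refine ⟨fun t => a (⌊t⌋₊ + 1) t, by simp [ha0], fun t ht => ?_⟩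
  have htn : t ∈ Ico (0 : ℝ) ((⌊t⌋₊ + 1 : ℕ) : ℝ) := ⟨ht, by exact_mod_cast Nat.lt_floor_add_one t⟩
  have h1 := ((ha (⌊t⌋₊ + 1) t (Ico_subset_Icc_self htn)).mono Ico_subset_Icc_self).congr
    (fun s hs => hr _ s hs) rfl
  refine h1.mono_of_mem_nhdsWithin ?_
  exact mem_nhdsWithin.2 ⟨Iio _, isOpen_Iio, htn.2, fun s hs => ⟨hs.2, hs.1⟩⟩

/-- Only r is assumed to stay in the ball. The set of times where ρ = r is closed, and just after
such a time continuity keeps ρ in the ball too, where the Lipschitz bound gives uniqueness. -/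
theorem eqOn_of_solution {F : E → E} {K : ℝ≥0} {x₀ : E} {ε b : ℝ}
    (hF : LipschitzOnWith K F (Metric.ball x₀ ε)) {r ρ : ℝ → E}
    (hr : ∀ t ∈ Ico 0 b, HasDerivWithinAt r (F (r t)) (Ico 0 b) t)
    (hrb : ∀ t ∈ Ico 0 b, r t ∈ Metric.ball x₀ ε)
    (hρ : ∀ t ∈ Ico 0 b, HasDerivWithinAt ρ (F (ρ t)) (Ico 0 b) t) (h0 : ρ 0 = r 0) :
    EqOn ρ r (Ico 0 b) := by
  intro t ht
  have hrc : ContinuousOn r (Ico 0 b) := fun s hs => (hr s hs).continuousWithinAt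
  have hρc : ContinuousOn ρ (Ico 0 b) := fun s hs => (hρ s hs).continuousWithinAt
  have hsub : Icc 0 t ⊆ Ico 0 b := fun s hs => ⟨hs.1, hs.2.trans_lt ht.2⟩
  have hclosed : IsClosed ({s | ρ s = r s} ∩ Icc 0 t) := by
    have := ((hρc.sub hrc).mono hsub).preimage_isClosed_of_isClosed isClosed_Icc
      (isClosed_singleton (x := (0 : E)))
    convert this using 1
    ext s
    simp [sub_eq_zero, and_comm]
  refine hclosed.Icc_subset_of_forall_mem_nhdsWithin h0 ?_ ⟨ht.1, le_rfl⟩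
  rintro s ⟨hs, hst⟩
  have hsb : s ∈ Ico 0 b := hsub (Ico_subset_Icc_self hst)
  have hnhds : ∀ f : ℝ → E, ContinuousOn f (Ico 0 b) → f s ∈ Metric.ball x₀ ε →
      f ⁻¹' Metric.ball x₀ ε ∈ 𝓝[≥] s := by
    intro f hf hfs
    refine ((hf s hsb).mono_of_mem_nhdsWithin ?_) (Metric.isOpen_ball.mem_nhds hfs)
    exact mem_of_superset (Ico_mem_nhdsGE hsb.2) (Ico_subset_Ico_left hsb.1)
  have h1 := hnhds r hrc (hrb s hsb)
  have h2 := hnhds ρ hρc (by rw [mem_ofPred_eq] at hs; rw [hs]; exact hrb s hsb)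
  obtain ⟨u, hu, hsu⟩ := (mem_nhdsGE_iff_exists_Icc_subset).1
    (inter_mem (inter_mem h1 h2) (Ico_mem_nhdsGE hsb.2))
  have hu' : Icc s u ⊆ Ico 0 b := fun x hx => ⟨hsb.1.trans hx.1, (hsu hx).2.2⟩
  have heq : EqOn ρ r (Icc s u) :=
    ODE_solution_unique_of_mem_Icc_right (v := fun _ => F) (s := fun _ => Metric.ball x₀ ε)
      (K := K) (fun _ _ => hF) (hρc.mono hu')
      (fun x hx => (hρ x (hu' (Ico_subset_Icc_self hx))).right_of_mem_Ico hx
        (Ico_subset_Icc_self.trans hu'))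
      (fun x hx => (hsu (Ico_subset_Icc_self hx)).1.2) (hrc.mono hu')
      (fun x hx => (hr x (hu' (Ico_subset_Icc_self hx))).right_of_mem_Ico hx
        (Ico_subset_Icc_self.trans hu'))
      (fun x hx => (hsu (Ico_subset_Icc_self hx)).1.1) hs
  exact mem_of_superset (Icc_mem_nhdsGT hu) heq

/-- A vector field that vanishes at `x₀` and is Lipschitz on a ball about `x₀` can be cut off
outside of a smaller ball to a bounded vector field that is Lipschitz on the whole space. -/
theorem exists_cutoff_lipschitzWith {F : E → E} {K : ℝ≥0} {x₀ : E} {ε : ℝ} (hε : 0 < ε)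
    (hF : LipschitzOnWith K F (Metric.ball x₀ ε)) (h0 : F x₀ = 0) :
    ∃ ψ : E → ℝ, ∃ K' L : ℝ≥0, LipschitzWith K' (fun x => ψ x • F x) ∧ (∀ x, ‖ψ x • F x‖ ≤ L) ∧
      (∀ x, 0 ≤ ψ x) ∧ (∀ x, x ∉ Metric.ball x₀ ε → ψ x = 0) ∧
      ∀ x ∈ Metric.closedBall x₀ (ε / 3), ψ x = 1 := by
  -- Equal to 1 up to radius ε/3, to 0 from radius 2ε/3 on, and linear in between with slope 3/ε.
  set ψ : E → ℝ := fun x => max 0 (min 1 (2 - 3 / ε * ‖x - x₀‖)) with hψ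
  have hψ0 : ∀ x, 0 ≤ ψ x := fun x => le_max_left _ _
  have hψ1 : ∀ x, ψ x ≤ 1 := fun x => max_le zero_le_one (min_le_left _ _)
  have hψz : ∀ x, x ∉ Metric.ball x₀ ε → ψ x = 0 := by
    intro x hx
    rw [Metric.mem_ball, dist_eq_norm, not_lt] at hx
    have : 3 ≤ 3 / ε * ‖x - x₀‖ := by
      rw [div_mul_eq_mul_div, le_div_iff₀ hε]
      linarith
    exact max_eq_left ((min_le_right _ _).trans (by linarith))
  have hψl : ∀ x y, |ψ x - ψ y| ≤ 3 / ε * ‖x - y‖ := by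
    intro x y
    have h1 : |ψ x - ψ y| ≤ |3 / ε * ‖y - x₀‖ - 3 / ε * ‖x - x₀‖| := by
      have h2 := abs_max_sub_max_le_max 0 (min 1 (2 - 3 / ε * ‖x - x₀‖)) 0
        (min 1 (2 - 3 / ε * ‖y - x₀‖))
      have h3 := abs_min_sub_min_le_max 1 (2 - 3 / ε * ‖x - x₀‖) 1 (2 - 3 / ε * ‖y - x₀‖)
      rw [sub_self, abs_zero, max_eq_right (a := 0) (b := |_|) (abs_nonneg _)] at h2 h3
      rw [sub_sub_sub_cancel_left] at h3
      exact h2.trans h3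
    refine h1.trans ?_
    rw [← mul_sub, abs_mul, abs_of_pos (by positivity : 0 < 3 / ε)]
    refine mul_le_mul_of_nonneg_left ?_ (by positivity)
    have := abs_norm_sub_norm_le (y - x₀) (x - x₀)
    rwa [sub_sub_sub_cancel_right, norm_sub_rev y x] at this
  have hFb : ∀ x ∈ Metric.ball x₀ ε, ‖F x‖ ≤ K * ε := by
    intro x hx
    have := hF.norm_sub_le hx (Metric.mem_ball_self hε)
    rw [h0, sub_zero] at this
    refine this.trans (mul_le_mul_of_nonneg_left ?_ K.2)
    rw [Metric.mem_ball, dist_eq_norm] at hx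
    exact hx.le
  have hmix : ∀ x ∈ Metric.ball x₀ ε, ∀ y, ‖(ψ x - ψ y) • F x‖ ≤ 3 * K * ‖x - y‖ := by
    intro x hx y
    rw [norm_smul, Real.norm_eq_abs]
    refine (mul_le_mul (hψl x y) (hFb x hx) (norm_nonneg _) (by positivity)).trans_eq ?_
    field_simp
  -- Of the constant 4K, the part 3K is the slope 3/ε times the bound Kε on F, which uses F x₀ = 0;
  -- the remaining K comes from F itself.
  refine ⟨ψ, 4 * K, K * ⟨ε, hε.le⟩, ?_, fun x => ?_, hψ0, hψz, fun x hx => ?_⟩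
  · refine LipschitzWith.of_dist_le_mul fun x y => ?_
    rw [dist_eq_norm, dist_eq_norm]
    push_cast
    by_cases hx : x ∈ Metric.ball x₀ ε
    · have hsplit : ψ x • F x - ψ y • F y = (ψ x - ψ y) • F x + ψ y • (F x - F y) := by module
      rw [hsplit]
      refine (norm_add_le _ _).trans ?_
      have h2 : ‖ψ y • (F x - F y)‖ ≤ K * ‖x - y‖ := by
        by_cases hy : y ∈ Metric.ball x₀ ε
        · rw [norm_smul, Real.norm_eq_abs, abs_of_nonneg (hψ0 y)]
          exact (mul_le_of_le_one_left (norm_nonneg _) (hψ1 y)).trans (hF.norm_sub_le hx hy)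
        · rw [hψz y hy, zero_smul, norm_zero]
          positivity
      linarith [hmix x hx y]
    · rw [hψz x hx, zero_smul, zero_sub, norm_neg]
      by_cases hy : y ∈ Metric.ball x₀ ε
      · have := hmix y hy x
        rw [hψz x hx, sub_zero, norm_sub_rev] at this
        have : 0 ≤ K * ‖x - y‖ := by positivity
        linarith
      · rw [hψz y hy, zero_smul, norm_zero]
        positivity
  · by_cases hx : x ∈ Metric.ball x₀ ε
    · rw [norm_smul, Real.norm_eq_abs, abs_of_nonneg (hψ0 x)]
      exact (mul_le_of_le_one_left (norm_nonneg _) (hψ1 x)).trans (hFb x hx)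
    · simp only [hψz x hx, zero_smul, norm_zero]
      positivity
  · rw [Metric.mem_closedBall, dist_eq_norm] at hx
    have : 3 / ε * ‖x - x₀‖ ≤ 1 := by
      rw [div_mul_eq_mul_div, div_le_iff₀ hε]
      linarith
    simp only [hψ]
    rw [min_eq_left (by linarith), max_eq_right zero_le_one]

end AutonomousODE

-- Exponential stability on a sphere

section StableFlow

open Set NNReal RealInnerProductSpace

variable {E : Type*} [NormedAddCommGroup E] [InnerProductSpace ℝ E]

theorem antitoneOn_Ici_of_hasDerivWithinAt {f f' : ℝ → ℝ}
    (hf : ∀ t ∈ Ici (0 : ℝ), HasDerivWithinAt f (f' t) (Ici 0) t)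
    (hf' : ∀ t ∈ Ici (0 : ℝ), f' t ≤ 0) : AntitoneOn f (Ici 0) := by
  refine antitoneOn_of_hasDerivWithinAt_nonpos (convex_Ici 0)
    (fun t ht => (hf t ht).continuousWithinAt) (f' := f') (fun t ht => ?_) fun t ht => ?_
  · exact (hf t (interior_subset ht)).mono interior_subset
  · exact hf' t (interior_subset ht)

/-- Nonlinear stability on the sphere `‖x‖ = ‖x₀‖` of a zero `x₀` of a vector field which is
tangent to the spheres about the origin. -/
theorem exists_stable_flow [CompleteSpace E] {F : E → E} {K : ℝ≥0} {x₀ : E} {ε c : ℝ} (hε : 0 < ε)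
    (hc : 0 < c) (hF : LipschitzOnWith K F (Metric.ball x₀ ε)) (h0 : F x₀ = 0)
    (htan : ∀ x ∈ Metric.ball x₀ ε, ⟪x, F x⟫ = 0)
    (hdecay : ∀ x ∈ Metric.ball x₀ ε, ‖x‖ = ‖x₀‖ → ⟪x - x₀, F x⟫ ≤ -c * ‖x - x₀‖ ^ 2)
    {y : E} (hy : ‖y‖ = ‖x₀‖) (hyε : ‖y - x₀‖ < ε / 3) :
    ∃ r : ℝ → E, r 0 = y ∧ (∀ t ∈ Ici (0 : ℝ), r t ∈ Metric.ball x₀ ε) ∧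
      (∀ t ∈ Ici (0 : ℝ), HasDerivWithinAt r (F (r t)) (Ici 0) t) ∧ Tendsto r atTop (𝓝 x₀) := by
  obtain ⟨ψ, K', L, hG, hL, hψ0, hψz, hψ1⟩ := exists_cutoff_lipschitzWith hε hF h0
  obtain ⟨r, hr0, hr⟩ := exists_global_solution hG hL y
  -- The cut-off field is tangent to spheres everywhere: inside the ball by `htan`, outside because
  -- it is zero. The decay estimate, valid only on the sphere, is thus available at all times.
  have hnorm : ∀ t ∈ Ici (0 : ℝ), ‖r t‖ = ‖x₀‖ := by
    have hz : ∀ t, 2 * ⟪r t, ψ (r t) • F (r t)⟫ = 0 := by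
      intro t
      rw [real_inner_smul_right]
      by_cases h : r t ∈ Metric.ball x₀ ε
      · rw [htan _ h, mul_zero, mul_zero]
      · rw [hψz _ h, zero_mul, mul_zero]
    intro t ht
    have h1 := antitoneOn_Ici_of_hasDerivWithinAt (fun t ht => (hr t ht).norm_sq)
      (fun t _ => (hz t).le) self_mem_Ici ht ht
    have h2 := antitoneOn_Ici_of_hasDerivWithinAt (fun t ht => (hr t ht).norm_sq.neg)
      (fun t _ => (neg_eq_zero.2 (hz t)).le) self_mem_Ici ht ht
    simp only [Pi.neg_apply, hr0, hy] at h1 h2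
    exact (pow_left_inj₀ (norm_nonneg _) (norm_nonneg _) two_ne_zero).1 (by linarith)
  have hdiff : ∀ t ∈ Ici (0 : ℝ), HasDerivWithinAt (fun t => ‖r t - x₀‖ ^ 2)
      (2 * ⟪r t - x₀, ψ (r t) • F (r t)⟫) (Ici 0) t :=
    fun t ht => ((hr t ht).sub_const x₀).norm_sq
  -- The distance to x₀ never grows, so the solution remains where the cutoff is 1 and solves the
  -- original equation.
  have hle : ∀ t ∈ Ici (0 : ℝ), ‖r t - x₀‖ < ε / 3 := by
    intro t ht
    have h1 := antitoneOn_Ici_of_hasDerivWithinAt hdiff (fun t ht => ?_) self_mem_Ici ht ht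
    · simp only [hr0] at h1
      exact ((pow_le_pow_iff_left₀ (norm_nonneg _) (norm_nonneg _) two_ne_zero).1 h1).trans_lt hyε
    · rw [real_inner_smul_right]
      by_cases h : r t ∈ Metric.ball x₀ ε
      · have h2 := hdecay _ h (hnorm t ht)
        have h3 : -c * ‖r t - x₀‖ ^ 2 ≤ 0 :=
          mul_nonpos_of_nonpos_of_nonneg (by linarith) (sq_nonneg _)
        have := mul_nonpos_of_nonneg_of_nonpos (hψ0 (r t)) (h2.trans h3)
        linarith
      · rw [hψz _ h, zero_mul, mul_zero]
  have hball : ∀ t ∈ Ici (0 : ℝ), r t ∈ Metric.ball x₀ ε := fun t ht => by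
    rw [Metric.mem_ball, dist_eq_norm]
    linarith [hle t ht]
  have hψr : ∀ t ∈ Ici (0 : ℝ), ψ (r t) • F (r t) = F (r t) := fun t ht => by
    rw [hψ1 _ (by rw [Metric.mem_closedBall, dist_eq_norm]; exact (hle t ht).le), one_smul]
  refine ⟨r, hr0, hball, fun t ht => hψr t ht ▸ hr t ht, ?_⟩
  have hexp : ∀ t ∈ Ici (0 : ℝ), HasDerivWithinAt (fun t => Real.exp (2 * c * t) * ‖r t - x₀‖ ^ 2)
      (Real.exp (2 * c * t) * (2 * c) * ‖r t - x₀‖ ^ 2 +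
        Real.exp (2 * c * t) * (2 * ⟪r t - x₀, F (r t)⟫)) (Ici 0) t := by
    intro t ht
    have h1 : HasDerivAt (fun t => Real.exp (2 * c * t)) (Real.exp (2 * c * t) * (2 * c)) t := by
      simpa using ((hasDerivAt_id t).const_mul (2 * c)).exp
    have h2 := hdiff t ht
    rw [hψr t ht] at h2
    exact h1.hasDerivWithinAt.mul h2
  have hanti := antitoneOn_Ici_of_hasDerivWithinAt hexp fun t ht => by
    have h2 := mul_le_mul_of_nonneg_left (hdecay _ (hball t ht) (hnorm t ht))
      (Real.exp_pos (2 * c * t)).le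
    linarith
  have hbound : ∀ t ∈ Ici (0 : ℝ), ‖r t - x₀‖ ^ 2 ≤ Real.exp (-(2 * c * t)) * ‖y - x₀‖ ^ 2 := by
    intro t ht
    have h1 := hanti self_mem_Ici ht ht
    simp only [hr0, mul_zero, Real.exp_zero, one_mul] at h1
    rw [Real.exp_neg, inv_mul_eq_div, le_div_iff₀ (Real.exp_pos _), mul_comm]
    exact h1
  have hlim : Tendsto (fun t => Real.exp (-(2 * c * t)) * ‖y - x₀‖ ^ 2) atTop (𝓝 0) := by
    rw [← zero_mul (‖y - x₀‖ ^ 2)]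
    refine Tendsto.mul_const _ (Real.tendsto_exp_neg_atTop_nhds_zero.comp ?_)
    exact tendsto_id.const_mul_atTop (by positivity)
  have hsq : Tendsto (fun t => ‖r t - x₀‖ ^ 2) atTop (𝓝 0) := by
    refine squeeze_zero' (Eventually.of_forall fun t => sq_nonneg _) ?_ hlim
    filter_upwards [Ici_mem_atTop 0] with t ht using hbound t ht
  rw [tendsto_iff_norm_sub_tendsto_zero]
  have := hsq.sqrt
  simpa [Real.sqrt_sq (norm_nonneg _)] using this

end StableFlow

open RealInnerProductSpace

section Decay

variable {E : Type*} [NormedAddCommGroup E] [InnerProductSpace ℝ E]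

/-- If the derivative at a zero `x₀` of a vector field is negative definite transversally to `x₀`,
then on the sphere about the origin through `x₀` the vector field points towards `x₀`. -/
theorem eventually_inner_sub_le {F : E → E} {F' : E →L[ℝ] E} {x₀ : E} {m : ℝ} (hm : 0 < m)
    (hF : HasFDerivAt F F' x₀) (h0 : F x₀ = 0) (hx₀ : ‖x₀‖ = 1)
    (hF' : ∀ h, ⟪h, F' h⟫ ≤ -m * (‖h‖ ^ 2 - ⟪h, x₀⟫ ^ 2)) :
    ∀ᶠ x in 𝓝 x₀, ‖x‖ = ‖x₀‖ → ⟪x - x₀, F x⟫ ≤ -(m / 2) * ‖x - x₀‖ ^ 2 := by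
  -- On the unit sphere ⟨x - x₀, x₀⟩ is of second order, so for ‖x - x₀‖ ≤ 1 the linear part
  -- contributes at most -(3m/4)‖x - x₀‖². A Taylor error of m/4 leaves m/2.
  have h1 := hF.isLittleO.def (by positivity : 0 < m / 4)
  filter_upwards [h1, Metric.ball_mem_nhds x₀ one_pos] with x hx hb hn
  rw [h0, sub_zero] at hx
  rw [Metric.mem_ball, dist_eq_norm] at hb
  have hin : ⟪x - x₀, x₀⟫ = -(‖x - x₀‖ ^ 2 / 2) := by
    have := norm_sub_sq_real x x₀
    rw [hn, hx₀] at this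
    rw [inner_sub_left, real_inner_self_eq_norm_sq, hx₀]
    linarith
  have h2 : ⟪x - x₀, F x - F' (x - x₀)⟫ ≤ m / 4 * ‖x - x₀‖ ^ 2 := by
    refine (real_inner_le_norm _ _).trans ?_
    refine (mul_le_mul_of_nonneg_left hx (norm_nonneg _)).trans_eq (by ring)
  have h3 := hF' (x - x₀)
  rw [inner_sub_right] at h2
  rw [hin] at h3
  have h4 : ‖x - x₀‖ ^ 2 ≤ 1 := pow_le_one₀ (norm_nonneg _) hb.le
  have h5 : m * (‖x - x₀‖ ^ 2 * ‖x - x₀‖ ^ 2) ≤ m * (‖x - x₀‖ ^ 2 * 1) :=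
    mul_le_mul_of_nonneg_left (mul_le_mul_of_nonneg_left h4 (sq_nonneg _)) hm.le
  nlinarith

end Decay

-- The field of the α-flow and its linearization

namespace Triangulation

variable {V M : Type*} [Fintype V] [TopologicalSpace M]

/-- The vector field of the `α`-flow. -/
def alphaField (T : Triangulation V M) (α : ℝ) (r : EuclideanSpace ℝ V) : EuclideanSpace ℝ V :=
  WithLp.toLp 2 fun i => T.sAlpha α r * r i ^ α - T.scalarCurv r i

theorem alphaField_apply (T : Triangulation V M) (α : ℝ) (r : EuclideanSpace ℝ V) (i : V) :
    T.alphaField α r i = T.sAlpha α r * r i ^ α - T.scalarCurv r i := rfl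

theorem sum_rpow_pos [Nonempty V] {r : EuclideanSpace ℝ V} (hr : ∀ i, 0 < r i) (p : ℝ) :
    0 < ∑ i, r i ^ p :=
  Finset.sum_pos (fun i _ => Real.rpow_pos_of_pos (hr i) p) Finset.univ_nonempty

/-- The normalization s_α is exactly the factor that makes the field orthogonal to the position
vector. -/
theorem inner_alphaField [Nonempty V] (T : Triangulation V M) (α : ℝ) {r : EuclideanSpace ℝ V}
    (hr : ∀ i, 0 < r i) : ⟪r, T.alphaField α r⟫ = 0 := by
  have hD := (sum_rpow_pos hr (α + 1)).ne'
  have h1 : ⟪r, T.alphaField α r⟫ =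
      T.sAlpha α r * ∑ i, r i ^ (α + 1) - ∑ i, T.scalarCurv r i * r i := by
    rw [PiLp.inner_apply, Finset.mul_sum, ← Finset.sum_sub_distrib]
    refine Finset.sum_congr rfl fun i _ => ?_
    rw [alphaField_apply, Real.rpow_add_one (hr i).ne']
    simp
    ring
  rw [h1, sAlpha, div_mul_cancel₀ _ hD, sub_self]

/-- Substituting K_i = c r_i^α into the quotient defining s_α identifies the constant c with s_α. -/
theorem IsConstAlphaMetric.scalarCurv_eq [Nonempty V] {T : Triangulation V M} {α : ℝ}
    {r : EuclideanSpace ℝ V} (h : T.IsConstAlphaMetric α r) (i : V) :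
    T.scalarCurv r i = T.sAlpha α r * r i ^ α := by
  obtain ⟨hr, c, hc⟩ := h
  have hpos := hr.1
  have hK : ∀ i, T.scalarCurv r i = c * r i ^ α := fun i => by
    rw [← hc i, alphaCurv, div_mul_cancel₀ _ (Real.rpow_pos_of_pos (hpos i) α).ne']
  have hs : T.sAlpha α r = c := by
    rw [sAlpha, div_eq_iff (sum_rpow_pos hpos (α + 1)).ne', Finset.mul_sum]
    refine Finset.sum_congr rfl fun i _ => ?_
    rw [hK, Real.rpow_add_one (hpos i).ne']
    ring
  rw [hs, hK]

theorem IsConstAlphaMetric.alphaField_eq_zero [Nonempty V] {T : Triangulation V M} {α : ℝ}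
    {r : EuclideanSpace ℝ V} (h : T.IsConstAlphaMetric α r) : T.alphaField α r = 0 := by
  ext i
  rw [alphaField_apply, h.scalarCurv_eq, sub_self]
  rfl

theorem hasStrictFDerivAt_coord_rpow {r : EuclideanSpace ℝ V} (hr : ∀ i, 0 < r i) (p : ℝ) (i : V) :
    HasStrictFDerivAt (fun ρ : EuclideanSpace ℝ V => ρ i ^ p)
      ((p * r i ^ (p - 1)) • (EuclideanSpace.proj i : EuclideanSpace ℝ V →L[ℝ] ℝ)) r :=
  ((EuclideanSpace.proj i : EuclideanSpace ℝ V →L[ℝ] ℝ).hasStrictFDerivAt (x := r)).rpow_const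
    (Or.inl (hr i).ne')

/-- A Schläfli-type identity: the symmetric weighted differences cancel in pairs. It gives d(∑ K_i
r_i) = ∑ K_i dr_i. -/
theorem sum_mul_scalarCurvDeriv {T : Triangulation V M} {r : EuclideanSpace ℝ V}
    (hr : ∀ i, 0 < r i) (h : EuclideanSpace ℝ V) :
    ∑ i, r i * T.scalarCurvDeriv r i h = 0 := by
  rw [← sum_weight_mul_sub_eq_zero (T.totalWeight_comm r) (fun i => (r i)⁻¹ * h i)]
  refine Finset.sum_congr rfl fun i _ => ?_
  rw [scalarCurvDeriv_apply, mul_inv_cancel_left₀ (hr i).ne']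

theorem sum_apply_mul_scalarCurvDeriv {T : Triangulation V M} {r : EuclideanSpace ℝ V}
    (h : EuclideanSpace ℝ V) :
    2 * ∑ i, h i * T.scalarCurvDeriv r i h =
      ∑ i, ∑ j, T.totalWeight r i j * ((r i)⁻¹ * h i - (r j)⁻¹ * h j) ^ 2 := by
  simp only [pow_two]
  rw [← two_mul_sum_weight_mul_sub (T.totalWeight_comm r) (fun i => (r i)⁻¹ * h i)
    (fun i => (r i)⁻¹ * h i)]
  congr 1
  refine Finset.sum_congr rfl fun i _ => ?_
  rw [scalarCurvDeriv_apply]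
  ring

/-- At constant curvature the numerator has differential s_α ∑ r_i^α h_i by the Schläfli-type
identity, and the denominator (α + 1) ∑ r_i^α h_i. The quotient rule leaves 1 - (α + 1) = -α. -/
theorem IsConstAlphaMetric.exists_hasStrictFDerivAt_sAlpha [Nonempty V] {T : Triangulation V M}
    {α : ℝ} {r : EuclideanSpace ℝ V} (hc : T.IsConstAlphaMetric α r) :
    ∃ s' : EuclideanSpace ℝ V →L[ℝ] ℝ, HasStrictFDerivAt (T.sAlpha α) s' r ∧
      ∀ h, s' h * ∑ i, r i ^ (α + 1) = -(α * T.sAlpha α r * ∑ i, r i ^ α * h i) := by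
  have hr := hc.1
  have hpos := hr.1
  have hD := (sum_rpow_pos hpos (α + 1)).ne'
  have hN : HasStrictFDerivAt (fun ρ : EuclideanSpace ℝ V => ∑ i, T.scalarCurv ρ i * ρ i)
      (∑ i, (T.scalarCurv r i • (EuclideanSpace.proj i : EuclideanSpace ℝ V →L[ℝ] ℝ) +
        r i • T.scalarCurvDeriv r i)) r :=
    HasStrictFDerivAt.fun_sum fun i _ => (hasStrictFDerivAt_scalarCurv hr i).mul
      (EuclideanSpace.proj i : EuclideanSpace ℝ V →L[ℝ] ℝ).hasStrictFDerivAt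
  have hDen : HasStrictFDerivAt (fun ρ : EuclideanSpace ℝ V => ∑ i, ρ i ^ (α + 1))
      (∑ i, ((α + 1) * r i ^ (α + 1 - 1)) •
        (EuclideanSpace.proj i : EuclideanSpace ℝ V →L[ℝ] ℝ)) r :=
    HasStrictFDerivAt.fun_sum fun i _ => hasStrictFDerivAt_coord_rpow hpos _ i
  have hdiv := hN.mul ((hasStrictDerivAt_inv hD).comp_hasStrictFDerivAt r hDen)
  have hK := hc.scalarCurv_eq
  have e : T.sAlpha α = (fun ρ : EuclideanSpace ℝ V => ∑ i, T.scalarCurv ρ i * ρ i) *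
      (Inv.inv ∘ fun ρ : EuclideanSpace ℝ V => ∑ i, ρ i ^ (α + 1)) := by
    ext ρ
    simp [sAlpha, div_eq_mul_inv]
  rw [← e] at hdiv
  refine ⟨_, hdiv, fun h => ?_⟩
  have hNs : ∑ i, T.scalarCurv r i * r i = T.sAlpha α r * ∑ i, r i ^ (α + 1) := by
    rw [sAlpha, div_mul_cancel₀ _ hD]
  have hN' : (∑ i, (T.scalarCurv r i • (EuclideanSpace.proj i : EuclideanSpace ℝ V →L[ℝ] ℝ) +
        r i • T.scalarCurvDeriv r i)) h = T.sAlpha α r * ∑ i, r i ^ α * h i := by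
    have : (∑ i, (T.scalarCurv r i • (EuclideanSpace.proj i : EuclideanSpace ℝ V →L[ℝ] ℝ) +
        r i • T.scalarCurvDeriv r i)) h =
        ∑ i, T.scalarCurv r i * h i + ∑ i, r i * T.scalarCurvDeriv r i h := by
      simp [Finset.sum_add_distrib]
    rw [this, sum_mul_scalarCurvDeriv hpos, add_zero, Finset.mul_sum]
    exact Finset.sum_congr rfl fun i _ => by rw [hK]; ring
  have hD' : (∑ i, ((α + 1) * r i ^ (α + 1 - 1)) •
        (EuclideanSpace.proj i : EuclideanSpace ℝ V →L[ℝ] ℝ)) h =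
      (α + 1) * ∑ i, r i ^ α * h i := by
    simp [Finset.mul_sum, mul_assoc]
  simp only [add_apply, smul_apply, smul_eq_mul, Function.comp_apply, hN', hD', hNs]
  field_simp
  ring

/-- The term from r_i^α gives the second moment of h_i / r_i and the term from s_α subtracts the
squared mean, so together they form the weighted variance; the curvature contributes the Laplacian
energy. -/
theorem IsConstAlphaMetric.exists_hasStrictFDerivAt_alphaField [Nonempty V]
    {T : Triangulation V M} {α : ℝ} {r : EuclideanSpace ℝ V} (hc : T.IsConstAlphaMetric α r) :
    ∃ F' : EuclideanSpace ℝ V →L[ℝ] EuclideanSpace ℝ V,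
      HasStrictFDerivAt (T.alphaField α) F' r ∧
      ∀ h, ⟪h, F' h⟫ =
        α * T.sAlpha α r * (∑ i, r i ^ (α + 1) * ((r i)⁻¹ * h i) ^ 2 -
          (∑ i, r i ^ (α + 1) * ((r i)⁻¹ * h i)) ^ 2 / ∑ i, r i ^ (α + 1)) -
        (∑ i, ∑ j, T.totalWeight r i j * ((r i)⁻¹ * h i - (r j)⁻¹ * h j) ^ 2) / 2 := by
  have hr := hc.1
  have hpos := hr.1
  have hD := (sum_rpow_pos hpos (α + 1)).ne'
  obtain ⟨s', hs', hs⟩ := hc.exists_hasStrictFDerivAt_sAlpha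
  set L : V → EuclideanSpace ℝ V →L[ℝ] ℝ := fun i =>
    T.sAlpha α r • ((α * r i ^ (α - 1)) • (EuclideanSpace.proj i : EuclideanSpace ℝ V →L[ℝ] ℝ)) +
      r i ^ α • s' - T.scalarCurvDeriv r i with hL
  refine ⟨(PiLp.continuousLinearEquiv 2 ℝ (fun _ : V => ℝ)).symm.toContinuousLinearMap ∘L
    ContinuousLinearMap.pi L, ?_, fun h => ?_⟩
  · rw [hasStrictFDerivAt_euclidean]
    intro i
    have := (hs'.mul (hasStrictFDerivAt_coord_rpow hpos α i)).sub (hasStrictFDerivAt_scalarCurv hr i)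
    exact this
  · have h1 : ∀ i, ((PiLp.continuousLinearEquiv 2 ℝ (fun _ : V => ℝ)).symm.toContinuousLinearMap ∘L
        ContinuousLinearMap.pi L) h i = T.sAlpha α r * (α * r i ^ (α - 1) * h i) +
          r i ^ α * s' h - T.scalarCurvDeriv r i h := fun i => rfl
    rw [PiLp.inner_apply, ← sum_apply_mul_scalarCurvDeriv]
    have e1 : ∑ i, r i ^ (α + 1) * ((r i)⁻¹ * h i) = ∑ i, r i ^ α * h i :=
      Finset.sum_congr rfl fun i _ => by
        have := (hpos i).ne'
        rw [Real.rpow_add_one this]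
        field_simp
    have e2 : ∑ i, r i ^ (α + 1) * ((r i)⁻¹ * h i) ^ 2 = ∑ i, r i ^ (α - 1) * h i ^ 2 :=
      Finset.sum_congr rfl fun i _ => by
        have := (hpos i).ne'
        rw [Real.rpow_add_one this, Real.rpow_sub_one this]
        field_simp
    have e3 : s' h = -(α * T.sAlpha α r * ∑ i, r i ^ α * h i) / ∑ i, r i ^ (α + 1) := by
      rw [eq_div_iff hD, hs]
    have e4 : ∑ i, ⟪h i, ((PiLp.continuousLinearEquiv 2 ℝ
        (fun _ : V => ℝ)).symm.toContinuousLinearMap ∘L ContinuousLinearMap.pi L) h i⟫ =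
        α * T.sAlpha α r * ∑ i, r i ^ (α - 1) * h i ^ 2 + s' h * ∑ i, r i ^ α * h i -
          ∑ i, h i * T.scalarCurvDeriv r i h := by
      rw [Finset.mul_sum, Finset.mul_sum, ← Finset.sum_add_distrib, ← Finset.sum_sub_distrib]
      refine Finset.sum_congr rfl fun i _ => ?_
      rw [h1]
      simp
      ring
    rw [e1, e2, e4, e3]
    ring

end Triangulation

/-- The weighted variance of the quotients `h i / r i` controls the part of `h` transversal
to `r`. -/
theorem exists_mul_sq_sub_inner_sq_le {V : Type*} [Fintype V] {w : V → ℝ} (hw : ∀ i, 0 < w i)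
    {r : EuclideanSpace ℝ V} (hr : ∀ i, 0 < r i) (hr1 : ‖r‖ = 1) :
    ∃ m > 0, ∀ (h : EuclideanSpace ℝ V) (a : ℝ),
      m * (‖h‖ ^ 2 - ⟪h, r⟫ ^ 2) ≤ ∑ i, w i * ((r i)⁻¹ * h i - a) ^ 2 := by
  obtain ⟨m, hm, hmw⟩ : ∃ m > 0, ∀ i, m ≤ w i / r i ^ 2 := by
    rcases isEmpty_or_nonempty V with hV | hV
    · exact ⟨1, one_pos, fun i => (hV.false i).elim⟩
    · obtain ⟨i₀, hi₀⟩ := Finite.exists_min fun i => w i / r i ^ 2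
      exact ⟨_, div_pos (hw i₀) (pow_pos (hr i₀) 2), hi₀⟩
  refine ⟨m, hm, fun h a => ?_⟩
  -- The left side is the squared distance from h to the line spanned by the unit vector r.
  have h1 : ‖h‖ ^ 2 - ⟪h, r⟫ ^ 2 ≤ ‖h - a • r‖ ^ 2 := by
    rw [norm_sub_sq_real, norm_smul, hr1, real_inner_smul_right, Real.norm_eq_abs, mul_one, sq_abs]
    nlinarith [sq_nonneg (a - ⟪h, r⟫)]
  refine (mul_le_mul_of_nonneg_left h1 hm.le).trans ?_
  rw [EuclideanSpace.norm_sq_eq, Finset.mul_sum]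
  refine Finset.sum_le_sum fun i _ => ?_
  have h2 : (h - a • r) i = r i * ((r i)⁻¹ * h i - a) := by
    have := (hr i).ne'
    simp
    field_simp
  rw [h2, Real.norm_eq_abs, sq_abs, mul_pow, ← mul_assoc]
  refine mul_le_mul_of_nonneg_right ?_ (sq_nonneg _)
  rw [← le_div_iff₀ (pow_pos (hr i) 2)]
  exact hmw i

theorem sum_mul_sub_weighted_mean {V : Type*} [Fintype V] {w f : V → ℝ} (hw : ∑ i, w i ≠ 0) :
    ∑ i, w i * (f i - (∑ i, w i * f i) / ∑ i, w i) = 0 := by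
  simp only [mul_sub, Finset.sum_sub_distrib, ← Finset.sum_mul]
  rw [mul_div_cancel₀ _ hw, sub_self]

theorem sum_mul_sub_weighted_mean_sq {V : Type*} [Fintype V] {w f : V → ℝ} (hw : ∑ i, w i ≠ 0) :
    ∑ i, w i * (f i - (∑ i, w i * f i) / ∑ i, w i) ^ 2 =
      ∑ i, w i * f i ^ 2 - (∑ i, w i * f i) ^ 2 / ∑ i, w i := by
  set a := (∑ i, w i * f i) / ∑ i, w i with ha
  have h1 : ∀ i, w i * (f i - a) ^ 2 = w i * f i ^ 2 - 2 * a * (w i * f i) + a ^ 2 * w i :=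
    fun i => by ring
  simp only [h1, Finset.sum_add_distrib, Finset.sum_sub_distrib, ← Finset.mul_sum]
  rw [ha]
  field_simp
  ring

-- Spectral gap of the α-Laplacian and convergence of the flow

namespace Triangulation

variable {V M : Type*} [Fintype V] [TopologicalSpace M]

/-- Without a second vertex there would be no nonzero function of mean zero, hence no positive
eigenvalue. -/
theorem nontrivial_vertices [Nonempty M] (T : Triangulation V M) : Nontrivial V := by
  obtain ⟨x, -, -, s, hs, -⟩ := T.homeo.symm (Classical.arbitrary M)
  obtain ⟨τ, hτ, -⟩ := T.exists_tet_of_face hs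
  obtain ⟨i, -, j, -, hij⟩ := Finset.one_lt_card.1
    (by rw [(mem_tets.1 hτ).2]; norm_num : 1 < τ.card)
  exact ⟨i, j, hij⟩

/-- The first positive eigenvalue of the `α`-Laplacian is positive and is its spectral gap. -/
theorem lambdaOne_spec [ConnectedSpace M] {T : Triangulation V M} {r : EuclideanSpace ℝ V}
    (hr : r ∈ T.metrics) (α : ℝ) :
    0 < T.lambdaOne α r ∧ ∀ f : V → ℝ, ∑ i, r i ^ (α + 1) * f i = 0 →
      2 * T.lambdaOne α r * ∑ i, r i ^ (α + 1) * f i ^ 2 ≤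
        ∑ i, ∑ j, T.totalWeight r i j * (f i - f j) ^ 2 := by
  have := T.nontrivial_vertices
  obtain ⟨μ, hμ, hgap⟩ := exists_isLeast_pos_eigenvalue (w := fun i => r i ^ (α + 1))
    (W := T.totalWeight r) (A := -T.alphaLaplacian α r)
    (fun i => Real.rpow_pos_of_pos (hr.1 i) _) (T.totalWeight_comm r)
    (fun g hg => sum_totalWeight_pos hr hg) (fun g i => by
      rw [LinearMap.neg_apply, Pi.neg_apply, mul_neg, alphaLaplacian_apply hr,
        ← Finset.sum_neg_distrib]
      exact Finset.sum_congr rfl fun j _ => by ring)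
  have h : T.lambdaOne α r = μ := hμ.csInf_eq
  rw [h]
  exact ⟨hμ.1.1, hgap⟩

/-- The spectral gap, applied to h_i / r_i minus its weighted mean a, dominates the variance term.
Subtracting the mean does not change the energy, which sees only differences. -/
theorem IsConstAlphaMetric.exists_derivative_neg [ConnectedSpace M] {T : Triangulation V M} {α : ℝ}
    {r : EuclideanSpace ℝ V} (hc : T.IsConstAlphaMetric α r) (hr1 : ‖r‖ = 1)
    (hlt : α * T.sAlpha α r < T.lambdaOne α r) :
    ∃ F' : EuclideanSpace ℝ V →L[ℝ] EuclideanSpace ℝ V,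
      HasStrictFDerivAt (T.alphaField α) F' r ∧
      ∃ m > 0, ∀ h, ⟪h, F' h⟫ ≤ -m * (‖h‖ ^ 2 - ⟪h, r⟫ ^ 2) := by
  have := T.nontrivial_vertices
  have hpos := hc.1.1
  have hD := (sum_rpow_pos hpos (α + 1)).ne'
  obtain ⟨F', hF', hinner⟩ := hc.exists_hasStrictFDerivAt_alphaField
  obtain ⟨-, hgap⟩ := lambdaOne_spec hc.1 α
  obtain ⟨m, hm, hmle⟩ := exists_mul_sq_sub_inner_sq_le (w := fun i => r i ^ (α + 1))
    (fun i => Real.rpow_pos_of_pos (hpos i) _) hpos hr1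
  refine ⟨F', hF', (T.lambdaOne α r - α * T.sAlpha α r) * m, mul_pos (sub_pos.2 hlt) hm,
    fun h => ?_⟩
  rw [hinner, ← sum_mul_sub_weighted_mean_sq (w := fun i => r i ^ (α + 1)) hD]
  set a := (∑ i, r i ^ (α + 1) * ((r i)⁻¹ * h i)) / ∑ i, r i ^ (α + 1)
  have h1 := hgap (fun i => (r i)⁻¹ * h i - a) (sum_mul_sub_weighted_mean hD)
  simp only [sub_sub_sub_cancel_right] at h1
  have h2 := mul_le_mul_of_nonneg_left (hmle h a) (sub_pos.2 hlt).le
  linarith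

theorem isAlphaFlowOn_iff {T : Triangulation V M} {α : ℝ} {J : Set ℝ}
    {ρ : ℝ → EuclideanSpace ℝ V} :
    T.IsAlphaFlowOn α J ρ ↔
      ∀ t ∈ J, ρ t ∈ T.metrics ∧ HasDerivWithinAt ρ (T.alphaField α (ρ t)) J t := by
  refine forall₂_congr fun t _ => and_congr_right fun _ => ?_
  rw [hasDerivWithinAt_iff_hasFDerivWithinAt, hasFDerivWithinAt_euclidean]
  refine forall_congr' fun i => ?_
  rw [hasDerivWithinAt_iff_hasFDerivWithinAt]
  refine iff_of_eq (congrArg (fun L => HasFDerivWithinAt (fun x => ρ x i) L J t) ?_)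
  ext
  simp [alphaField_apply]

theorem IsConstAlphaMetric.exists_flow_tendsto [ConnectedSpace M] {T : Triangulation V M} {α : ℝ}
    {r : EuclideanSpace ℝ V} (hc : T.IsConstAlphaMetric α r) (hr1 : ‖r‖ = 1)
    (hlt : α * T.sAlpha α r < T.lambdaOne α r) :
    ∃ δ > 0, ∀ r₀ : EuclideanSpace ℝ V, ‖r₀‖ = 1 → ‖r₀ - r‖ < δ →
      ∃ u : ℝ → EuclideanSpace ℝ V, u 0 = r₀ ∧ T.IsAlphaFlowOn α (Set.Ici 0) u ∧
        (∀ (b : ℝ) (ρ : ℝ → EuclideanSpace ℝ V), ρ 0 = r₀ →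
          T.IsAlphaFlowOn α (Set.Ico 0 b) ρ → Set.EqOn ρ u (Set.Ico 0 b)) ∧
        Tendsto u atTop (𝓝 r) := by
  have := T.nontrivial_vertices
  obtain ⟨F', hF', m, hm, hneg⟩ := hc.exists_derivative_neg hr1 hlt
  have h0 := hc.alphaField_eq_zero
  obtain ⟨K, s, hs, hK⟩ := hF'.exists_lipschitzOnWith
  -- One ball on which the field is Lipschitz, every point is a metric and the decay estimate holds.
  obtain ⟨ε, hε, hball⟩ := Metric.mem_nhds_iff.1 (Filter.inter_mem
    (Filter.inter_mem hs (metrics_mem_nhds hc.1))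
    (eventually_inner_sub_le hm hF'.hasFDerivAt h0 hr1 hneg))
  have hLip : LipschitzOnWith K (T.alphaField α) (Metric.ball r ε) :=
    hK.mono fun x hx => (hball hx).1.1
  refine ⟨ε / 3, by positivity, fun r₀ hr₀ hd => ?_⟩
  obtain ⟨u, hu0, hub, hu, hlim⟩ := exists_stable_flow hε (half_pos hm) hLip h0
    (fun x hx => T.inner_alphaField α (hball hx).1.2.1) (fun x hx => (hball hx).2)
    (hr₀.trans hr1.symm) hd
  refine ⟨u, hu0, isAlphaFlowOn_iff.2 fun t ht => ⟨(hball (hub t ht)).1.2, hu t ht⟩, ?_, hlim⟩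
  intro b ρ hρ0 hρ
  exact eqOn_of_solution hLip (fun t ht => (hu t ht.1).mono Set.Ico_subset_Ici_self)
    (fun t ht => hub t ht.1) (fun t ht => (isAlphaFlowOn_iff.1 hρ t ht).2) (hρ0.trans hu0.symm)

end Triangulation

end SpherePacking

end

theorem mainTheorem5 {V M H : Type*} [Fintype V] [TopologicalSpace M] [CompactSpace M]
    [T2Space M] [ConnectedSpace M] [TopologicalSpace H]
    (I : ModelWithCorners ℝ (EuclideanSpace ℝ (Fin 3)) H) [ChartedSpace H M] [IsManifold I 0 M]
    (T : SpherePacking.Triangulation V M) (α : ℝ) (rstar : EuclideanSpace ℝ V)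
    (hsphere : rstar ∈ Metric.sphere (0 : EuclideanSpace ℝ V) 1)
    (hconst : T.IsConstAlphaMetric α rstar) :
    (α * T.sAlpha α rstar ≤ 0 → α * T.sAlpha α rstar < T.lambdaOne α rstar) ∧
    (α * T.sAlpha α rstar < T.lambdaOne α rstar →
      ∃ δ > 0, ∀ r₀ ∈ Metric.sphere (0 : EuclideanSpace ℝ V) 1, ‖r₀ - rstar‖ < δ →
        ∃ r : ℝ → EuclideanSpace ℝ V,
          r 0 = r₀ ∧ T.IsAlphaFlowOn α (Set.Ici 0) r ∧
          (∀ (b : ℝ) (ρ : ℝ → EuclideanSpace ℝ V), ρ 0 = r₀ →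
            T.IsAlphaFlowOn α (Set.Ico 0 b) ρ → Set.EqOn ρ r (Set.Ico 0 b)) ∧
          Tendsto r atTop (𝓝 rstar)) := by
  rw [mem_sphere_zero_iff_norm] at hsphere
  refine ⟨fun h => h.trans_lt (SpherePacking.Triangulation.lambdaOne_spec hconst.1 α).1,
    fun h => ?_⟩
  obtain ⟨δ, hδ, hflow⟩ := hconst.exists_flow_tendsto hsphere h
  exact ⟨δ, hδ, fun r₀ hr₀ => hflow r₀ (mem_sphere_zero_iff_norm.1 hr₀)⟩
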